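/- **Model.** Let $d\ge 1$, $\rho>0$. Entities $e_1,\dots,e_n$ are closed balls of radius $\rho$ in $\mathbb R^d$ with centres $\zeta_i(t)$, $t\ge 0$, moving with speed at most $1$, such that all separations $\|\zeta_i(t)-\zeta_j(t)\|-2\rho$ $(i\ne j)$ are non-negative. A query scheme assigns to each entity a set of query times in $[0,\infty)$, finitely many in bounded time. If $p$ is the time of the last query to $e_i$ prior to $t$, the uncertainty region $u_i(t)$ is the closed ball with centre $\zeta_i(p)$ and radius $\rho+t-p$ (all of $\mathbb R^d$ if there was no such query). The uncertainty degree at time $t$ is $\max_i\#\{j: u_i(t)\cap u_j(t)\neq\emptyset\}$ (with $j=i$ counted); the uncertainty ply at time $t$ is the maximum number of regions $u_i(t)$ with a common point. Let $\sigma_i(y,t)$ be the separation at time $t$ between $e_i$ and its $y$-th closest other entity, and $\tilde\sigma_i(y,t)$ the same quantity computed from the locations of the entities at their most recent queries. The stationary frequency demand at time $t$ is $\phi_y(t)=\sum_i 1/\sigma_i(y,t)$, and $\phi_y(T)=\int_T\phi_y(t)\,dt$. Let $c_{d,x}$ be the least $c\ge0$ such that a unit ball $B$ in $\mathbb R^d$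 belongs to a family of $x$ unit balls with disjoint interiors, all others at separation at most $c$ from $B$; let $\hat x_d$ be the largest $x$ with $c_{d,x}=0$, and $\lambda_{d,x}=c_{d,x}/(1+c_{d,x})$. **Refined BucketScheme$[y]$ from time $t_0$.** A bucket of length $2^b$ is an interval $[i2^b,(i+1)2^b)$, with $b,i$ integers. To schedule $e_j$ in a bucket $B$: if no entity is assigned to $B$, assign $e_j$ to $B$; if $e_i$ is assigned to $B$, unassign it, then recursively schedule $e_i$ in the first half of $B$ and then $e_j$ in the second half of $B$. At time $t_0$ the following is assumed for all $i$, where $p_i$ is the last query time of $e_i$ before $t_0$: $\tfrac12\sigma_i(y,t_0)\le\tilde\sigma_i(y,t_0)\le\tfrac32\sigma_i(y,t_0)$ and $t_0-p_i\le\lambda_{d,y}\tilde\sigma_i(y,t_0)/12$. Initially the entities are scheduled one after the other, $e_j$ in the first bucket of length $2^b$ starting after $t_0$, $b=\lfloor\log_2(\tfrac{\lambda_{d,y}}{24}\tilde\sigma_j(y,t_0))\rfloor$. Then repeatedly: the entity $e_j$ whose bucket has the earliest midpoint $t$ is queried at time $t$, leaves its bucket, and is scheduled in the next bucket of length $2^b$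 starting after $t+2^b$, where $b=\lfloor\log_2(\tfrac{\lambda_{d,y}}{24}\tilde\sigma_j(y,t))\rfloor$ is computed just after the query. **Theorem.** For every $d\ge1$ there are constants $K,C,c>0$, depending only on $d$, such that the following holds for all $\rho>0$, all integers $x>\hat x_d$, all real $\beta\ge0$, all $n>y:=\lfloor(1+\beta)x\rfloor$, all such motions of $n$ entities, all $t_0$ and all initial queries before $t_0$ that satisfy the precondition above. The refined BucketScheme$[y]$ from time $t_0$ is well defined (it has a run), and in each run, with $N(T)$ the number of queries made over $T$ (initial ones included): 1. At all times $t\ge t_0$ the uncertainty degree, and hence the ply, is at most $(1+\beta)x$. 2. Let $T=[s,s+L]$ with $s\ge t_0$, $L>0$ be sufficiently large, in the sense that $\phi_y(T)\ge Kn$, and let $\overrightarrow T=T+L/2^{55}$. For every query scheme (even a clairvoyant one) that keeps the ply at most $x$ over $T\cup\overrightarrow T$, with $N'(\cdot)$ its number of queries, $$N(T)\le C\,x\,\max\{N'(T),N'(\overrightarrow T)\}\ \text{ if }\beta=0,\qquad N(T)\le C\,\tfrac{1+\beta}{\beta}\max\{N'(T),N'(\overrightarrow T)\}\ \text{ if }\beta>0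 .$$ 3. The query granularity is at all times at least inversely proportional to the stationary frequency demand: if $\tau<\tau'$ are consecutive query times of the run, then $\tau'-\tau\ge c/\phi_y(t)$ for all $t\in[\tau,\tau']$. Moreover, the average granularity over every sufficiently large interval is inversely proportional to the average stationary frequency demand: $c\,\phi_y(T)\le N(T)\le C\,\phi_y(T)$ for every $T$ as in 2. -/

import Mathlib

namespace BucketModel

/-- `d`-dimensional Euclidean space. -/
abbrev Space (d : ℕ) : Type := EuclideanSpace ℝ (Fin d)

/-! ### Configurations of `n` balls of radius `ρ` -/

/-- The separation between the balls of radius `ρ` centred at `Z i` and `Z j`. -/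
noncomputable def sep {d n : ℕ} (ρ : ℝ) (Z : Fin n → Space d) (i j : Fin n) : ℝ :=
  dist (Z i) (Z j) - 2 * ρ

/-- The `x`-separation of entity `i` in the configuration `Z`: the separation between `i` and
its `x`-th closest neighbour, `i` itself not counted (meaningful for `1 ≤ x < n`). -/
noncomputable def xSep {d n : ℕ} (ρ : ℝ) (Z : Fin n → Space d) (x : ℕ) (i : Fin n) : ℝ :=
  sInf {s : ℝ | x ≤ {j : Fin n | j ≠ i ∧ sep ρ Z i j ≤ s}.ncard}

/-! ### The packing constants -/

/-- The smallest `c` such that a unit ball (centred at the origin) belongs to a family of `x` unit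
balls with disjoint interiors whose other members have separation at most `c` from it. -/
noncomputable def packingSep (d x : ℕ) : ℝ :=
  sInf {c : ℝ | 0 ≤ c ∧ ∃ P : Finset (Space d), P.card = x ∧ 0 ∈ P ∧
    (∀ u ∈ P, ∀ v ∈ P, u ≠ v → 2 ≤ dist u v) ∧ ∀ u ∈ P, u ≠ 0 → dist u 0 - 2 ≤ c}

/-- The largest `x` for which `packingSep d x = 0`. -/
noncomputable def xHat (d : ℕ) : ℕ := sSup {x : ℕ | packingSep d x = 0}

/-- The constant `λ = c / (1 + c)`, where `c = packingSep d x`. -/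
noncomputable def lam (d x : ℕ) : ℝ := packingSep d x / (1 + packingSep d x)

/-! ### Moving entities -/

/-- The configuration at time `t` of entities moving along the trajectories `ζ`. -/
def config {d n : ℕ} (ζ : Fin n → ℝ → Space d) (t : ℝ) : Fin n → Space d := fun i => ζ i t

/-- Admissible motions on the time axis `[0, ∞)`: every entity has speed at most one, and two
entities (closed balls of radius `ρ`) never properly intersect. -/
structure IsMotion {d n : ℕ} (ρ : ℝ) (ζ : Fin n → ℝ → Space d) : Prop where
  speed : ∀ i, ∀ s ≥ 0, ∀ t ≥ 0, dist (ζ i s) (ζ i t) ≤ |s - t|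
  separated : ∀ t ≥ 0, ∀ i j, i ≠ j → 0 ≤ sep ρ (config ζ t) i j

/-- The stationary frequency demand of the configuration at time `t`. -/
noncomputable def demand {d n : ℕ} (ρ : ℝ) (ζ : Fin n → ℝ → Space d) (x : ℕ) (t : ℝ) : ℝ :=
  ∑ i, 1 / xSep ρ (config ζ t) x i

/-- The intrinsic frequency demand over the time interval `[s, e]`. -/
noncomputable def intervalDemand {d n : ℕ} (ρ : ℝ) (ζ : Fin n → ℝ → Space d) (x : ℕ)
    (s e : ℝ) : ℝ :=
  ∑ i, ∫ t in s..e, 1 / xSep ρ (config ζ t) x i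

/-! ### Query schemes and uncertainty -/

/-- A query scheme: `Q i` is the set of times at which entity `i` is queried. -/
abbrev Scheme (n : ℕ) : Type := Fin n → Set ℝ

/-- Queries are made at non-negative times, finitely many in bounded time. -/
def IsScheme {n : ℕ} (Q : Scheme n) : Prop :=
  ∀ i, Q i ⊆ Set.Ici 0 ∧ ∀ b : ℝ, (Q i ∩ Set.Iic b).Finite

/-- The total number of queries made over a set `T` of times. -/
noncomputable def queryCount {n : ℕ} (Q : Scheme n) (T : Set ℝ) : ℕ :=
  ∑ i, (Q i ∩ T).ncard

/-- `p` is the time of the last query prior to `t`, among the query times `q`. -/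
def IsLastQuery (q : Set ℝ) (t p : ℝ) : Prop := IsGreatest {s : ℝ | s ∈ q ∧ s < t} p

/-- The uncertainty region of entity `i` at time `t`: the closed ball of radius `ρ + (t - p)`
about the location of the entity at the time `p` of its last query prior to `t`; the whole space
if there was no such query. -/
def region {d n : ℕ} (ρ : ℝ) (ζ : Fin n → ℝ → Space d) (Q : Scheme n) (t : ℝ) (i : Fin n) :
    Set (Space d) :=
  {z | ∀ p, IsLastQuery (Q i) t p → dist z (ζ i p) ≤ ρ + (t - p)}

/-- The uncertainty degree at time `t`: the maximum over the entities `i` of the number of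
entities (including `i`) whose uncertainty regions meet that of `i`. -/
noncomputable def degree {d n : ℕ} (ρ : ℝ) (ζ : Fin n → ℝ → Space d) (Q : Scheme n) (t : ℝ) : ℕ :=
  Finset.univ.sup fun i : Fin n =>
    {j : Fin n | (region ρ ζ Q t i ∩ region ρ ζ Q t j).Nonempty}.ncard

/-- The uncertainty ply at time `t`: the maximum number of uncertainty regions with a common
point. -/
noncomputable def ply {d n : ℕ} (ρ : ℝ) (ζ : Fin n → ℝ → Space d) (Q : Scheme n) (t : ℝ) : ℕ :=
  ⨆ z : Space d, {i : Fin n | z ∈ region ρ ζ Q t i}.ncard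

/-! ### Buckets and the scheduling policy -/

/-- The bucket of length `2 ^ exp` with time interval
`[idx * 2 ^ exp, (idx + 1) * 2 ^ exp)`. -/
structure Bucket where
  exp : ℤ
  idx : ℤ

/-- The midpoint of the time interval of a bucket. -/
noncomputable def Bucket.mid (B : Bucket) : ℝ := ((B.idx : ℝ) + 1 / 2) * (2 : ℝ) ^ B.exp

/-- The sub-bucket spanning the first half of the time interval. -/
def Bucket.first (B : Bucket) : Bucket := ⟨B.exp - 1, 2 * B.idx⟩

/-- The sub-bucket spanning the second half of the time interval. -/
def Bucket.second (B : Bucket) : Bucket := ⟨B.exp - 1, 2 * B.idx + 1⟩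

/-- The first bucket of length `2 ^ b` whose time interval starts after time `u`. -/
noncomputable def firstBucketAfter (b : ℤ) (u : ℝ) : Bucket := ⟨b, ⌊u / (2 : ℝ) ^ b⌋ + 1⟩

/-- The bucket each entity is currently assigned to, if any. -/
abbrev Assignment (n : ℕ) : Type := Fin n → Option Bucket

/-- `Schedule A j B A'`: the recursive policy that schedules entity `j` in bucket `B`, called
with the assignment `A`, ends with the assignment `A'`. -/
inductive Schedule {n : ℕ} : Assignment n → Fin n → Bucket → Assignment n → Prop
  | free (A : Assignment n) (j : Fin n) (B : Bucket) (h : ∀ i, A i ≠ some B) :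
      Schedule A j B (Function.update A j (some B))
  | split (A A' A'' : Assignment n) (i j : Fin n) (B : Bucket) (h : A i = some B)
      (h₁ : Schedule (Function.update A i none) i B.first A')
      (h₂ : Schedule A' j B.second A'') : Schedule A j B A''

/-- Entities in a list are scheduled one after the other, entity `j` in the bucket `f j`. -/
inductive ScheduleAll {n : ℕ} (f : Fin n → Bucket) :
    List (Fin n) → Assignment n → Assignment n → Prop
  | nil (A : Assignment n) : ScheduleAll f [] A A
  | cons (j : Fin n) (l : List (Fin n)) (A A' A'' : Assignment n)
      (h₁ : Schedule A j (f j) A') (h₂ : ScheduleAll f l A' A'') : ScheduleAll f (j :: l) A A''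

/-! ### The refined BucketScheme -/

/-- The perceived configuration, when `p i` is the time of the most recent query of entity `i`. -/
def perceived {d n : ℕ} (ζ : Fin n → ℝ → Space d) (p : Fin n → ℝ) : Fin n → Space d :=
  fun i => ζ i (p i)

/-- The exponent `⌊lg ((λ / 24) s)⌋` of the length of the bucket of an entity with perceived
`y`-separation `s`. -/
noncomputable def bucketExp (d y : ℕ) (s : ℝ) : ℤ := ⌊Real.logb 2 (lam d y / 24 * s)⌋

/-- The perception-reality precondition at time `t₀`, when the queries made before `t₀` are those
of `I` and `p i` is the time of the last one to entity `i`: perceived and true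
`y`-separations at time `t₀` are within a factor `1/2 … 3/2` of each other, and every entity has
been queried recently, in comparison with its perceived `y`-separation. -/
structure Precondition {d n : ℕ} (ρ : ℝ) (ζ : Fin n → ℝ → Space d) (y : ℕ) (t₀ : ℝ)
    (I : Scheme n) (p : Fin n → ℝ) : Prop where
  isScheme : IsScheme I
  before : ∀ i, I i ⊆ Set.Iio t₀
  isLast : ∀ i, IsLastQuery (I i) t₀ (p i)
  lower : ∀ i, xSep ρ (config ζ t₀) y i / 2 ≤ xSep ρ (perceived ζ p) y i
  upper : ∀ i, xSep ρ (perceived ζ p) y i ≤ 3 * xSep ρ (config ζ t₀) y i / 2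
  prompt : ∀ i, t₀ - p i ≤ lam d y * xSep ρ (perceived ζ p) y i / 12

/-- The state of the scheme: the times of the most recent queries, and the current assignment of
entities to buckets. -/
structure State (n : ℕ) where
  last : Fin n → ℝ
  bucket : Assignment n

/-- One round of the scheme with parameter `y`: at time `t`, entity `j`, whose bucket has the
earliest midpoint `t`, is queried, leaves its bucket, and is scheduled in the next bucket of length
`2 ^ b` starting after time `t + 2 ^ b`, where `b` is determined by its perceived `y`-separation
just after the query. -/
def Step {d n : ℕ} (ρ : ℝ) (ζ : Fin n → ℝ → Space d) (y : ℕ) (S : State n) (j : Fin n) (t : ℝ)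
    (S' : State n) : Prop :=
  (∃ B, S.bucket j = some B ∧ t = B.mid) ∧
  (∀ i B, S.bucket i = some B → t ≤ B.mid) ∧
  S'.last = Function.update S.last j t ∧
  ∃ b : ℤ, b = bucketExp d y (xSep ρ (perceived ζ S'.last) y j) ∧
    Schedule (Function.update S.bucket j none) j (firstBucketAfter b (t + (2 : ℝ) ^ b)) S'.bucket

/-- A run of the refined BucketScheme with parameter `y` from time `t₀`, where `p` holds the times
of the last queries before `t₀`. The `k`-th query is made to entity `who k` at time `time k`.
Initially the entities are scheduled, in some order, in the first bucket starting after `t₀` of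
the length determined by their perceived `y`-separation. -/
structure BucketRun {d n : ℕ} (ρ : ℝ) (ζ : Fin n → ℝ → Space d) (y : ℕ) (t₀ : ℝ)
    (p : Fin n → ℝ) where
  state : ℕ → State n
  who : ℕ → Fin n
  time : ℕ → ℝ
  init_last : (state 0).last = p
  init_bucket : ∃ order : List (Fin n), order.Nodup ∧ (∀ i, i ∈ order) ∧
    ScheduleAll (fun j => firstBucketAfter (bucketExp d y (xSep ρ (perceived ζ p) y j)) t₀)
      order (fun _ => none) (state 0).bucket
  step : ∀ k, Step ρ ζ y (state k) (who k) (time k) (state (k + 1))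

/-- All queries made: the initial ones `I`, and those of the run. -/
def BucketRun.scheme {d n : ℕ} {ρ : ℝ} {ζ : Fin n → ℝ → Space d} {y : ℕ} {t₀ : ℝ}
    {p : Fin n → ℝ} (R : BucketRun ρ ζ y t₀ p) (I : Scheme n) : Scheme n :=
  fun i => I i ∪ {t : ℝ | ∃ k, R.who k = i ∧ R.time k = t}

end BucketModel

namespace BucketModel

open MeasureTheory
open scoped ENNReal

/-! ### Basic properties of the `x`-separation -/

/-! The basic objects are clusters, sets of more than `y` entities. As `y` exceeds `xHat d`, packing
gives σ ≥ cρ with c = `packingSep d y`, that is, λ(ρ + σ) ≤ σ (`Setup.key`): the size of the balls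
is controlled by separations. By `exists_lam_bound`, λ is bounded below in terms of d alone.

Degree: `BucketRun.recent` shows, by induction over the queries, that in a cluster of diameter at
most 2ρ + E every entity has been queried within the last λE/4. Hence the perceived separation of an
entity just queried is within a factor 1/2 … 3/2 of the true one, and its bucket has length
comparable with λσ. Suppose that more than `y` regions met one of them, and let M be the longest
time since the last query of any of these entities. At that last query they formed a cluster of
extent O(ρ + M), so the scheme would have repeated the query before M had elapsed
(`BucketRun.card_le_of_meet`).

Granularity: only every second call on a bucket is passed on to its halves. So the load of a bucket
is at most its own arrivals plus half the load of its parent, and behind an occupied bucket X there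
are entities, scheduled in buckets Y, with ∑ |X|/|Y| ≥ 1/2 (`Loaded.exists_heavy`). Since σ =
O(|Y|/λ), the demand is at least of order λ/|X|. Successive queries are made at midpoints of
distinct buckets, which differ by at least half the shorter length.

Counting: between successive queries to an entity, the integral of 1/σ lies between λ/132 and 1. So
the number of queries agrees with the demand up to constant factors and an error of at most n
(`BucketRun.queryCount_bounds`).

Clairvoyant schemes: in a cluster around i at most x members can stay unqueried for time κσ_i, since
their regions would all contain the location of i. The other y + 1 - x or more are queried, and the
demand of i is charged to these queries. A query receives only O(y) in total, provided that it is
charged only by entities of comparable scale. The obstacle is clusters of much smaller scale. By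
`ClusteredMotion.dichotomy`, either enough queries at comparable scale occur nearby, or small
clusters persist nearby for time σ_i. In the second case the demand of i is charged to that of the
small entities; by exchanging integrals, all such charges make up at most half of the total demand
and are absorbed (`ClusteredMotion.sum_innerDemand_le`). The demand is therefore O(y / (y + 1 - x))
times the number of queries of the scheme, plus a boundary term that a large K absorbs. -/

lemma bddBelow_xSep {d n : ℕ} (ρ : ℝ) (Z : Fin n → Space d) {x : ℕ} (hx : 1 ≤ x) (i : Fin n) :
    BddBelow {s : ℝ | x ≤ {j : Fin n | j ≠ i ∧ sep ρ Z i j ≤ s}.ncard} := by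
  refine ⟨-2 * ρ, fun s hs => ?_⟩
  have h1 : 0 < {j : Fin n | j ≠ i ∧ sep ρ Z i j ≤ s}.ncard := lt_of_lt_of_le hx hs
  obtain ⟨j, hj⟩ := (Set.ncard_pos (Set.toFinite _)).1 h1
  have h2 : sep ρ Z i j ≤ s := hj.2
  have h3 : 0 ≤ dist (Z i) (Z j) := dist_nonneg
  unfold sep at h2
  linarith

lemma le_ncard_of_finset {n x : ℕ} {p : Fin n → Prop} {F : Finset (Fin n)} (hF : x ≤ F.card)
    (h : ∀ j ∈ F, p j) : x ≤ {j : Fin n | p j}.ncard := by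
  refine hF.trans ?_
  rw [← Set.ncard_coe_finset F]
  exact Set.ncard_le_ncard (fun j hj => h j hj) (Set.toFinite _)

lemma xSep_le_of_card {d n : ℕ} {ρ : ℝ} {Z : Fin n → Space d} {x : ℕ} (hx : 1 ≤ x) {i : Fin n}
    {F : Finset (Fin n)} (hF : x ≤ F.card) {s : ℝ} (h : ∀ j ∈ F, j ≠ i ∧ sep ρ Z i j ≤ s) :
    xSep ρ Z x i ≤ s :=
  csInf_le (bddBelow_xSep ρ Z hx i) (le_ncard_of_finset hF h)

/-- The infimum is attained: the admissible radii form a finite union of closed sets, one for each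
set of `x` other entities. -/
lemma exists_nearest {d n : ℕ} (ρ : ℝ) (Z : Fin n → Space d) {x : ℕ} (hx : 1 ≤ x) (hn : x < n)
    (i : Fin n) :
    ∃ F : Finset (Fin n), F.card = x ∧ ∀ j ∈ F, j ≠ i ∧ sep ρ Z i j ≤ xSep ρ Z x i := by
  classical
  set S : Set ℝ := {s : ℝ | x ≤ {j : Fin n | j ≠ i ∧ sep ρ Z i j ≤ s}.ncard} with hS
  have hcl : IsClosed S := by
    have : S = ⋃ F ∈ Finset.powersetCard x (Finset.univ.erase i),
        {s : ℝ | ∀ j ∈ F, sep ρ Z i j ≤ s} := by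
      ext s
      simp only [hS, Set.mem_ofPred_eq, Set.mem_iUnion, Finset.mem_powersetCard, exists_prop]
      constructor
      · intro h
        rw [Set.ncard_eq_toFinset_card'] at h
        obtain ⟨F, hF, hc⟩ := Finset.exists_subset_card_eq h
        refine ⟨F, ⟨fun j hj => ?_, hc⟩, fun j hj => ?_⟩
        · have := hF hj
          simp only [Set.mem_toFinset, Set.mem_ofPred_eq] at this
          simp [this.1]
        · have := hF hj
          simp only [Set.mem_toFinset, Set.mem_ofPred_eq] at this
          exact this.2
      · rintro ⟨F, ⟨hF, hc⟩, h⟩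
        refine le_ncard_of_finset hc.ge fun j hj => ⟨?_, h j hj⟩
        exact Finset.ne_of_mem_erase (hF hj)
    rw [this]
    refine isClosed_biUnion_finset fun F _ => ?_
    simp only [Set.ofPred_forall]
    exact isClosed_iInter fun j => isClosed_iInter fun _ => isClosed_Ici
  have hne : S.Nonempty := by
    refine ⟨∑ j, |sep ρ Z i j|, ?_⟩
    refine le_ncard_of_finset (F := Finset.univ.erase i) ?_ fun j hj => ⟨Finset.ne_of_mem_erase hj, ?_⟩
    · simp only [Finset.mem_univ, Finset.card_erase_of_mem, Finset.card_univ, Fintype.card_fin]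
      omega
    · exact (le_abs_self _).trans
        (Finset.single_le_sum (f := fun j => |sep ρ Z i j|) (fun _ _ => abs_nonneg _) (Finset.mem_univ j))
  have hmem : xSep ρ Z x i ∈ S := hcl.csInf_mem hne (bddBelow_xSep ρ Z hx i)
  have h : x ≤ {j : Fin n | j ≠ i ∧ sep ρ Z i j ≤ xSep ρ Z x i}.ncard := hmem
  rw [Set.ncard_eq_toFinset_card'] at h
  obtain ⟨F, hF, hc⟩ := Finset.exists_subset_card_eq h
  refine ⟨F, hc, fun j hj => ?_⟩
  have := hF hj
  simpa only [Set.mem_toFinset, Set.mem_ofPred_eq] using this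

lemma xSep_le_add {d n : ℕ} {ρ : ℝ} {Z Z' : Fin n → Space d} {x : ℕ} (hx : 1 ≤ x) (hn : x < n)
    {i : Fin n} {e : ℝ} (h : ∀ j, j ≠ i → sep ρ Z' i j ≤ sep ρ Z i j + e) :
    xSep ρ Z' x i ≤ xSep ρ Z x i + e := by
  obtain ⟨F, hc, hF⟩ := exists_nearest ρ Z hx hn i
  refine xSep_le_of_card hx hc.ge fun j hj => ⟨(hF j hj).1, ?_⟩
  linarith [h j (hF j hj).1, (hF j hj).2]

/-- An entity together with `x` nearest neighbours. -/
lemma exists_cluster {d n : ℕ} (ρ : ℝ) (Z : Fin n → Space d) {x : ℕ} (hx : 1 ≤ x) (hn : x < n)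
    (i : Fin n) :
    ∃ A : Finset (Fin n), A.card = x + 1 ∧ i ∈ A ∧
      ∀ j ∈ A, j ≠ i → sep ρ Z i j ≤ xSep ρ Z x i := by
  classical
  obtain ⟨F, hc, hF⟩ := exists_nearest ρ Z hx hn i
  have hi : i ∉ F := fun h => (hF i h).1 rfl
  refine ⟨insert i F, by rw [Finset.card_insert_of_notMem hi, hc], Finset.mem_insert_self _ _,
    fun j hj hji => ?_⟩
  exact (hF j ((Finset.mem_insert.1 hj).resolve_left hji)).2

/-! ### Packing constants -/

/-- A family of `x` unit balls with disjoint interiors, all within separation `c` of the one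
centred at the origin. -/
def Packs (d x : ℕ) (c : ℝ) : Prop :=
  0 ≤ c ∧ ∃ P : Finset (Space d), P.card = x ∧ 0 ∈ P ∧
    (∀ u ∈ P, ∀ v ∈ P, u ≠ v → 2 ≤ dist u v) ∧ ∀ u ∈ P, u ≠ 0 → dist u 0 - 2 ≤ c

lemma packingSep_eq (d x : ℕ) : packingSep d x = sInf {c | Packs d x c} := rfl

lemma packingSep_le {d x : ℕ} {c : ℝ} (h : Packs d x c) : packingSep d x ≤ c :=
  csInf_le ⟨0, fun _ hc => hc.1⟩ h

lemma packingSep_nonneg (d x : ℕ) : 0 ≤ packingSep d x := Real.sInf_nonneg fun _ hc => hc.1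

lemma Packs.mono {d x x' : ℕ} {c : ℝ} (h : Packs d x c) (h1 : 1 ≤ x') (hx : x' ≤ x) :
    Packs d x' c := by
  classical
  obtain ⟨hc, P, hP, h0, hd, hs⟩ := h
  have h2 : ({0} : Finset (Space d)) ⊆ P := by simpa using h0
  obtain ⟨P', hP1, hP2, hP3⟩ := Finset.exists_subsuperset_card_eq (n := x') h2 (by simpa using h1)
    (by omega)
  exact ⟨hc, P', hP3, hP1 (by simp), fun u hu v hv => hd u (hP2 hu) v (hP2 hv),
    fun u hu => hs u (hP2 hu)⟩

/-- Balls centred at 0, 2, 4, … on a line. Without this, `sInf ∅ = 0` could spoil the monotonicity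
of `packingSep`. -/
lemma exists_packs {d : ℕ} (hd : 1 ≤ d) {x : ℕ} (hx : 1 ≤ x) : ∃ c, Packs d x c := by
  classical
  let f : ℕ → Space d := fun k => EuclideanSpace.single ⟨0, hd⟩ (2 * (k : ℝ))
  have hf : ∀ k l : ℕ, k ≠ l → 2 ≤ dist (f k) (f l) := by
    intro k l hkl
    simp only [f]
    rw [PiLp.dist_single_same, Real.dist_eq, ← mul_sub, abs_mul, abs_two]
    have : (1 : ℝ) ≤ |(k : ℝ) - l| := by
      have h1 : (1 : ℤ) ≤ |(k : ℤ) - l| := Int.one_le_abs (by omega)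
      exact_mod_cast h1
    linarith
  have hinj : Function.Injective f := by
    intro k l hkl
    by_contra h
    have := hf k l h
    rw [hkl, dist_self] at this
    linarith
  have h0 : f 0 = 0 := by simp [f]
  refine ⟨∑ k ∈ Finset.range x, dist (f k) 0, Finset.sum_nonneg fun _ _ => dist_nonneg,
    (Finset.range x).image f, ?_, ?_, ?_, ?_⟩
  · rw [Finset.card_image_of_injective _ hinj, Finset.card_range]
  · exact Finset.mem_image.2 ⟨0, by simp; omega, h0⟩
  · simp only [Finset.mem_image]
    rintro _ ⟨k, _, rfl⟩ _ ⟨l, _, rfl⟩ h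
    exact hf k l fun hkl => h (by rw [hkl])
  · simp only [Finset.mem_image]
    rintro _ ⟨k, hk, rfl⟩ _
    have := Finset.single_le_sum (f := fun k => dist (f k) 0) (fun _ _ => dist_nonneg) hk
    linarith

lemma packingSep_mono {d : ℕ} (hd : 1 ≤ d) {x x' : ℕ} (h1 : 1 ≤ x') (hx : x' ≤ x) :
    packingSep d x' ≤ packingSep d x :=
  csInf_le_csInf ⟨0, fun _ hc => hc.1⟩ (exists_packs hd (h1.trans hx))
    fun _ hc => Packs.mono hc h1 hx

/-- Every ball of radius `C * r` is covered by a number of balls of radius `r` that depends only on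
the dimension and on `C`. -/
lemma exists_cover (d : ℕ) (C : ℝ) :
    ∃ N : ℕ, ∀ (z : Space d) (r : ℝ), 0 < r → ∃ F : Finset (Space d), F.card ≤ N ∧
      ∀ w, dist w z ≤ C * r → ∃ u ∈ F, dist w u < r := by
  classical
  have hc : IsCompact (Metric.closedBall (0 : Space d) C) := isCompact_closedBall _ _
  obtain ⟨t, ht, hcov⟩ := Metric.totallyBounded_iff.1 hc.totallyBounded 1 one_pos
  refine ⟨ht.toFinset.card, fun z r hr => ⟨ht.toFinset.image fun u => z + r • u,
    Finset.card_image_le, fun w hw => ?_⟩⟩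
  have h1 : r⁻¹ • (w - z) ∈ Metric.closedBall (0 : Space d) C := by
    rw [mem_closedBall_zero_iff, norm_smul, Real.norm_of_nonneg (inv_nonneg.2 hr.le), ← dist_eq_norm]
    rw [inv_mul_le_iff₀ hr]
    linarith
  obtain ⟨u, hu, huw⟩ := Set.mem_iUnion₂.1 (hcov h1)
  refine ⟨z + r • u, Finset.mem_image.2 ⟨u, by simpa using hu, rfl⟩, ?_⟩
  rw [Metric.mem_ball] at huw
  have h2 : w = z + r • (r⁻¹ • (w - z)) := by
    rw [smul_smul, mul_inv_cancel₀ hr.ne', one_smul]; abel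
  rw [h2, dist_add_left, dist_smul₀, Real.norm_of_nonneg hr.le]
  calc r * dist (r⁻¹ • (w - z)) u < r * 1 := by gcongr
    _ = r := mul_one r

/-- Centres of balls at separation less than 1 lie within distance 3 of the origin, and a covering
ball of radius 1 contains at most one of them. Boundedness is what makes the `sSup` in `xHat`
meaningful. -/
lemma bddAbove_packingSep_eq_zero {d : ℕ} (hd : 1 ≤ d) : BddAbove {x : ℕ | packingSep d x = 0} := by
  classical
  obtain ⟨N, hN⟩ := exists_cover d 3
  refine ⟨N, fun x hx => ?_⟩
  rcases Nat.eq_zero_or_pos x with h0 | h0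
  · omega
  have h1 : sInf {c | Packs d x c} < 1 := by
    rw [← packingSep_eq, show packingSep d x = 0 from hx]; exact one_pos
  obtain ⟨c, ⟨hc0, P, hP, hP0, hPd, hPs⟩, hc1⟩ := exists_lt_of_csInf_lt (exists_packs hd h0) h1
  obtain ⟨F, hF, hcov⟩ := hN 0 1 one_pos
  have h2 : ∀ u ∈ P, ∃ v ∈ F, dist u v < 1 := by
    intro u hu
    refine hcov u ?_
    by_cases hu0 : u = 0
    · simp [hu0]
    · linarith [hPs u hu hu0]
  choose! g hg hgd using h2
  rw [← hP]
  refine (Finset.card_le_card_of_injOn g hg ?_).trans hF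
  intro u hu v hv huv
  by_contra hne
  have h3 := hPd u hu v hv hne
  have h4 := hgd u hu
  have h5 := hgd v hv
  rw [← huv] at h5
  linarith [dist_triangle_right u v (g u)]

lemma packingSep_pos_of_xHat_lt {d : ℕ} (hd : 1 ≤ d) {x : ℕ} (hx : xHat d < x) :
    0 < packingSep d x := by
  refine lt_of_le_of_ne (packingSep_nonneg d x) fun h => ?_
  have : x ≤ xHat d := le_csSup (bddAbove_packingSep_eq_zero hd) h.symm
  omega

/-- By monotonicity the worst case is x = `xHat d` + 1; the bound `l` is the source of all constants
that depend only on d. -/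
lemma exists_lam_bound {d : ℕ} (hd : 1 ≤ d) :
    ∃ l : ℝ, 0 < l ∧ ∀ x, xHat d < x → l ≤ lam d x ∧ lam d x < 1 := by
  have h0 := packingSep_pos_of_xHat_lt hd (Nat.lt_succ_self (xHat d))
  refine ⟨lam d (xHat d + 1), div_pos h0 (by linarith), fun x hx => ?_⟩
  have h1 := packingSep_mono hd (Nat.succ_le_succ (Nat.zero_le (xHat d))) (show xHat d + 1 ≤ x from hx)
  have h2 := h0.trans_le h1
  refine ⟨?_, ?_⟩
  · unfold lam
    rw [div_le_div_iff₀ (by positivity) (by positivity)]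
    nlinarith
  · unfold lam
    rw [div_lt_one (by positivity)]
    linarith

/-- The separation of an entity is at least that of an optimal packing. -/
lemma packingSep_mul_le_xSep {d n : ℕ} {ρ : ℝ} (hρ : 0 < ρ) {Z : Fin n → Space d} {y : ℕ}
    (hy : 1 ≤ y) (hn : y < n) (hZ : ∀ i j, i ≠ j → 0 ≤ sep ρ Z i j) (i : Fin n) :
    packingSep d y * ρ ≤ xSep ρ Z y i := by
  classical
  obtain ⟨A, hA, hiA, hAs⟩ := exists_cluster ρ Z hy hn i
  have hA1 : ∃ j ∈ A, j ≠ i := Finset.exists_mem_ne (by omega) i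
  obtain ⟨j, hj, hji⟩ := hA1
  have hs0 : 0 ≤ xSep ρ Z y i := (hZ i j hji.symm).trans (hAs j hj hji)
  -- Entity `i` is moved to the origin and the radii are scaled to 1.
  let f : Fin n → Space d := fun j => ρ⁻¹ • (Z j - Z i)
  have hf : ∀ j k, dist (f j) (f k) = dist (Z j) (Z k) / ρ := by
    intro j k
    simp only [f]
    rw [dist_smul₀, dist_sub_right, Real.norm_of_nonneg (inv_nonneg.2 hρ.le)]
    field_simp
  have hf2 : ∀ j k, j ≠ k → 2 ≤ dist (f j) (f k) := by
    intro j k hjk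
    rw [hf, le_div_iff₀ hρ]
    have := hZ j k hjk
    unfold sep at this
    linarith
  have hinj : Function.Injective f := by
    intro k l hkl
    by_contra h
    have := hf2 k l h
    rw [hkl, dist_self] at this
    linarith
  have hf0 : f i = 0 := by simp [f]
  have hp : Packs d (y + 1) (xSep ρ Z y i / ρ) := by
    refine ⟨by positivity, A.image f, by rw [Finset.card_image_of_injective _ hinj, hA],
      Finset.mem_image.2 ⟨i, hiA, hf0⟩, ?_, ?_⟩
    · simp only [Finset.mem_image]
      rintro _ ⟨k, _, rfl⟩ _ ⟨l, _, rfl⟩ h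
      exact hf2 k l fun hkl => h (by rw [hkl])
    · simp only [Finset.mem_image]
      rintro _ ⟨k, hk, rfl⟩ hk0
      have hki : k ≠ i := fun h => hk0 (by rw [h, hf0])
      rw [← hf0, hf, div_sub' hρ.ne', dist_comm]
      have := hAs k hk hki
      unfold sep at this
      gcongr
      linarith
  -- The cluster has y + 1 members, as `xSep` does not count `i` itself; one of them is dropped.
  have := packingSep_le (hp.mono hy (Nat.le_succ y))
  rwa [le_div_iff₀ hρ] at this

/-- The standing assumptions: an admissible motion of more than `y` entities, where `y` is large
enough for `y` of them never to be close together. -/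
structure Setup {d n : ℕ} (ρ : ℝ) (ζ : Fin n → ℝ → Space d) (y : ℕ) : Prop where
  motion : IsMotion ρ ζ
  rho_pos : 0 < ρ
  one_le : 1 ≤ y
  lt : y < n
  lam_pos : 0 < lam d y
  lam_lt : lam d y < 1
  key : ∀ t ≥ 0, ∀ i, lam d y * (ρ + xSep ρ (config ζ t) y i) ≤ xSep ρ (config ζ t) y i

/-- The field `key` is equivalent to σ ≥ cρ, because λ = c / (1 + c). -/
lemma Setup.of_xHat_lt {d n : ℕ} (hd : 1 ≤ d) {ρ : ℝ} {ζ : Fin n → ℝ → Space d} {y : ℕ}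
    (hρ : 0 < ρ) (hy : xHat d < y) (hn : y < n) (h : IsMotion ρ ζ) : Setup ρ ζ y := by
  obtain ⟨l, hl, hlam⟩ := exists_lam_bound hd
  have hp := packingSep_pos_of_xHat_lt hd hy
  refine ⟨h, hρ, by omega, hn, hl.trans_le (hlam y hy).1, (hlam y hy).2, fun t ht i => ?_⟩
  have := packingSep_mul_le_xSep hρ (by omega) hn (h.separated t ht) i
  unfold lam
  rw [div_mul_eq_mul_div, div_le_iff₀ (by positivity)]
  nlinarith

section Setup

variable {d n : ℕ} {ρ : ℝ} {ζ : Fin n → ℝ → Space d} {y : ℕ}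

lemma Setup.xSep_pos (h : Setup ρ ζ y) {t : ℝ} (ht : 0 ≤ t) (i : Fin n) :
    0 < xSep ρ (config ζ t) y i := by
  have h1 := h.key t ht i
  have h2 := mul_pos h.lam_pos h.rho_pos
  have h3 := h.lam_lt
  nlinarith

lemma Setup.xSep_lower (h : Setup ρ ζ y) {t : ℝ} (ht : 0 ≤ t) (i : Fin n) :
    lam d y * ρ ≤ xSep ρ (config ζ t) y i := by
  have h1 := h.key t ht i
  have h2 := mul_pos h.lam_pos (h.xSep_pos ht i)
  nlinarith

lemma Setup.xSep_lipschitz (h : Setup ρ ζ y) {s t : ℝ} (hs : 0 ≤ s) (ht : 0 ≤ t) (i : Fin n) :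
    xSep ρ (config ζ t) y i ≤ xSep ρ (config ζ s) y i + 2 * |s - t| := by
  refine xSep_le_add h.one_le h.lt fun j _ => ?_
  have h1 := h.motion.speed i s hs t ht
  have h2 := h.motion.speed j s hs t ht
  have h3 := dist_triangle4 (ζ i t) (ζ i s) (ζ j s) (ζ j t)
  rw [dist_comm (ζ i t) (ζ i s)] at h3
  simp only [sep, config]
  linarith

/-- Cluster members have comparable separation. -/
lemma Setup.xSep_neighbour (h : Setup ρ ζ y) {t : ℝ} {i : Fin n}
    {A : Finset (Fin n)} (hA : y + 1 ≤ A.card) {D : ℝ}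
    (hD : ∀ k ∈ A, ∀ l ∈ A, dist (ζ k t) (ζ l t) ≤ 2 * ρ + D) (hi : i ∈ A) :
    xSep ρ (config ζ t) y i ≤ D := by
  classical
  refine xSep_le_of_card h.one_le (F := A.erase i) (by rw [Finset.card_erase_of_mem hi]; omega)
    fun j hj => ⟨Finset.ne_of_mem_erase hj, ?_⟩
  have := hD i hi j (Finset.mem_of_mem_erase hj)
  simp only [sep, config]
  linarith

end Setup

/-! ### Geometry of buckets -/

/-- The length of a bucket. -/
noncomputable def Bucket.len (B : Bucket) : ℝ := (2 : ℝ) ^ B.exp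

/-- The beginning of the time interval of a bucket. -/
noncomputable def Bucket.start (B : Bucket) : ℝ := (B.idx : ℝ) * (2 : ℝ) ^ B.exp

/-- The end of the time interval of a bucket. -/
noncomputable def Bucket.finish (B : Bucket) : ℝ := ((B.idx : ℝ) + 1) * (2 : ℝ) ^ B.exp

/-- The bucket of twice the length that contains a given one. -/
def Bucket.parent (B : Bucket) : Bucket := ⟨B.exp + 1, B.idx / 2⟩

/-- Inclusion of the time intervals of buckets. -/
def Within (X B : Bucket) : Prop := B.start ≤ X.start ∧ X.finish ≤ B.finish

lemma Bucket.len_pos (B : Bucket) : 0 < B.len := zpow_pos two_pos _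

lemma Bucket.finish_eq (B : Bucket) : B.finish = B.start + B.len := by
  simp only [finish, start, len]; ring

lemma Bucket.mid_eq (B : Bucket) : B.mid = B.start + B.len / 2 := by
  simp only [mid, start, len]; ring

lemma Bucket.half_exp (B : Bucket) : (2 : ℝ) ^ (B.exp - 1) = (2 : ℝ) ^ B.exp / 2 := by
  rw [zpow_sub_one₀ two_ne_zero]; ring

lemma Bucket.len_first (B : Bucket) : B.first.len = B.len / 2 := B.half_exp

lemma Bucket.len_second (B : Bucket) : B.second.len = B.len / 2 := B.half_exp

lemma Bucket.start_first (B : Bucket) : B.first.start = B.start := by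
  simp only [start, first, B.half_exp]; push_cast; ring

lemma Bucket.start_second (B : Bucket) : B.second.start = B.start + B.len / 2 := by
  simp only [start, second, len, B.half_exp]; push_cast; ring

lemma Within.refl (B : Bucket) : Within B B := ⟨le_rfl, le_rfl⟩

lemma Within.trans {X Y Z : Bucket} (h : Within X Y) (h' : Within Y Z) : Within X Z :=
  ⟨h'.1.trans h.1, h.2.trans h'.2⟩

lemma within_first (B : Bucket) : Within B.first B := by
  have := B.len_pos
  constructor
  · rw [B.start_first]
  · rw [B.first.finish_eq, B.finish_eq, B.start_first, B.len_first]; linarith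

lemma within_second (B : Bucket) : Within B.second B := by
  have := B.len_pos
  constructor
  · rw [B.start_second]; linarith
  · rw [B.second.finish_eq, B.finish_eq, B.start_second, B.len_second]; linarith

lemma Within.len_le {X B : Bucket} (h : Within X B) : X.len ≤ B.len := by
  have h1 := h.1
  have h2 := h.2
  rw [X.finish_eq, B.finish_eq] at h2
  linarith

lemma not_within_first (B : Bucket) : ¬ Within B B.first := fun h => by
  have := h.len_le
  rw [B.len_first] at this
  linarith [B.len_pos]

lemma not_within_second (B : Bucket) : ¬ Within B B.second := fun h => by
  have := h.len_le
  rw [B.len_second] at this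
  linarith [B.len_pos]

lemma not_within_both {X B : Bucket} (h : Within X B.first) (h' : Within X B.second) : False := by
  have h1 := h.2
  have h2 := h'.1
  rw [X.finish_eq, B.first.finish_eq, B.start_first, B.len_first] at h1
  rw [B.start_second] at h2
  linarith [X.len_pos]

lemma Within.exp_le {X B : Bucket} (h : Within X B) : X.exp ≤ B.exp :=
  (zpow_le_zpow_iff_right₀ one_lt_two).1 h.len_le

lemma Within.mid_mem {X B : Bucket} (h : Within X B) : B.start < X.mid ∧ X.mid < B.finish := by
  have h1 := h.1
  have h2 := h.2
  rw [X.finish_eq] at h2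
  rw [X.mid_eq]
  constructor <;> linarith [X.len_pos]

lemma Bucket.eq_first_or_second_parent (B : Bucket) :
    B = B.parent.first ∨ B = B.parent.second := by
  rcases B with ⟨e, i⟩
  simp only [parent, first, second, mk.injEq]
  omega

lemma within_parent (B : Bucket) : Within B B.parent := by
  rcases B.eq_first_or_second_parent with h | h
  · conv_lhs => rw [h]
    exact within_first _
  · conv_lhs => rw [h]
    exact within_second _

lemma Bucket.len_parent (B : Bucket) : B.parent.len = 2 * B.len := by
  simp only [parent, len]
  rw [zpow_add_one₀ two_ne_zero]; ring

/-- Buckets of the same exponent are separated in time by at least their length, and so are, up to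
a factor of two, the midpoints of different buckets. -/
lemma exists_len_le_of_mid_lt {X Y : Bucket} (h : X.mid < Y.mid) :
    X.len / 2 ≤ Y.mid - X.mid ∨ Y.len / 2 ≤ Y.mid - X.mid := by
  -- Both midpoints are integer multiples of half the shorter length, so a positive difference is at
  -- least that much.
  have key : ∀ a b e : ℤ, ∀ m : ℕ, 0 < ((a : ℝ) - b * 2 ^ m) * 2 ^ e → 
      (2 : ℝ) ^ e ≤ ((a : ℝ) - b * 2 ^ m) * 2 ^ e := by
    intro a b e m h
    have h1 : 0 < (a : ℝ) - b * 2 ^ m := (pos_iff_pos_of_mul_pos h).2 (zpow_pos two_pos _)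
    have h2 : (0 : ℤ) < a - b * 2 ^ m := by exact_mod_cast h1
    have h3 : (1 : ℝ) ≤ (a : ℝ) - b * 2 ^ m := by exact_mod_cast (show (1 : ℤ) ≤ a - b * 2 ^ m by omega)
    have : (0 : ℝ) < 2 ^ e := zpow_pos two_pos _
    nlinarith
  have hX : ∀ Z : Bucket, Z.mid = ((2 * Z.idx + 1 : ℤ) : ℝ) * (2 : ℝ) ^ (Z.exp - 1) := by
    intro Z
    rw [Z.half_exp, Bucket.mid]; push_cast; ring
  rcases le_total X.exp Y.exp with hle | hle
  · left
    obtain ⟨m, hm⟩ := Int.eq_ofNat_of_zero_le (sub_nonneg.2 hle)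
    have h1 : (2 : ℝ) ^ (Y.exp - 1) = 2 ^ m * 2 ^ (X.exp - 1) := by
      rw [← zpow_natCast, ← zpow_add₀ two_ne_zero]; congr 1; omega
    rw [hX X, hX Y, h1] at h ⊢
    have h2 := key (-(2 * X.idx + 1)) (-(2 * Y.idx + 1)) (X.exp - 1) m (by push_cast at h ⊢; linarith)
    rw [Bucket.len, ← X.half_exp]
    push_cast at h2 ⊢
    linarith
  · right
    obtain ⟨m, hm⟩ := Int.eq_ofNat_of_zero_le (sub_nonneg.2 hle)
    have h1 : (2 : ℝ) ^ (X.exp - 1) = 2 ^ m * 2 ^ (Y.exp - 1) := by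
      rw [← zpow_natCast, ← zpow_add₀ two_ne_zero]; congr 1; omega
    rw [hX X, hX Y, h1] at h ⊢
    have h2 := key (2 * Y.idx + 1) (2 * X.idx + 1) (Y.exp - 1) m (by push_cast at h ⊢; linarith)
    rw [Bucket.len, ← Y.half_exp]
    push_cast at h2 ⊢
    linarith

/-- A midpoint is an odd multiple of 2^(exp - 1), so its 2-adic valuation reveals the exponent. -/
lemma Bucket.mid_injective : Function.Injective Bucket.mid := by
  have key : ∀ X Y : Bucket, X.exp ≤ Y.exp → X.mid = Y.mid → X = Y := by
    intro X Y hle h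
    have hX : ∀ Z : Bucket, Z.mid = ((2 * Z.idx + 1 : ℤ) : ℝ) * (2 : ℝ) ^ (Z.exp - 1) := by
      intro Z
      rw [Z.half_exp, Bucket.mid]; push_cast; ring
    obtain ⟨m, hm⟩ := Int.eq_ofNat_of_zero_le (sub_nonneg.2 hle)
    have h1 : (2 : ℝ) ^ (Y.exp - 1) = 2 ^ m * 2 ^ (X.exp - 1) := by
      rw [← zpow_natCast, ← zpow_add₀ two_ne_zero]; congr 1; omega
    rw [hX X, hX Y, h1, ← mul_assoc] at h
    have h2 := mul_right_cancel₀ (zpow_pos (two_pos (α := ℝ)) _).ne' h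
    have h3 : 2 * X.idx + 1 = (2 * Y.idx + 1) * 2 ^ m := by exact_mod_cast h2
    have hm0 : m = 0 := by
      by_contra hm0
      obtain ⟨k, rfl⟩ := Nat.exists_eq_succ_of_ne_zero hm0
      rw [pow_succ, ← mul_assoc] at h3
      omega
    rw [hm0] at h3 hm
    rcases X with ⟨e, i⟩
    rcases Y with ⟨e', i'⟩
    simp only [Bucket.mk.injEq] at *
    constructor
    · push_cast at hm; omega
    · simp at h3; omega
  intro X Y h
  rcases le_total X.exp Y.exp with hle | hle
  · exact key X Y hle h
  · exact (key Y X hle h.symm).symm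

lemma firstBucketAfter_start (b : ℤ) (u : ℝ) :
    u < (firstBucketAfter b u).start ∧ (firstBucketAfter b u).start ≤ u + 2 ^ b := by
  have hb : (0 : ℝ) < 2 ^ b := zpow_pos two_pos _
  simp only [firstBucketAfter, Bucket.start]
  push_cast
  constructor
  · rw [← div_lt_iff₀ hb]
    exact Int.lt_floor_add_one _
  · have := Int.floor_le (u / (2 : ℝ) ^ b)
    rw [le_div_iff₀ hb] at this
    linarith

lemma firstBucketAfter_len (b : ℤ) (u : ℝ) : (firstBucketAfter b u).len = 2 ^ b := rfl

/-! ### The scheduling policy -/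

section Schedule

variable {n : ℕ}

/-- No two entities are assigned to the same bucket. -/
def Inj (A : Assignment n) : Prop := ∀ i k B, A i = some B → A k = some B → i = k

lemma Inj.update_none {A : Assignment n} (h : Inj A) (i : Fin n) :
    Inj (Function.update A i none) := by
  intro k l B hk hl
  by_cases hki : k = i
  · subst hki; simp at hk
  by_cases hli : l = i
  · subst hli; simp at hl
  rw [Function.update_of_ne hki] at hk
  rw [Function.update_of_ne hli] at hl
  exact h k l B hk hl

/-- Scheduling in `B` moves other entities only from sub-buckets of `B`, to sub-buckets of their
own buckets. -/
def Moves (A A' : Assignment n) (B : Bucket) (i : Fin n) : Prop :=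
  A' i = A i ∨ ∃ Y X, A i = some Y ∧ Within Y B ∧ A' i = some X ∧ Within X Y

/-- This is what keeps an entity, however often it is displaced, inside the bucket in which it was
first scheduled. -/
lemma Schedule.frame {A A' : Assignment n} {j : Fin n} {B : Bucket} (h : Schedule A j B A')
    (hj : A j = none) :
    (∃ X, A' j = some X ∧ Within X B) ∧ ∀ i, i ≠ j → Moves A A' B i := by
  induction h with
  | free A j B h =>
    exact ⟨⟨B, by simp, Within.refl B⟩, fun i hi => Or.inl (by rw [Function.update_of_ne hi])⟩
  | split A A' A'' i j B h h₁ h₂ ih₁ ih₂ =>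
    have hij : j ≠ i := by rintro rfl; rw [hj] at h; simp at h
    obtain ⟨⟨X₁, hX₁, hw₁⟩, hm₁⟩ := ih₁ (by simp)
    have hj' : A' j = none := by
      rcases hm₁ j hij with h' | ⟨Y, X, h', -⟩
      · rw [h', Function.update_of_ne hij, hj]
      · rw [Function.update_of_ne hij, hj] at h'; simp at h'
    obtain ⟨⟨X₂, hX₂, hw₂⟩, hm₂⟩ := ih₂ hj'
    refine ⟨⟨X₂, hX₂, hw₂.trans (within_second B)⟩, fun k hk => ?_⟩
    have hm1 : Moves A A' B k := by
      by_cases hki : k = i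
      · subst hki
        exact Or.inr ⟨B, X₁, h, Within.refl B, hX₁, hw₁.trans (within_first B)⟩
      · rcases hm₁ k hki with h' | ⟨Y, X, hY, hw, hX, hw'⟩
        · left; rw [h', Function.update_of_ne hki]
        · rw [Function.update_of_ne hki] at hY
          exact Or.inr ⟨Y, X, hY, hw.trans (within_first B), hX, hw'⟩
    rcases hm₂ k hk with h' | ⟨Y, X, hY, hw, hX, hw'⟩
    · rw [Moves, h']; exact hm1
    · rcases hm1 with h'' | ⟨Y', X', hY', hw'', hX', hw'''⟩
      · rw [h''] at hY
        exact Or.inr ⟨Y, X, hY, hw.trans (within_second B), hX, hw'⟩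
      · rw [hX', Option.some_inj] at hY
        subst hY
        exact Or.inr ⟨Y', X, hY', hw'', hX, hw'.trans hw'''⟩

lemma Schedule.none_of_ne {A A' : Assignment n} {i j : Fin n} {B : Bucket} (h : Schedule A i B A')
    (hi : A i = none) (hij : j ≠ i) (hj : A j = none) : A' j = none := by
  rcases (h.frame hi).2 j hij with h' | ⟨Y, X, h', -⟩
  · rw [h', hj]
  · rw [hj] at h'; simp at h'

lemma Schedule.eq_some_of_not_within {A A' : Assignment n} {i j : Fin n} {B Y : Bucket}
    (h : Schedule A j B A') (hj : A j = none) (hY : ¬ Within Y B) (hi : A' i = some Y) :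
    A i = some Y := by
  obtain ⟨⟨X, hX, hw⟩, hm⟩ := h.frame hj
  by_cases hij : i = j
  · subst hij
    rw [hX, Option.some_inj] at hi
    exact absurd (hi ▸ hw) hY
  · rcases hm i hij with h' | ⟨Y', X', hY', hw', hX', hw''⟩
    · rw [← h', hi]
    · rw [hX', Option.some_inj] at hi
      exact absurd (hi ▸ hw''.trans hw') hY

lemma Schedule.inj {A A' : Assignment n} {j : Fin n} {B : Bucket} (h : Schedule A j B A')
    (hj : A j = none) (hA : Inj A) : Inj A' := by
  induction h with
  | free A j B h =>
    intro k l Y hk hl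
    by_cases hkj : k = j
    · by_cases hlj : l = j
      · rw [hkj, hlj]
      · subst hkj
        rw [Function.update_of_ne hlj] at hl
        simp only [Function.update_self, Option.some_inj] at hk
        exact absurd (hk ▸ hl) (h l)
    · by_cases hlj : l = j
      · subst hlj
        rw [Function.update_of_ne hkj] at hk
        simp only [Function.update_self, Option.some_inj] at hl
        exact absurd (hl ▸ hk) (h k)
      · rw [Function.update_of_ne hkj] at hk
        rw [Function.update_of_ne hlj] at hl
        exact hA k l Y hk hl
  | split A A' A'' i j B h h₁ h₂ ih₁ ih₂ =>
    have hij : j ≠ i := by rintro rfl; rw [hj] at h; simp at h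
    exact ih₂ (h₁.none_of_ne (by simp) hij (by rw [Function.update_of_ne hij, hj]))
      (ih₁ (by simp) (hA.update_none i))

/-- The recursive scheduling policy terminates. -/
lemma exists_schedule (A : Assignment n) (j : Fin n) (B : Bucket) (hj : A j = none) :
    ∃ A', Schedule A j B A' := by
  classical
  -- The measure is the number of entities inside `B`. The occupant `i` of `B` drops out of the
  -- count for both recursive calls: the first acts after `i` has been unassigned, and the second
  -- sees only entities of the second half, which the first call leaves alone.
  suffices H : ∀ m : ℕ, ∀ (A : Assignment n) (j : Fin n) (B : Bucket), A j = none →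
      (Finset.univ.filter fun i => ∃ Y, A i = some Y ∧ Within Y B).card ≤ m →
      ∃ A', Schedule A j B A' from H _ A j B hj le_rfl
  intro m
  induction m with
  | zero =>
    intro A j B hj hm
    refine ⟨_, Schedule.free A j B fun i hi => ?_⟩
    rw [Nat.le_zero, Finset.card_eq_zero] at hm
    have : i ∈ Finset.univ.filter fun i => ∃ Y, A i = some Y ∧ Within Y B := by
      simpa using ⟨B, hi, Within.refl B⟩
    simp [hm] at this
  | succ m ih =>
    intro A j B hj hm
    by_cases hfree : ∀ i, A i ≠ some B
    · exact ⟨_, Schedule.free A j B hfree⟩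
    push Not at hfree
    obtain ⟨i, hi⟩ := hfree
    have hij : j ≠ i := by rintro rfl; rw [hj] at hi; simp at hi
    have hmem : i ∈ Finset.univ.filter fun i => ∃ Y, A i = some Y ∧ Within Y B := by
      simpa using ⟨B, hi, Within.refl B⟩
    have hcard : ∀ F : Finset (Fin n),
        F ⊆ (Finset.univ.filter fun i => ∃ Y, A i = some Y ∧ Within Y B).erase i → F.card ≤ m := by
      intro F hF
      have := Finset.card_le_card hF
      rw [Finset.card_erase_of_mem hmem] at this
      omega
    obtain ⟨A', h₁⟩ := ih (Function.update A i none) i B.first (by simp) (hcard _ fun k hk => by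
      obtain ⟨Y, hY, hw⟩ := (Finset.mem_filter.1 hk).2
      have hki : k ≠ i := by rintro rfl; simp at hY
      rw [Function.update_of_ne hki] at hY
      simpa [hki] using ⟨Y, hY, hw.trans (within_first B)⟩)
    have hj' := h₁.none_of_ne (by simp) hij (by rw [Function.update_of_ne hij, hj])
    obtain ⟨A'', h₂⟩ := ih A' j B.second hj' (hcard _ fun k hk => by
      obtain ⟨Y, hY, hw⟩ := (Finset.mem_filter.1 hk).2
      have hw' : ¬ Within Y B.first := fun h => not_within_both h hw
      have hY' := h₁.eq_some_of_not_within (by simp) hw' hY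
      have hki : k ≠ i := by rintro rfl; simp at hY'
      rw [Function.update_of_ne hki] at hY'
      simpa [hki] using ⟨Y, hY', hw.trans (within_second B)⟩)
    exact ⟨A'', Schedule.split A A' A'' i j B hi h₁ h₂⟩

/-! ### The load of buckets -/

open Classical in
/-- The occupancy (`0` or `1`) of a bucket. -/
noncomputable def occ (A : Assignment n) (X : Bucket) : ℕ := if ∃ i, A i = some X then 1 else 0

/-- `c` bounds the number of calls of the scheduling policy on each bucket, of which `g` are not
recursive: only every other call on a bucket leads to calls on its two halves. -/
def Balanced (A : Assignment n) (c g : Bucket → ℕ) : Prop :=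
  ∀ Z, g Z ≤ c Z ∧ ∀ X : Bucket, (Z = X.first ∨ Z = X.second) → 2 * c Z + occ A X ≤ c X + 2 * g Z

lemma occ_le {A A' : Assignment n} {X : Bucket} (h : ∀ i, A' i = some X → ∃ k, A k = some X) :
    occ A' X ≤ occ A X := by
  unfold occ
  split_ifs with h1 h2 <;> try omega
  obtain ⟨i, hi⟩ := h1
  exact absurd (h i hi) h2

lemma occ_eq_zero {A : Assignment n} {X : Bucket} (h : ∀ i, A i ≠ some X) : occ A X = 0 := by
  unfold occ
  rw [if_neg]
  rintro ⟨i, hi⟩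
  exact h i hi

lemma occ_le_one (A : Assignment n) (X : Bucket) : occ A X ≤ 1 := by
  unfold occ; split_ifs <;> omega

lemma Balanced.mono {A A' : Assignment n} {c g : Bucket → ℕ} (h : Balanced A c g)
    (hA : ∀ X, occ A' X ≤ occ A X) : Balanced A' c g :=
  fun Z => ⟨(h Z).1, fun X hX => by have := (h Z).2 X hX; have := hA X; omega⟩

lemma occ_update_none_le (A : Assignment n) (i : Fin n) (X : Bucket) :
    occ (Function.update A i none) X ≤ occ A X := by
  refine occ_le fun k hk => ⟨k, ?_⟩
  by_cases hki : k = i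
  · subst hki; simp at hk
  · rwa [Function.update_of_ne hki] at hk

lemma first_ne_second (X B : Bucket) : X.first ≠ B.second := by
  simp only [Bucket.first, Bucket.second, ne_eq, Bucket.mk.injEq]; omega

lemma first_inj {X B : Bucket} (h : X.first = B.first) : X = B := by
  rcases X with ⟨e, i⟩
  rcases B with ⟨e', i'⟩
  simp only [Bucket.first, Bucket.mk.injEq] at *; omega

lemma second_inj {X B : Bucket} (h : X.second = B.second) : X = B := by
  rcases X with ⟨e, i⟩
  rcases B with ⟨e', i'⟩
  simp only [Bucket.second, Bucket.mk.injEq] at *; omega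

lemma child_inj {Z X B : Bucket} (h : Z = X.first ∨ Z = X.second)
    (h' : Z = B.first ∨ Z = B.second) : X = B := by
  rcases h with rfl | rfl <;> rcases h' with h' | h'
  · exact first_inj h'
  · exact absurd h' (first_ne_second _ _)
  · exact absurd h'.symm (first_ne_second _ _)
  · exact second_inj h'

lemma child_ne {Z X : Bucket} (h : Z = X.first ∨ Z = X.second) : Z ≠ X := by
  rintro rfl
  rcases h with h | h <;> have := congrArg Bucket.exp h <;>
    simp only [Bucket.first, Bucket.second] at this <;> omega

-- In the split case the induction hypotheses book the two calls on the halves as non-recursive.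
-- They are then rebooked as recursive, at the expense of the call that had filled `B` and of the
-- present one.
open Classical in
lemma Balanced.schedule {A A' : Assignment n} {j : Fin n} {B : Bucket} (h : Schedule A j B A')
    (hj : A j = none) (hA : Inj A) {c g : Bucket → ℕ} (hb : Balanced A c g) :
    ∃ c', Balanced A' c' (Function.update g B (g B + 1)) ∧ c' B = c B + 1 ∧
      ∀ Y, ¬ Within Y B → c' Y = c Y := by
  induction h generalizing c g with
  | free A j B h =>
    refine ⟨Function.update c B (c B + 1), fun Z => ?_, by simp, fun Y hY => ?_⟩
    · have hocc : ∀ X, X ≠ B → occ (Function.update A j (some B)) X ≤ occ A X := by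
        intro X hX
        refine occ_le fun k hk => ⟨k, ?_⟩
        by_cases hkj : k = j
        · subst hkj
          simp only [Function.update_self, Option.some_inj] at hk
          exact absurd hk.symm hX
        · rwa [Function.update_of_ne hkj] at hk
      refine ⟨?_, fun X hX => ?_⟩
      · by_cases hZ : Z = B
        · subst hZ; simpa using (hb Z).1
        · simpa [Function.update_of_ne hZ] using (hb Z).1
      · have h1 := (hb Z).2 X hX
        have hZX := child_ne hX
        by_cases hXB : X = B
        · subst hXB
          rw [Function.update_of_ne hZX, Function.update_of_ne hZX, Function.update_self]
          have := occ_eq_zero h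
          have := occ_le_one (Function.update A j (some X)) X
          omega
        · have := hocc X hXB
          rw [Function.update_of_ne hXB]
          by_cases hZ : Z = B
          · subst hZ
            rw [Function.update_self, Function.update_self]; omega
          · rw [Function.update_of_ne hZ, Function.update_of_ne hZ]; omega
    · rw [Function.update_of_ne]
      rintro rfl
      exact hY (Within.refl _)
  | split A A' A'' i j B h h₁ h₂ ih₁ ih₂ =>
    have hij : j ≠ i := by rintro rfl; rw [hj] at h; simp at h
    have hj' := h₁.none_of_ne (by simp) hij (by rw [Function.update_of_ne hij, hj])
    obtain ⟨c₁, hb₁, hc₁, hf₁⟩ := ih₁ (by simp) (hA.update_none i)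
      (hb.mono (occ_update_none_le A i))
    obtain ⟨c₂, hb₂, hc₂, hf₂⟩ := ih₂ hj' (h₁.inj (by simp) (hA.update_none i)) hb₁
    have hoccB : occ A'' B = 0 := by
      refine occ_eq_zero fun k hk => ?_
      have h3 := h₁.eq_some_of_not_within (by simp) (not_within_first B)
        (h₂.eq_some_of_not_within hj' (not_within_second B) hk)
      by_cases hki : k = i
      · subst hki; simp at h3
      · rw [Function.update_of_ne hki] at h3
        exact hki (hA k i B h3 h)
    have hoccB' : occ A B = 1 := by unfold occ; rw [if_pos ⟨i, h⟩]
    have hcB : c₂ B = c B := by rw [hf₂ B (not_within_second B), hf₁ B (not_within_first B)]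
    have hcf : c₂ B.first = c B.first + 1 := by
      rw [hf₂ _ fun h => not_within_both (Within.refl _) h, hc₁]
    have hcs : c₂ B.second = c B.second + 1 := by
      rw [hc₂, hf₁ _ fun h => not_within_both h (Within.refl _)]
    have hg : ∀ Z, Z ≠ B.first → Z ≠ B.second → Function.update (Function.update g B.first
        (g B.first + 1)) B.second (Function.update g B.first (g B.first + 1) B.second + 1) Z
        = g Z := by
      intro Z h1 h2
      rw [Function.update_of_ne h2, Function.update_of_ne h1]
    have hgle : ∀ Z, g Z ≤ Function.update (Function.update g B.first
        (g B.first + 1)) B.second (Function.update g B.first (g B.first + 1) B.second + 1) Z := by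
      intro Z
      by_cases h2 : Z = B.second
      · subst h2
        rw [Function.update_self, Function.update_of_ne (first_ne_second B B).symm]; omega
      · rw [Function.update_of_ne h2]
        by_cases h1 : Z = B.first
        · subst h1; rw [Function.update_self]; omega
        · rw [Function.update_of_ne h1]
    have hBf : B ≠ B.first := (child_ne (Or.inl rfl)).symm
    have hBs : B ≠ B.second := (child_ne (Or.inr rfl)).symm
    refine ⟨Function.update c₂ B (c₂ B + 1), fun Z => ⟨?_, fun X hX => ?_⟩, by simp [hcB],
      fun Y hY => ?_⟩
    · by_cases hZ : Z = B
      · subst hZ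
        simpa [hcB] using (hb Z).1
      · rw [Function.update_of_ne hZ, Function.update_of_ne hZ]
        exact (hgle Z).trans (hb₂ Z).1
    · have hZX := child_ne hX
      by_cases hXB : X = B
      · subst hXB
        -- The extra call on `Z` costs 2: one unit is the occupancy of `B`, which drops from 1 to 0,
        -- the other the new call on `B`.
        have h4 := (hb Z).2 X hX
        have h5 : c₂ Z = c Z + 1 := by rcases hX with rfl | rfl <;> assumption
        rw [Function.update_of_ne hZX, Function.update_of_ne hZX, Function.update_self]
        omega
      · have h4 := (hb₂ Z).2 X hX
        rw [Function.update_of_ne hXB]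
        by_cases hZ : Z = B
        · subst hZ
          rw [hg Z hBf hBs] at h4
          rw [Function.update_self, Function.update_self]; omega
        · rw [hg Z (fun h => hXB (child_inj hX (Or.inl h)))
            (fun h => hXB (child_inj hX (Or.inr h)))] at h4
          rw [Function.update_of_ne hZ, Function.update_of_ne hZ]; omega
    · have hYB : Y ≠ B := by rintro rfl; exact hY (Within.refl _)
      rw [Function.update_of_ne hYB, hf₂ Y fun h => hY (h.trans (within_second B)),
        hf₁ Y fun h => hY (h.trans (within_first B))]

/-- The assignment has been obtained by scheduling the entities `l` in the buckets `Y` with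
`Arr l Y`, and possibly removing some. -/
def Loaded (A : Assignment n) (Arr : Fin n → Bucket → Prop) : Prop :=
  ∃ (c : Bucket → ℕ) (b : ℤ), Balanced A c (fun Y => {l | Arr l Y}.ncard) ∧
    ∀ Y : Bucket, b < Y.exp → c Y = 0

lemma loaded_none : Loaded (fun _ : Fin n => none) (fun _ _ => False) := by
  refine ⟨fun _ => 0, 0, fun Z => ⟨by simp, fun X _ => ?_⟩, fun _ _ => rfl⟩
  have : occ (fun _ : Fin n => none) X = 0 := occ_eq_zero (by simp)
  simp [this]

lemma Loaded.update_none {A : Assignment n} {Arr : Fin n → Bucket → Prop} (h : Loaded A Arr)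
    (i : Fin n) : Loaded (Function.update A i none) Arr := by
  obtain ⟨c, b, hb, hc⟩ := h
  exact ⟨c, b, hb.mono (occ_update_none_le A i), hc⟩

/-- Arrivals are counted as a set, so `hArr` is needed for the count at `B` to grow by one. -/
lemma Loaded.schedule {A A' : Assignment n} {j : Fin n} {B : Bucket} (h : Schedule A j B A')
    (hj : A j = none) (hA : Inj A) {Arr : Fin n → Bucket → Prop} (hArr : ¬ Arr j B)
    (hl : Loaded A Arr) : Loaded A' (fun l Y => Arr l Y ∨ (l = j ∧ Y = B)) := by
  classical
  obtain ⟨c, b, hb, hc⟩ := hl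
  obtain ⟨c', hb', -, hc'⟩ := hb.schedule h hj hA
  refine ⟨c', max b B.exp, ?_, fun Y hY => ?_⟩
  · convert hb' using 1
    ext Y
    by_cases hY : Y = B
    · subst hY
      rw [Function.update_self]
      have : {l | Arr l Y ∨ (l = j ∧ Y = Y)} = insert j {l | Arr l Y} := by
        ext l; simp [or_comm]
      rw [this, Set.ncard_insert_of_notMem (by simpa using hArr)]
    · rw [Function.update_of_ne hY]
      simp [hY]
  · rw [hc' Y fun h => by have := h.exp_le; omega, hc Y (by omega)]

/-- An entity may have been scheduled in several ancestors of the same bucket; counting only the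
shortest loses a factor 2. -/
lemma sum_half_pow_le {p : ℕ → Prop} [DecidablePred p] {j : ℕ} (hj : ∀ i < j, ¬ p i) (J : ℕ) :
    ∑ i ∈ Finset.range J, (if p i then (1 / 2 : ℝ) ^ i else 0) ≤ 2 * (1 / 2) ^ j := by
  have h1 : ∑ i ∈ Finset.range J, (if p i then (1 / 2 : ℝ) ^ i else 0) ≤
      ∑ i ∈ Finset.Ico j (j + J), (1 / 2 : ℝ) ^ i := by
    rw [← Finset.sum_filter]
    refine Finset.sum_le_sum_of_subset_of_nonneg (fun i hi => ?_) fun _ _ _ => by positivity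
    simp only [Finset.mem_filter, Finset.mem_range] at hi
    have : j ≤ i := by
      by_contra h
      exact hj i (by omega) hi.2
    simp only [Finset.mem_Ico]; omega
  refine h1.trans ?_
  rw [Finset.sum_Ico_eq_sum_range]
  simp only [pow_add, ← Finset.mul_sum, add_tsub_cancel_left]
  have := sum_geometric_two_le J
  have h2 : (0 : ℝ) < (1 / 2) ^ j := by positivity
  nlinarith

lemma Bucket.len_iterate_parent (X : Bucket) (j : ℕ) : (parent^[j] X).len = 2 ^ j * X.len := by
  induction j with
  | zero => simp
  | succ j ih => rw [Function.iterate_succ_apply', len_parent, ih, pow_succ]; ring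

lemma within_iterate_parent (X : Bucket) (j : ℕ) : Within X (Bucket.parent^[j] X) := by
  induction j with
  | zero => exact Within.refl X
  | succ j ih => rw [Function.iterate_succ_apply']; exact ih.trans (within_parent _)

lemma Bucket.exp_iterate_parent (X : Bucket) (j : ℕ) : (parent^[j] X).exp = X.exp + j := by
  induction j with
  | zero => simp
  | succ j ih => rw [Function.iterate_succ_apply', parent, ih]; push_cast; ring

/-- A short occupied bucket is the result of scheduling entities with a large total frequency. -/
lemma Loaded.exists_heavy {A : Assignment n} {Arr : Fin n → Bucket → Prop} (h : Loaded A Arr)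
    {i : Fin n} {X : Bucket} (hi : A i = some X) :
    ∃ (L : Finset (Fin n)) (Y : Fin n → Bucket), (∀ l ∈ L, Arr l (Y l) ∧ Within X (Y l)) ∧
      1 / 2 ≤ ∑ l ∈ L, X.len / (Y l).len := by
  classical
  obtain ⟨c, b, hb, hc⟩ := h
  have hocc : occ A X = 1 := by unfold occ; rw [if_pos ⟨i, hi⟩]
  -- For the half `Z = X.first`, the balance reads 2 c(Z) + 1 ≤ c(X) + 2 g(Z), and g(Z) ≤ c(Z).
  have hcX : 1 ≤ c X := by
    have h1 := (hb X.first).2 X (Or.inl rfl)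
    have h2 := (hb X.first).1
    omega
  have hstep : ∀ Z : Bucket, (c Z : ℝ) ≤ {l | Arr l Z}.ncard + c Z.parent / 2 := by
    intro Z
    have h1 := (hb Z).2 Z.parent Z.eq_first_or_second_parent
    simp only at h1
    have h2 : 2 * c Z ≤ c Z.parent + 2 * {l | Arr l Z}.ncard := by omega
    have h3 : (2 : ℝ) * c Z ≤ c Z.parent + 2 * {l | Arr l Z}.ncard := by exact_mod_cast h2
    linarith
  -- The inequality `hstep` is unrolled along the ancestors of `X`.
  have hsum : ∀ J : ℕ, (c X : ℝ) ≤ ∑ j ∈ Finset.range J,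
      ({l | Arr l (Bucket.parent^[j] X)}.ncard : ℝ) * (1 / 2) ^ j +
      c (Bucket.parent^[J] X) * (1 / 2) ^ J := by
    intro J
    induction J with
    | zero => simp
    | succ J ih =>
      rw [Finset.sum_range_succ, Function.iterate_succ_apply']
      have h1 := hstep (Bucket.parent^[J] X)
      have h2 : (0 : ℝ) < (1 / 2) ^ J := by positivity
      have h3 := mul_le_mul_of_nonneg_right h1 h2.le
      rw [pow_succ]
      linarith
  -- High enough for the ancestor to be longer than every bucket on which the policy was called.
  set J : ℕ := (b - X.exp).toNat + 1 with hJ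
  have h0 : c (Bucket.parent^[J] X) = 0 := hc _ (by rw [Bucket.exp_iterate_parent]; omega)
  have h1 := hsum J
  rw [h0] at h1
  have hcard : ∀ j, ({l | Arr l (Bucket.parent^[j] X)}.ncard : ℝ) =
      ∑ l, if Arr l (Bucket.parent^[j] X) then (1 : ℝ) else 0 := by
    intro j
    rw [Set.ncard_eq_toFinset_card', Finset.sum_boole]
    congr 2
    ext l; simp
  simp only [hcard, Finset.sum_mul] at h1
  rw [Finset.sum_comm] at h1
  set L : Finset (Fin n) := Finset.univ.filter fun l => ∃ j, Arr l (Bucket.parent^[j] X) with hL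
  have hex : ∀ l ∈ L, ∃ j, Arr l (Bucket.parent^[j] X) := fun l hl => (Finset.mem_filter.1 hl).2
  -- The generation of the shortest ancestor of `X` in which `l` was scheduled; the default 0 is
  -- never used.
  let m : Fin n → ℕ := fun l => if h : ∃ j, Arr l (Bucket.parent^[j] X) then Nat.find h else 0
  have hm : ∀ l ∈ L, Arr l (Bucket.parent^[m l] X) ∧
      ∀ i < m l, ¬ Arr l (Bucket.parent^[i] X) := by
    intro l hl
    have h := hex l hl
    simp only [m, dif_pos h]
    exact ⟨Nat.find_spec h, fun i hi => Nat.find_min h hi⟩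
  refine ⟨L, fun l => Bucket.parent^[m l] X, fun l hl => ⟨(hm l hl).1, within_iterate_parent X _⟩, ?_⟩
  have h2 : ∑ l, ∑ j ∈ Finset.range J,
      (if Arr l (Bucket.parent^[j] X) then (1 : ℝ) else 0) * (1 / 2) ^ j ≤
      ∑ l ∈ L, 2 * (1 / 2) ^ (m l) := by
    rw [← Finset.sum_subset (Finset.subset_univ L)]
    · refine Finset.sum_le_sum fun l hl => ?_
      simp only [ite_mul, one_mul, zero_mul]
      exact sum_half_pow_le (hm l hl).2 J
    · intro l _ hl
      refine Finset.sum_eq_zero fun j _ => ?_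
      rw [if_neg, zero_mul]
      intro h
      exact hl (Finset.mem_filter.2 ⟨Finset.mem_univ _, j, h⟩)
  have h3 : ∑ l ∈ L, X.len / (Bucket.parent^[m l] X).len = ∑ l ∈ L, (1 / 2 : ℝ) ^ (m l) := by
    refine Finset.sum_congr rfl fun l _ => ?_
    rw [Bucket.len_iterate_parent]
    have := X.len_pos
    rw [one_div, inv_pow]
    field_simp
  rw [h3]
  rw [← Finset.mul_sum] at h2
  have h4 : (1 : ℝ) ≤ c X := by exact_mod_cast hcX
  simp only [CharP.cast_eq_zero, zero_mul, add_zero] at h1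
  linarith

end Schedule

/-! ### Existence of runs -/

section Initial

variable {n : ℕ}

lemma exists_scheduleAll (f : Fin n → Bucket) (l : List (Fin n)) (hl : l.Nodup)
    (A : Assignment n) (hA : ∀ j ∈ l, A j = none) : ∃ A', ScheduleAll f l A A' := by
  induction l generalizing A with
  | nil => exact ⟨A, ScheduleAll.nil A⟩
  | cons j l ih =>
    obtain ⟨A₁, h₁⟩ := exists_schedule A j (f j) (hA j (by simp))
    rw [List.nodup_cons] at hl
    obtain ⟨A₂, h₂⟩ := ih hl.2 A₁ fun k hk =>
      h₁.none_of_ne (hA j (by simp)) (fun h => hl.1 (h ▸ hk)) (hA k (by simp [hk]))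
    exact ⟨A₂, ScheduleAll.cons j l A A₁ A₂ h₁ h₂⟩

lemma ScheduleAll.spec {f : Fin n → Bucket} {l : List (Fin n)} {A A' : Assignment n}
    (h : ScheduleAll f l A A') (hl : l.Nodup) (hA : ∀ j ∈ l, A j = none) (hinj : Inj A)
    (hw : ∀ i X, A i = some X → Within X (f i)) {Arr : Fin n → Bucket → Prop}
    (hArr : ∀ j ∈ l, ¬ Arr j (f j)) (hload : Loaded A Arr) :
    Inj A' ∧ (∀ i X, A' i = some X → Within X (f i)) ∧
      (∀ i, (i ∈ l ∨ ∃ X, A i = some X) → ∃ X, A' i = some X) ∧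
      Loaded A' (fun i Y => Arr i Y ∨ (i ∈ l ∧ Y = f i)) := by
  induction h generalizing Arr with
  | nil A =>
    refine ⟨hinj, hw, fun i hi => ?_, ?_⟩
    · simpa using hi
    · simpa using hload
  | cons j l A A₁ A₂ h₁ h₂ ih =>
    have hj : A j = none := hA j (by simp)
    rw [List.nodup_cons] at hl
    obtain ⟨⟨X₁, hX₁, hw₁⟩, hm₁⟩ := h₁.frame hj
    have hne : ∀ k ∈ l, k ≠ j := fun k hk h => hl.1 (h ▸ hk)
    obtain ⟨r1, r2, r3, r4⟩ := ih hl.2 (fun k hk => h₁.none_of_ne hj (hne k hk) (hA k (by simp [hk])))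
      (h₁.inj hj hinj) (fun i X hi => by
        by_cases hij : i = j
        · subst hij
          rw [hX₁, Option.some_inj] at hi
          exact hi ▸ hw₁
        · rcases hm₁ i hij with h' | ⟨Y, X', hY, -, hX', hww⟩
          · rw [h'] at hi; exact hw i X hi
          · rw [hX', Option.some_inj] at hi
            exact hi ▸ hww.trans (hw i Y hY))
      (Arr := fun i Y => Arr i Y ∨ (i = j ∧ Y = f j))
      (fun k hk h => by
        rcases h with h | h
        · exact hArr k (by simp [hk]) h
        · exact hne k hk h.1)
      (hload.schedule h₁ hj hinj (hArr j (by simp)))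
    refine ⟨r1, r2, fun i hi => r3 i ?_, ?_⟩
    · rcases hi with hi | ⟨X, hX⟩
      · rcases List.mem_cons.1 hi with rfl | hi
        · exact Or.inr ⟨X₁, hX₁⟩
        · exact Or.inl hi
      · by_cases hij : i = j
        · exact Or.inr ⟨X₁, hij ▸ hX₁⟩
        · rcases hm₁ i hij with h' | ⟨Y, X', -, -, hX', -⟩
          · exact Or.inr ⟨X, h' ▸ hX⟩
          · exact Or.inr ⟨X', hX'⟩
    · convert r4 using 3 with i Y
      simp only [List.mem_cons]
      constructor
      · rintro (h | ⟨rfl | h, h'⟩)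
        · exact Or.inl (Or.inl h)
        · exact Or.inl (Or.inr ⟨rfl, h'⟩)
        · exact Or.inr ⟨h, h'⟩
      · rintro ((h | ⟨rfl, h⟩) | ⟨h, h'⟩)
        · exact Or.inl h
        · exact Or.inr ⟨Or.inl rfl, h⟩
        · exact Or.inr ⟨Or.inr h, h'⟩

end Initial

section Run

variable {d n : ℕ} {ρ : ℝ} {ζ : Fin n → ℝ → Space d} {y : ℕ} {t₀ : ℝ} {p : Fin n → ℝ}

lemma exists_step (ρ : ℝ) (ζ : Fin n → ℝ → Space d) (y : ℕ) (hn : 0 < n) (S : State n)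
    (hS : ∀ i, ∃ X, S.bucket i = some X) :
    ∃ j t S', Step ρ ζ y S j t S' ∧ ∀ i, ∃ X, S'.bucket i = some X := by
  choose X hX using hS
  have : Nonempty (Fin n) := ⟨⟨0, hn⟩⟩
  obtain ⟨j, -, hj⟩ := Finset.exists_min_image Finset.univ (fun i => (X i).mid)
    Finset.univ_nonempty
  let last := Function.update S.last j (X j).mid
  let b := bucketExp d y (xSep ρ (perceived ζ last) y j)
  have hnone : Function.update S.bucket j none j = none := by simp
  obtain ⟨A', hA'⟩ := exists_schedule (Function.update S.bucket j none) j
    (firstBucketAfter b ((X j).mid + (2 : ℝ) ^ b)) hnone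
  refine ⟨j, (X j).mid, ⟨last, A'⟩, ⟨⟨X j, hX j, rfl⟩, fun i B hi => ?_, rfl, b, rfl, hA'⟩,
    fun i => ?_⟩
  · rw [hX i, Option.some_inj] at hi
    exact hi ▸ hj i (Finset.mem_univ i)
  · obtain ⟨⟨X', hX', -⟩, hm⟩ := hA'.frame hnone
    by_cases hij : i = j
    · exact ⟨X', hij ▸ hX'⟩
    · rcases hm i hij with h | ⟨-, X'', -, -, h, -⟩
      · exact ⟨X i, h.trans (by rw [Function.update_of_ne hij, hX i])⟩
      · exact ⟨X'', h⟩

theorem nonempty_bucketRun (ρ : ℝ) (ζ : Fin n → ℝ → Space d) (y : ℕ) (hn : 0 < n) (t₀ : ℝ)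
    (p : Fin n → ℝ) : Nonempty (BucketRun ρ ζ y t₀ p) := by
  let f : Fin n → Bucket :=
    fun j => firstBucketAfter (bucketExp d y (xSep ρ (perceived ζ p) y j)) t₀
  obtain ⟨A₀, hA₀⟩ := exists_scheduleAll f (List.finRange n) (List.nodup_finRange n)
    (fun _ => none) fun _ _ => rfl
  have hspec := hA₀.spec (List.nodup_finRange n) (fun _ _ => rfl)
    (fun _ _ _ h => by simp at h) (fun _ _ h => by simp at h) (Arr := fun _ _ => False)
    (fun _ _ h => h) loaded_none
  let T := {S : State n // ∀ i, ∃ X, S.bucket i = some X}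
  have hstep : ∀ S : T, ∃ (j : Fin n) (t : ℝ) (S' : T), Step ρ ζ y S.1 j t S'.1 := by
    intro S
    obtain ⟨j, t, S', h, h'⟩ := exists_step ρ ζ y hn S.1 S.2
    exact ⟨j, t, ⟨S', h'⟩, h⟩
  choose who time next hnext using hstep
  let S₀ : T := ⟨⟨p, A₀⟩, fun i => hspec.2.2.1 i (Or.inl (List.mem_finRange i))⟩
  let st : ℕ → T := fun k => next^[k] S₀
  exact ⟨{ state := fun k => (st k).1
           who := fun k => who (st k)
           time := fun k => time (st k)
           init_last := rfl
           init_bucket := ⟨List.finRange n, List.nodup_finRange n, List.mem_finRange, hA₀⟩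
           step := fun k => by
             have : st (k + 1) = next (st k) := Function.iterate_succ_apply' next k S₀
             rw [this]
             exact hnext (st k) }⟩

/-! ### Invariants of runs -/

/-- The perceived `y`-separation of entity `i` just before the `k`-th query. -/
noncomputable def BucketRun.per (R : BucketRun ρ ζ y t₀ p) (k : ℕ) (i : Fin n) : ℝ :=
  xSep ρ (perceived ζ (R.state k).last) y i

/-- The exponent of the bucket chosen after the `k`-th query. -/
noncomputable def BucketRun.exp (R : BucketRun ρ ζ y t₀ p) (k : ℕ) : ℤ :=
  bucketExp d y (R.per (k + 1) (R.who k))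

/-- The bucket in which each entity was last scheduled (non-recursively). -/
noncomputable def BucketRun.nom (R : BucketRun ρ ζ y t₀ p) : ℕ → Fin n → Bucket
  | 0 => fun j => firstBucketAfter (bucketExp d y (R.per 0 j)) t₀
  | k + 1 => Function.update (R.nom k) (R.who k)
      (firstBucketAfter (R.exp k) (R.time k + (2 : ℝ) ^ R.exp k))

/-- The time of the query that precedes the `k`-th one. -/
def BucketRun.cur (R : BucketRun ρ ζ y t₀ p) : ℕ → ℝ
  | 0 => t₀
  | k + 1 => R.time k

lemma BucketRun.last_succ (R : BucketRun ρ ζ y t₀ p) (k : ℕ) :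
    (R.state (k + 1)).last = Function.update (R.state k).last (R.who k) (R.time k) :=
  (R.step k).2.2.1

lemma BucketRun.schedule_succ (R : BucketRun ρ ζ y t₀ p) (k : ℕ) :
    Schedule (Function.update (R.state k).bucket (R.who k) none) (R.who k)
      (R.nom (k + 1) (R.who k)) (R.state (k + 1)).bucket := by
  obtain ⟨b, hb, h⟩ := (R.step k).2.2.2
  have : b = R.exp k := hb
  subst this
  simpa [BucketRun.nom] using h

/-- The invariant of the assignments of entities to buckets. -/
structure BucketRun.Inv (R : BucketRun ρ ζ y t₀ p) (k : ℕ) : Prop where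
  inj : Inj (R.state k).bucket
  total : ∀ i, ∃ X, (R.state k).bucket i = some X ∧ Within X (R.nom k i) ∧ R.cur k < X.mid
  start_mono : ∀ i, ∀ m ≤ k, (R.nom m i).start ≤ (R.nom k i).start
  loaded : Loaded (R.state k).bucket (fun i Y => ∃ m ≤ k, R.nom m i = Y)

lemma BucketRun.inv_zero (R : BucketRun ρ ζ y t₀ p) : R.Inv 0 := by
  obtain ⟨l, hl, hmem, h⟩ := R.init_bucket
  obtain ⟨h1, h2, h3, h4⟩ := h.spec hl (fun _ _ => rfl)
    (fun _ _ _ h => by simp at h) (fun _ _ h => by simp at h) (Arr := fun _ _ => False)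
    (fun _ _ h => h) loaded_none
  have hnom : ∀ j, R.nom 0 j =
      firstBucketAfter (bucketExp d y (xSep ρ (perceived ζ p) y j)) t₀ := by
    intro j
    change firstBucketAfter (bucketExp d y (xSep ρ (perceived ζ (R.state 0).last) y j)) t₀ = _
    rw [R.init_last]
  refine ⟨h1, fun i => ?_, fun i m hm => ?_, ?_⟩
  · obtain ⟨X, hX⟩ := h3 i (Or.inl (hmem i))
    have hw := h2 i X hX
    refine ⟨X, hX, by rw [hnom]; exact hw, ?_⟩
    exact (firstBucketAfter_start _ _).1.trans hw.mid_mem.1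
  · rw [Nat.le_zero.1 hm]
  · convert h4 using 3 with i Y
    simp [hmem, hnom, eq_comm]

lemma BucketRun.Inv.time_gt {R : BucketRun ρ ζ y t₀ p} {k : ℕ} (h : R.Inv k) :
    R.cur k < R.time k := by
  obtain ⟨B, hB, ht⟩ := (R.step k).1
  obtain ⟨X, hX, -, hc⟩ := h.total (R.who k)
  rw [hB, Option.some_inj] at hX
  rw [ht, hX]; exact hc

lemma BucketRun.nom_succ_start (R : BucketRun ρ ζ y t₀ p) (k : ℕ) :
    R.time k + (2 : ℝ) ^ R.exp k < (R.nom (k + 1) (R.who k)).start := by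
  rw [BucketRun.nom, Function.update_self]
  exact (firstBucketAfter_start _ _).1

lemma BucketRun.Inv.succ {R : BucketRun ρ ζ y t₀ p} {k : ℕ} (h : R.Inv k) : R.Inv (k + 1) := by
  obtain ⟨B, hB, ht⟩ := (R.step k).1
  have hmin := (R.step k).2.1
  have hs := R.schedule_succ k
  have hst := R.nom_succ_start k
  have hpos : (0 : ℝ) < (2 : ℝ) ^ R.exp k := zpow_pos two_pos _
  have hnone : Function.update (R.state k).bucket (R.who k) none (R.who k) = none := by simp
  have hBw : (R.nom k (R.who k)).start < R.time k := by
    obtain ⟨X, hX, hw, -⟩ := h.total (R.who k)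
    rw [hB, Option.some_inj] at hX
    rw [ht, hX]; exact hw.mid_mem.1
  have hne : ∀ i, i ≠ R.who k → R.nom (k + 1) i = R.nom k i := by
    intro i hi
    rw [BucketRun.nom, Function.update_of_ne hi]
  obtain ⟨⟨X, hX, hXw⟩, hm⟩ := hs.frame hnone
  refine ⟨hs.inj hnone (h.inj.update_none _), fun i => ?_, fun i m hmk => ?_, ?_⟩
  · by_cases hi : i = R.who k
    · subst hi
      exact ⟨X, hX, hXw, (by simp only [BucketRun.cur]; linarith [hXw.mid_mem.1])⟩
    · obtain ⟨Y, hY, hYw, hYc⟩ := h.total i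
      rw [hne i hi]
      rcases hm i hi with h' | ⟨Y', X', hY', hw', hX', hw''⟩
      · refine ⟨Y, by rw [h', Function.update_of_ne hi, hY], hYw, ?_⟩
        -- Equal midpoints would mean equal buckets, hence equal entities; so query times increase
        -- strictly.
        refine lt_of_le_of_ne (hmin i Y hY) fun heq => hi ?_
        have : B = Y := Bucket.mid_injective (ht ▸ heq)
        subst this
        exact h.inj i (R.who k) B hY hB
      · rw [Function.update_of_ne hi, hY, Option.some_inj] at hY'
        subst hY'
        refine ⟨X', hX', hw''.trans hYw, ?_⟩
        simp only [BucketRun.cur]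
        linarith [(hw''.trans hw').mid_mem.1]
  · have hstep : (R.nom k i).start ≤ (R.nom (k + 1) i).start := by
      by_cases hi : i = R.who k
      · subst hi; linarith
      · rw [hne i hi]
    rcases Nat.le_succ_iff.1 hmk with hmk | rfl
    · exact (h.start_mono i m hmk).trans hstep
    · exact le_rfl
  -- The new bucket starts after the present query, whereas all former ones of this entity started
  -- before it. It is thus a genuinely new arrival.
  · have h5 := (h.loaded.update_none (R.who k)).schedule hs hnone (h.inj.update_none _) (by
      rintro ⟨m, hmk, heq⟩
      have := h.start_mono (R.who k) m hmk
      rw [heq] at this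
      linarith)
    convert h5 using 3 with i Y
    constructor
    · rintro ⟨m, hmk, heq⟩
      rcases Nat.le_succ_iff.1 hmk with hmk | rfl
      · exact Or.inl ⟨m, hmk, heq⟩
      · by_cases hi : i = R.who k
        · subst hi; exact Or.inr ⟨rfl, heq.symm⟩
        · rw [hne i hi] at heq
          exact Or.inl ⟨k, le_rfl, heq⟩
    · rintro (⟨m, hmk, heq⟩ | ⟨rfl, rfl⟩)
      · exact ⟨m, by omega, heq⟩
      · exact ⟨k + 1, le_rfl, rfl⟩

lemma BucketRun.inv (R : BucketRun ρ ζ y t₀ p) (k : ℕ) : R.Inv k := by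
  induction k with
  | zero => exact R.inv_zero
  | succ k ih => exact ih.succ

lemma BucketRun.cur_lt_time (R : BucketRun ρ ζ y t₀ p) (k : ℕ) : R.cur k < R.time k :=
  (R.inv k).time_gt

lemma BucketRun.time_strictMono (R : BucketRun ρ ζ y t₀ p) : StrictMono R.time :=
  strictMono_nat_of_lt_succ fun k => R.cur_lt_time (k + 1)

lemma BucketRun.cur_strictMono (R : BucketRun ρ ζ y t₀ p) : StrictMono R.cur :=
  strictMono_nat_of_lt_succ fun k => R.cur_lt_time k

lemma BucketRun.le_cur (R : BucketRun ρ ζ y t₀ p) (k : ℕ) : t₀ ≤ R.cur k :=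
  R.cur_strictMono.monotone (Nat.zero_le k)

lemma BucketRun.lt_time (R : BucketRun ρ ζ y t₀ p) (k : ℕ) : t₀ < R.time k :=
  (R.le_cur k).trans_lt (R.cur_lt_time k)

/-- No query comes later than the end of the bucket in which an entity was last scheduled. -/
lemma BucketRun.time_lt_finish (R : BucketRun ρ ζ y t₀ p) (k : ℕ) (i : Fin n) :
    R.time k < (R.nom k i).finish := by
  obtain ⟨X, hX, hw, -⟩ := (R.inv k).total i
  exact ((R.step k).2.1 i X hX).trans_lt hw.mid_mem.2

lemma BucketRun.start_lt_time (R : BucketRun ρ ζ y t₀ p) (k : ℕ) :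
    (R.nom k (R.who k)).start < R.time k := by
  obtain ⟨B, hB, ht⟩ := (R.step k).1
  obtain ⟨X, hX, hw, -⟩ := (R.inv k).total (R.who k)
  rw [hB, Option.some_inj] at hX
  rw [ht, hX]; exact hw.mid_mem.1

/-- Entity `i` has not been queried before the `k`-th query of the run. -/
structure BucketRun.Unqueried (R : BucketRun ρ ζ y t₀ p) (k : ℕ) (i : Fin n) : Prop where
  last : (R.state k).last i = p i
  nom : R.nom k i = firstBucketAfter (bucketExp d y (R.per 0 i)) t₀
  who_ne : ∀ m < k, R.who m ≠ i

/-- The last query to entity `i` before the `k`-th query of the run is the `m`-th one. -/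
structure BucketRun.QueriedAt (R : BucketRun ρ ζ y t₀ p) (k : ℕ) (i : Fin n) (m : ℕ) : Prop where
  lt : m < k
  who : R.who m = i
  last : (R.state k).last i = R.time m
  nom : R.nom k i = firstBucketAfter (R.exp m) (R.time m + (2 : ℝ) ^ R.exp m)
  who_ne : ∀ m', m < m' → m' < k → R.who m' ≠ i

lemma BucketRun.unqueried_or_queriedAt (R : BucketRun ρ ζ y t₀ p) (k : ℕ) (i : Fin n) :
    R.Unqueried k i ∨ ∃ m, R.QueriedAt k i m := by
  induction k with
  | zero => exact Or.inl ⟨by rw [R.init_last], rfl, fun m hm => absurd hm (Nat.not_lt_zero m)⟩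
  | succ k ih =>
    by_cases hi : R.who k = i
    · subst hi
      exact Or.inr ⟨k, ⟨Nat.lt_succ_self k, rfl, by rw [R.last_succ, Function.update_self],
        by rw [BucketRun.nom, Function.update_self], fun m' h h' => by omega⟩⟩
    · have hi' : i ≠ R.who k := fun h => hi h.symm
      have hlast : (R.state (k + 1)).last i = (R.state k).last i := by
        rw [R.last_succ, Function.update_of_ne hi']
      have hnom : R.nom (k + 1) i = R.nom k i := by
        rw [BucketRun.nom, Function.update_of_ne hi']
      rcases ih with h | ⟨m, h⟩
      · refine Or.inl ⟨hlast.trans h.last, hnom.trans h.nom, fun m hm => ?_⟩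
        rcases Nat.lt_succ_iff_lt_or_eq.1 hm with hm | rfl
        · exact h.who_ne m hm
        · exact hi
      · refine Or.inr ⟨m, ⟨h.lt.trans (Nat.lt_succ_self k), h.who, hlast.trans h.last,
          hnom.trans h.nom, fun m' hm hm' => ?_⟩⟩
        rcases Nat.lt_succ_iff_lt_or_eq.1 hm' with hm' | rfl
        · exact h.who_ne m' hm hm'
        · exact hi

lemma BucketRun.Unqueried.time_le {R : BucketRun ρ ζ y t₀ p} {k : ℕ} {i : Fin n}
    (h : R.Unqueried k i) : R.time k ≤ t₀ + 2 * 2 ^ (bucketExp d y (R.per 0 i)) := by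
  have h1 := R.time_lt_finish k i
  rw [h.nom, Bucket.finish_eq, firstBucketAfter_len] at h1
  have := (firstBucketAfter_start (bucketExp d y (R.per 0 i)) t₀).2
  linarith

/-- Three bucket lengths: the prescribed delay, the wait for the next bucket to start, and that
bucket itself. -/
lemma BucketRun.QueriedAt.time_le {R : BucketRun ρ ζ y t₀ p} {k m : ℕ} {i : Fin n}
    (h : R.QueriedAt k i m) : R.time k ≤ R.time m + 3 * 2 ^ R.exp m := by
  have h1 := R.time_lt_finish k i
  rw [h.nom, Bucket.finish_eq, firstBucketAfter_len] at h1
  have := (firstBucketAfter_start (R.exp m) (R.time m + (2 : ℝ) ^ R.exp m)).2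
  linarith

lemma BucketRun.QueriedAt.lt_time {R : BucketRun ρ ζ y t₀ p} {k m : ℕ}
    (h : R.QueriedAt k (R.who k) m) : R.time m + 2 ^ R.exp m < R.time k := by
  have h1 := R.start_lt_time k
  rw [h.nom] at h1
  have := (firstBucketAfter_start (R.exp m) (R.time m + (2 : ℝ) ^ R.exp m)).1
  linarith

lemma two_zpow_bucketExp {s : ℝ} (hs : 0 < lam d y / 24 * s) :
    (2 : ℝ) ^ bucketExp d y s ≤ lam d y / 24 * s ∧
      lam d y / 24 * s < 2 * (2 : ℝ) ^ bucketExp d y s := by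
  have h1 : (2 : ℝ) ^ Real.logb 2 (lam d y / 24 * s) = lam d y / 24 * s :=
    Real.rpow_logb two_pos (by norm_num) hs
  constructor
  · conv_rhs => rw [← h1]
    rw [← Real.rpow_intCast]
    exact Real.rpow_le_rpow_of_exponent_le one_le_two (Int.floor_le _)
  · conv_lhs => rw [← h1]
    rw [mul_comm (2 : ℝ), ← zpow_add_one₀ two_ne_zero, ← Real.rpow_intCast]
    refine Real.rpow_lt_rpow_of_exponent_lt one_lt_two ?_
    push_cast
    exact Int.lt_floor_add_one _

end Run

/-! ### Perceived against true separations, and the recency of queries. -/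

section Perception

variable {d n : ℕ} {ρ : ℝ} {ζ : Fin n → ℝ → Space d} {y : ℕ} {t₀ : ℝ} {p : Fin n → ℝ}
  {I : Scheme n}

lemma Precondition.last_nonneg (h : Precondition ρ ζ y t₀ I p) (i : Fin n) : 0 ≤ p i :=
  (h.isScheme i).1 (h.isLast i).1.1

lemma Precondition.last_lt (h : Precondition ρ ζ y t₀ I p) (i : Fin n) : p i < t₀ :=
  (h.isLast i).1.2

lemma Precondition.pos (h : Precondition ρ ζ y t₀ I p) (hS : Setup ρ ζ y) : 0 < t₀ := by
  have i : Fin n := ⟨0, (Nat.zero_le y).trans_lt hS.lt⟩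
  exact (h.last_nonneg i).trans_lt (h.last_lt i)

lemma BucketRun.per_zero (R : BucketRun ρ ζ y t₀ p) (i : Fin n) :
    R.per 0 i = xSep ρ (perceived ζ p) y i := by
  rw [BucketRun.per, R.init_last]

lemma BucketRun.last_le_cur (R : BucketRun ρ ζ y t₀ p) (hP : Precondition ρ ζ y t₀ I p) (k : ℕ)
    (i : Fin n) : (R.state k).last i ≤ R.cur k := by
  rcases R.unqueried_or_queriedAt k i with h | ⟨m, h⟩
  · rw [h.last]
    exact (hP.last_lt i).le.trans (R.le_cur k)
  · rw [h.last]
    exact R.cur_strictMono.monotone (show m + 1 ≤ k from h.lt)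

lemma BucketRun.last_nonneg (R : BucketRun ρ ζ y t₀ p) (hS : Setup ρ ζ y)
    (hP : Precondition ρ ζ y t₀ I p) (k : ℕ) (i : Fin n) : 0 ≤ (R.state k).last i := by
  rcases R.unqueried_or_queriedAt k i with h | ⟨m, h⟩
  · rw [h.last]; exact hP.last_nonneg i
  · rw [h.last]; exact (hP.pos hS).le.trans (R.lt_time m).le

lemma BucketRun.time_nonneg (R : BucketRun ρ ζ y t₀ p) (hS : Setup ρ ζ y)
    (hP : Precondition ρ ζ y t₀ I p) (k : ℕ) : 0 ≤ R.time k :=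
  (hP.pos hS).le.trans (R.lt_time k).le

lemma BucketRun.per_le (R : BucketRun ρ ζ y t₀ p) (hS : Setup ρ ζ y) {k : ℕ} {l : Fin n}
    {A : Finset (Fin n)} (hA : y + 1 ≤ A.card) {D : ℝ}
    (hD : ∀ a ∈ A, a ≠ l →
      dist (ζ l ((R.state k).last l)) (ζ a ((R.state k).last a)) ≤ 2 * ρ + D) :
    R.per k l ≤ D := by
  classical
  have h1 := A.pred_card_le_card_erase (a := l)
  refine xSep_le_of_card hS.one_le (F := A.erase l) (by omega)
    fun j hj => ⟨Finset.ne_of_mem_erase hj, ?_⟩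
  have := hD j (Finset.mem_of_mem_erase hj) (Finset.ne_of_mem_erase hj)
  simp only [sep, perceived]
  linarith

/-- All `E` such that `A` has diameter at most `2 * ρ + E` at time `t`. -/
def DiamLE (ρ : ℝ) (ζ : Fin n → ℝ → Space d) (A : Finset (Fin n)) (t E : ℝ) : Prop :=
  ∀ a ∈ A, ∀ b ∈ A, dist (ζ a t) (ζ b t) ≤ 2 * ρ + E

lemma DiamLE.pos (hS : Setup ρ ζ y) {A : Finset (Fin n)} (hA : y + 1 ≤ A.card) {t E : ℝ}
    (ht : 0 ≤ t) (h : DiamLE ρ ζ A t E) : 0 < E := by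
  obtain ⟨a, ha⟩ := Finset.card_pos.1 (show 0 < A.card by omega)
  exact (hS.xSep_pos ht a).trans_le (hS.xSep_neighbour hA h ha)

lemma DiamLE.at_time (hS : Setup ρ ζ y) {A : Finset (Fin n)} {s t E : ℝ} (hs : 0 ≤ s) (ht : 0 ≤ t)
    (h : DiamLE ρ ζ A t E) : DiamLE ρ ζ A s (E + 2 * |s - t|) := by
  intro a ha b hb
  have h1 := hS.motion.speed a s hs t ht
  have h2 := hS.motion.speed b s hs t ht
  have h3 := h a ha b hb
  have h4 := dist_triangle4 (ζ a s) (ζ a t) (ζ b t) (ζ b s)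
  rw [dist_comm (ζ b t) (ζ b s)] at h4
  linarith

/-- The surplus 2ρ does no harm: λ(D + ρ) ≤ D in the applications, by `Setup.key`. -/
lemma DiamLE.of_star {A : Finset (Fin n)} {j : Fin n} {t D : ℝ} (hρ : 0 ≤ ρ) (hD : 0 ≤ D)
    (h : ∀ a ∈ A, a ≠ j → dist (ζ j t) (ζ a t) ≤ 2 * ρ + D) :
    DiamLE ρ ζ A t (2 * D + 2 * ρ) := by
  have h' : ∀ a ∈ A, dist (ζ j t) (ζ a t) ≤ 2 * ρ + D := by
    intro a ha
    by_cases haj : a = j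
    · rw [haj, dist_self]; linarith
    · exact h a ha haj
  intro a ha b hb
  have h1 := h' a ha
  have h2 := h' b hb
  have h3 := dist_triangle_left (ζ a t) (ζ b t) (ζ j t)
  linarith

/-- The invariant: up to the `k`-th query, all entities of a cluster have been queried recently, in
comparison with the diameter of the cluster. -/
def BucketRun.Recent (R : BucketRun ρ ζ y t₀ p) (k : ℕ) : Prop :=
  ∀ t, R.cur k ≤ t → t ≤ R.time k → ∀ A : Finset (Fin n), y + 1 ≤ A.card → ∀ E,
    DiamLE ρ ζ A t E → ∀ l ∈ A, t - (R.state k).last l ≤ lam d y / 4 * E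

/-- The entity just queried is perceived where it is, and the others have moved by at most λE/4
since their last queries. -/
lemma BucketRun.Recent.per_succ_le {R : BucketRun ρ ζ y t₀ p} {k : ℕ} (h : R.Recent k)
    (hS : Setup ρ ζ y) (hP : Precondition ρ ζ y t₀ I p) {A : Finset (Fin n)}
    (hA : y + 1 ≤ A.card) {E : ℝ} (hE : DiamLE ρ ζ A (R.time k) E) (hk : R.who k ∈ A) :
    R.per (k + 1) (R.who k) ≤ E + lam d y / 4 * E := by
  refine R.per_le hS hA fun a ha hak => ?_
  rw [R.last_succ, Function.update_self, Function.update_of_ne hak]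
  have h1 := h _ (R.cur_lt_time k).le le_rfl A hA E hE a ha
  have h2 := hE _ hk a ha
  have h3 := hS.motion.speed a _ (R.time_nonneg hS hP k) _ (R.last_nonneg hS hP k a)
  have h4 := (R.last_le_cur hP k a).trans (R.cur_lt_time k).le
  rw [abs_of_nonneg (by linarith)] at h3
  have h5 := dist_triangle (ζ (R.who k) (R.time k)) (ζ a (R.time k)) (ζ a ((R.state k).last a))
  linarith

lemma Setup.key_of_le (hS : Setup ρ ζ y) {t : ℝ} (ht : 0 ≤ t) {i : Fin n} {D : ℝ}
    (h : xSep ρ (config ζ t) y i ≤ D) : lam d y * (ρ + D) ≤ D := by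
  have h1 := hS.key t ht i
  have h2 := hS.lam_lt
  nlinarith

lemma BucketRun.Recent.per_succ_le' {R : BucketRun ρ ζ y t₀ p} {k : ℕ} (h : R.Recent k)
    (hS : Setup ρ ζ y) (hP : Precondition ρ ζ y t₀ I p) :
    R.per (k + 1) (R.who k) ≤ 3 / 2 * xSep ρ (config ζ (R.time k)) y (R.who k) := by
  set j := R.who k with hj
  have ht := R.time_nonneg hS hP k
  obtain ⟨A, hA, hjA, hAs⟩ := exists_cluster ρ (config ζ (R.time k)) hS.one_le hS.lt j
  have hσ := hS.xSep_pos ht j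
  set σ := xSep ρ (config ζ (R.time k)) y j
  have hstar : ∀ a ∈ A, a ≠ j → dist (ζ j (R.time k)) (ζ a (R.time k)) ≤ 2 * ρ + σ := by
    intro a ha haj
    have := hAs a ha haj
    simp only [sep, config] at this
    linarith
  have hdiam := DiamLE.of_star hS.rho_pos.le hσ.le hstar
  have hkey : lam d y * (ρ + σ) ≤ σ := hS.key _ ht j
  refine R.per_le hS hA.ge fun a ha haj => ?_
  rw [R.last_succ, Function.update_self, Function.update_of_ne haj]
  -- Here E = 2σ + 2ρ, so λE/4 ≤ σ/2 by `hkey`.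
  have h1 := h _ (R.cur_lt_time k).le le_rfl A hA.ge _ hdiam a ha
  have h2 := hstar a ha haj
  have h3 := hS.motion.speed a _ ht _ (R.last_nonneg hS hP k a)
  have h4 := (R.last_le_cur hP k a).trans (R.cur_lt_time k).le
  rw [abs_of_nonneg (by linarith)] at h3
  have h5 := dist_triangle (ζ j (R.time k)) (ζ a (R.time k)) (ζ a ((R.state k).last a))
  linarith

/-- Among the `y` perceived nearest neighbours let `a₀` be the one truly farthest away, at
separation D ≥ σ. It has moved by at most λ(2D + 2ρ)/4 ≤ D/2 since its last query, so it is
perceived at separation at least D/2. -/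
lemma BucketRun.Recent.le_per_succ {R : BucketRun ρ ζ y t₀ p} {k : ℕ} (h : R.Recent k)
    (hS : Setup ρ ζ y) (hP : Precondition ρ ζ y t₀ I p) :
    xSep ρ (config ζ (R.time k)) y (R.who k) / 2 ≤ R.per (k + 1) (R.who k) := by
  classical
  set j := R.who k with hj
  have ht := R.time_nonneg hS hP k
  obtain ⟨A, hA, hjA, hAs⟩ := exists_cluster ρ (perceived ζ (R.state (k + 1)).last) hS.one_le hS.lt j
  have hF : (A.erase j).card = y := by rw [Finset.card_erase_of_mem hjA, hA]; omega
  obtain ⟨a₀, ha₀, hmax⟩ := (A.erase j).exists_max_image (sep ρ (config ζ (R.time k)) j)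
    (Finset.card_pos.1 (by rw [hF]; exact hS.one_le))
  set D := sep ρ (config ζ (R.time k)) j a₀ with hDdef
  have hσD : xSep ρ (config ζ (R.time k)) y j ≤ D :=
    xSep_le_of_card hS.one_le hF.ge fun a ha => ⟨Finset.ne_of_mem_erase ha, hmax a ha⟩
  have hD0 : 0 ≤ D := (hS.xSep_pos ht j).le.trans hσD
  have hkey := hS.key_of_le ht hσD
  have hdiam : DiamLE ρ ζ A (R.time k) (2 * D + 2 * ρ) := by
    refine DiamLE.of_star (j := j) hS.rho_pos.le hD0 fun a ha haj => ?_
    have := hmax a (Finset.mem_erase.2 ⟨haj, ha⟩)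
    simp only [sep, config] at this hDdef
    linarith
  have ha₀j : a₀ ≠ j := Finset.ne_of_mem_erase ha₀
  have ha₀A := Finset.mem_of_mem_erase ha₀
  have h1 := h _ (R.cur_lt_time k).le le_rfl A hA.ge _ hdiam a₀ ha₀A
  have h2 := hAs a₀ ha₀A ha₀j
  simp only [sep, perceived] at h2
  rw [R.last_succ, Function.update_self, Function.update_of_ne ha₀j, ← R.last_succ] at h2
  have h3 := hS.motion.speed a₀ _ ht _ (R.last_nonneg hS hP k a₀)
  have h4 := (R.last_le_cur hP k a₀).trans (R.cur_lt_time k).le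
  rw [abs_of_nonneg (by linarith)] at h3
  have h5 := dist_triangle (ζ j (R.time k)) (ζ a₀ ((R.state k).last a₀)) (ζ a₀ (R.time k))
  rw [dist_comm (ζ a₀ ((R.state k).last a₀))] at h5
  have h6 : xSep ρ (perceived ζ (R.state (k + 1)).last) y j = R.per (k + 1) j := rfl
  rw [h6] at h2
  simp only [sep, config] at hDdef
  linarith

lemma BucketRun.Recent.two_zpow_exp {R : BucketRun ρ ζ y t₀ p} {k : ℕ} (h : R.Recent k)
    (hS : Setup ρ ζ y) (hP : Precondition ρ ζ y t₀ I p) :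
    (2 : ℝ) ^ R.exp k ≤ lam d y / 24 * R.per (k + 1) (R.who k) ∧
      lam d y / 24 * R.per (k + 1) (R.who k) < 2 * (2 : ℝ) ^ R.exp k := by
  have h1 := h.le_per_succ hS hP
  have h2 := hS.xSep_pos (R.time_nonneg hS hP k) (R.who k)
  exact two_zpow_bucketExp (mul_pos (by linarith [hS.lam_pos]) (by linarith))

lemma Precondition.per_pos (hP : Precondition ρ ζ y t₀ I p) (hS : Setup ρ ζ y)
    (R : BucketRun ρ ζ y t₀ p) (i : Fin n) : 0 < R.per 0 i := by
  have h1 := hP.lower i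
  have h2 := hS.xSep_pos (hP.pos hS).le i
  rw [R.per_zero]; linarith

lemma Precondition.two_zpow_exp (hP : Precondition ρ ζ y t₀ I p) (hS : Setup ρ ζ y)
    (R : BucketRun ρ ζ y t₀ p) (i : Fin n) :
    (2 : ℝ) ^ bucketExp d y (R.per 0 i) ≤ lam d y / 24 * R.per 0 i ∧
      lam d y / 24 * R.per 0 i < 2 * (2 : ℝ) ^ bucketExp d y (R.per 0 i) := by
  have h1 := hP.per_pos hS R i
  have h3 := hS.lam_pos
  exact two_zpow_bucketExp (by positivity)

/-- With P the largest perceived separation in the cluster, every member has moved by at most P/12.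
Two displacements give P ≤ E + P/6. -/
lemma Precondition.per_zero_le (hP : Precondition ρ ζ y t₀ I p) (hS : Setup ρ ζ y)
    (R : BucketRun ρ ζ y t₀ p) {A : Finset (Fin n)} (hA : y + 1 ≤ A.card) {E : ℝ}
    (hE : DiamLE ρ ζ A t₀ E) : ∀ a ∈ A, R.per 0 a ≤ 6 / 5 * E := by
  obtain ⟨b, hb, hmax⟩ := A.exists_max_image (R.per 0) (Finset.card_pos.1 (by omega))
  suffices H : R.per 0 b ≤ E + R.per 0 b / 6 by
    intro a ha
    have := hmax a ha
    linarith
  have ht := (hP.pos hS).le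
  have hlam := hS.lam_lt
  have hmove : ∀ a ∈ A, dist (ζ a t₀) (ζ a (p a)) ≤ R.per 0 b / 12 := by
    intro a ha
    have h1 := hP.prompt a
    rw [← R.per_zero] at h1
    have h2 := hmax a ha
    have h3 := hP.per_pos hS R a
    have h4 := hS.motion.speed a _ ht _ (hP.last_nonneg a)
    rw [abs_of_nonneg (by linarith [hP.last_lt a])] at h4
    nlinarith
  refine R.per_le hS hA fun a ha _ => ?_
  rw [R.init_last]
  have h1 := hmove a ha
  have h2 := hmove b hb
  have h3 := hE b hb a ha
  have h4 := dist_triangle4 (ζ b (p b)) (ζ b t₀) (ζ a t₀) (ζ a (p a))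
  rw [dist_comm (ζ b (p b)) (ζ b t₀)] at h4
  linarith

/-- The waiting time of `l` is governed by its perceived separation at its last query. The invariant
for that earlier query bounds this by the diameter of the cluster then, which exceeds the present
one by at most twice the waiting time. -/
theorem BucketRun.recent (R : BucketRun ρ ζ y t₀ p) (hS : Setup ρ ζ y)
    (hP : Precondition ρ ζ y t₀ I p) (k : ℕ) : R.Recent k := by
  induction k using Nat.strong_induction_on with
  | _ k ih =>
  intro t htc htk A hA E hE l hl
  have hl0 := hS.lam_pos
  have hl1 := hS.lam_lt
  have ht0 := (hP.pos hS).le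
  have ht : 0 ≤ t := ht0.trans ((R.le_cur k).trans htc)
  have hEpos := hE.pos hS hA ht
  rcases R.unqueried_or_queriedAt k l with h | ⟨m, h⟩
  · rw [h.last]
    have h1 := h.time_le
    have h2 := (hP.two_zpow_exp hS R l).1
    have h3 := hP.prompt l
    rw [← R.per_zero] at h3
    have h4 := hP.per_zero_le hS R hA (hE.at_time hS ht0 ht) l hl
    rw [abs_sub_comm, abs_of_nonneg (by linarith [R.le_cur k])] at h4
    -- With P = `R.per 0 l`: the bounds t - t₀ ≤ λP/12 and P ≤ 6/5 (E + 2(t - t₀)) give P ≤ 3E/2,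
    -- while t - p l ≤ λP/6.
    have hpos := hP.per_pos hS R l
    have h5 : lam d y * R.per 0 l ≤ R.per 0 l := by nlinarith
    have h6 : R.per 0 l ≤ 3 / 2 * E := by linarith
    nlinarith
  · have hm := ih m h.lt
    rw [h.last]
    have hmt : R.time m ≤ t := (R.cur_strictMono.monotone (show m + 1 ≤ k from h.lt)).trans htc
    have h1 := h.time_le
    have hdm := hE.at_time hS (R.time_nonneg hS hP m) ht
    rw [abs_sub_comm, abs_of_nonneg (by linarith)] at hdm
    have h2 := (hm.two_zpow_exp hS hP).1
    have h3 := hm.per_succ_le hS hP hA hdm (by rw [h.who]; exact hl)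
    set u := t - R.time m with hu
    have hu0 : 0 ≤ u := by linarith
    -- As λ < 1, this resolves to u ≤ (5/22) λE, which is less than λE/4.
    have h4 : u ≤ lam d y / 8 * (5 / 4 * (E + 2 * u)) := by
      have h5 : R.per (m + 1) (R.who m) ≤ 5 / 4 * (E + 2 * u) := by nlinarith
      have h6 : lam d y / 8 * R.per (m + 1) (R.who m) ≤ lam d y / 8 * (5 / 4 * (E + 2 * u)) := by
        gcongr
      linarith
    have h7 : lam d y * u ≤ u := by nlinarith
    nlinarith

/-! ### Uncertainty degree and ply -/

/-- At most `y` entities have uncertainty regions that meet that of a given one. -/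
theorem BucketRun.card_le_of_meet (R : BucketRun ρ ζ y t₀ p) (hS : Setup ρ ζ y)
    (hP : Precondition ρ ζ y t₀ I p) {k : ℕ} {t : ℝ} (htc : R.cur k ≤ t) (htk : t ≤ R.time k)
    {S : Finset (Fin n)} {i : Fin n} (hi : i ∈ S)
    (h : ∀ j ∈ S, dist (ζ i ((R.state k).last i)) (ζ j ((R.state k).last j)) ≤
      2 * ρ + (t - (R.state k).last i) + (t - (R.state k).last j)) : S.card ≤ y := by
  classical
  by_contra hcard
  have hA : y + 1 ≤ S.card := by omega
  have hl0 := hS.lam_pos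
  have hl1 := hS.lam_lt
  have hρ := hS.rho_pos
  have ht0 := (hP.pos hS).le
  have ht : 0 ≤ t := ht0.trans ((R.le_cur k).trans htc)
  set la := (R.state k).last with hla
  -- The configuration is examined at the last query of the entity that has waited longest; all
  -- others have been queried since, or at that time.
  obtain ⟨j, hj, hmax⟩ := S.exists_max_image (fun a => t - la a) ⟨i, hi⟩
  set M := t - la j with hM
  have hh : ∀ a ∈ S, 0 ≤ t - la a ∧ t - la a ≤ M := fun a ha =>
    ⟨by linarith [R.last_le_cur hP k a], hmax a ha⟩
  have hτ0 : 0 ≤ la j := R.last_nonneg hS hP k j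
  have hback : ∀ a ∈ S, dist (ζ a (la j)) (ζ a (la a)) ≤ M - (t - la a) := by
    intro a ha
    have h1 := hS.motion.speed a _ hτ0 _ (R.last_nonneg hS hP k a)
    rw [abs_sub_comm, abs_of_nonneg (by linarith [(hh a ha).2])] at h1
    linarith
  -- An entity queried h ago has moved by at most M - h between the time examined and its own query,
  -- which cancels the growth h of its region.
  have hstar : ∀ a ∈ S, dist (ζ i (la j)) (ζ a (la j)) ≤ 2 * ρ + 2 * M := by
    intro a ha
    have h1 := hback i hi
    have h2 := hback a ha
    have h3 := h a ha
    have h4 := dist_triangle4 (ζ i (la j)) (ζ i (la i)) (ζ a (la a)) (ζ a (la j))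
    rw [dist_comm (ζ a (la a))] at h4
    linarith
  have hσ : xSep ρ (config ζ (la j)) y i ≤ 2 * M := by
    refine xSep_le_of_card hS.one_le (F := S.erase i)
      (by rw [Finset.card_erase_of_mem hi]; omega) fun a ha => ⟨Finset.ne_of_mem_erase ha, ?_⟩
    have := hstar a (Finset.mem_of_mem_erase ha)
    simp only [sep, config]
    linarith
  have hMpos : 0 < M := by linarith [hS.xSep_pos hτ0 i]
  have hkey := hS.key_of_le hτ0 hσ
  have hdiam : DiamLE ρ ζ S (la j) (2 * ρ + 4 * M) := by
    intro a ha b hb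
    have h1 := hback a ha
    have h2 := hback b hb
    have h3 := h a ha
    have h4 := h b hb
    have h5 := dist_triangle4 (ζ a (la j)) (ζ a (la a)) (ζ b (la b)) (ζ b (la j))
    have h6 := dist_triangle_left (ζ a (la a)) (ζ b (la b)) (ζ i (la i))
    rw [dist_comm (ζ b (la b))] at h5
    linarith [(hh i hi).2]
  rcases R.unqueried_or_queriedAt k j with hq | ⟨m, hq⟩
  · have hw := hq.time_le
    have h2 := (hP.two_zpow_exp hS R j).1
    have h3 := hP.prompt j
    rw [← R.per_zero] at h3
    have hlj : la j = p j := hq.last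
    have hlt := hP.last_lt j
    have hwt : t₀ ≤ t := (R.le_cur k).trans htc
    have hdiam0 := hdiam.at_time hS ht0 hτ0
    rw [abs_of_nonneg (by linarith), hlj] at hdiam0
    have hper0 := hP.per_zero_le hS R hA hdiam0
    have hprompt : ∀ b ∈ S, t₀ - p b ≤ (2 * ρ + 4 * M + 2 * (t₀ - p j)) / 10 := by
      intro b hb
      have h4 := hP.prompt b
      rw [← R.per_zero] at h4
      have h5 := hper0 b hb
      have h6 := hP.per_pos hS R b
      nlinarith
    -- The initial perception uses the location of `b` at `p b`, even if `b` has been queried since.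
    -- The detour from the later query back to `p b` is paid for by `hprompt`.
    have hper : R.per 0 j ≤ 11 / 5 * ρ + 22 / 5 * M := by
      refine R.per_le hS hA fun b hb _ => ?_
      rw [R.init_last]
      have h4 := h j hj
      have h5 := h b hb
      have h6 := dist_triangle_left (ζ j (la j)) (ζ b (la b)) (ζ i (la i))
      have h7 := (hh i hi).2
      rcases R.unqueried_or_queriedAt k b with hb' | ⟨m, hb'⟩
      · have h8 : la b = p b := hb'.last
        rw [hlj, h8] at h6
        rw [hlj] at h4
        rw [h8] at h5
        have h9 := (hh b hb).2
        rw [h8] at h9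
        linarith
      · have h8 : la b = R.time m := hb'.last
        have h9 := R.lt_time m
        have h10 := hS.motion.speed b _ (R.last_nonneg hS hP k b) _ (hP.last_nonneg b)
        have h12 := hP.last_lt b
        rw [abs_of_nonneg (by linarith)] at h10
        have h11 := dist_triangle (ζ j (la j)) (ζ b (la b)) (ζ b (p b))
        have h13 := hprompt b hb
        rw [← hlj]
        linarith
    -- Then M ≤ (11/30) λ(ρ + 2M) ≤ (22/30) M by `hkey`, which is absurd.
    have h14 : M ≤ lam d y / 6 * R.per 0 j := by rw [hM, hlj]; linarith
    have h15 : lam d y / 6 * R.per 0 j ≤ lam d y / 6 * (11 / 5 * ρ + 22 / 5 * M) := by gcongr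
    linarith
  · have hlj : la j = R.time m := hq.last
    have hm := R.recent hS hP m
    have h1 := hq.time_le
    have h2 := (hm.two_zpow_exp hS hP).1
    rw [hlj] at hdiam
    have h3 := hm.per_succ_le hS hP hA hdiam (by rw [hq.who]; exact hj)
    have h4 : R.per (m + 1) (R.who m) ≤ 5 / 4 * (2 * ρ + 4 * M) := by nlinarith
    -- Together with `hkey` this yields M ≤ (5/16) λ(ρ + 2M) ≤ (5/8) M, which is absurd.
    have h5 : lam d y / 8 * R.per (m + 1) (R.who m) ≤ lam d y / 8 * (5 / 4 * (2 * ρ + 4 * M)) := by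
      gcongr
    have h6 : M ≤ lam d y / 8 * R.per (m + 1) (R.who m) := by rw [hM, hlj]; linarith
    linarith

/-- A query at time t is not prior to t, hence the strict inequality. The instant t₀ is allowed for
k = 0 because the initial queries come before it. -/
lemma BucketRun.isLastQuery (R : BucketRun ρ ζ y t₀ p) (hP : Precondition ρ ζ y t₀ I p) {k : ℕ}
    {t : ℝ} (htc : R.cur k < t ∨ (k = 0 ∧ t₀ ≤ t)) (htk : t ≤ R.time k) (i : Fin n) :
    IsLastQuery (R.scheme I i) t ((R.state k).last i) := by
  have hct : R.cur k ≤ t := by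
    rcases htc with h | ⟨rfl, h⟩
    · exact h.le
    · exact h
  have hrun : ∀ m, R.time m < t → m < k := fun m hm =>
    R.time_strictMono.lt_iff_lt.1 (hm.trans_le htk)
  rcases R.unqueried_or_queriedAt k i with h | ⟨m, h⟩
  · rw [h.last]
    have h1 := hP.isLast i
    have hlt := (hP.last_lt i).trans_le ((R.le_cur k).trans hct)
    refine ⟨⟨Or.inl h1.1.1, hlt⟩, ?_⟩
    rintro s ⟨hs | ⟨m, hm, rfl⟩, hst⟩
    · exact h1.2 ⟨hs, hP.before i hs⟩
    · exact absurd hm (h.who_ne m (hrun m hst))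
  · rw [h.last]
    have hlt : R.time m < t := by
      rcases htc with h' | ⟨rfl, -⟩
      · exact (R.cur_strictMono.monotone (show m + 1 ≤ k from h.lt)).trans_lt h'
      · exact absurd h.lt (Nat.not_lt_zero m)
    refine ⟨⟨Or.inr ⟨m, h.who, rfl⟩, hlt⟩, ?_⟩
    rintro s ⟨hs | ⟨m', hm, rfl⟩, hst⟩
    · exact (hP.before i hs).le.trans (R.lt_time m).le
    · by_contra hlt'
      push Not at hlt'
      exact h.who_ne m' (R.time_strictMono.lt_iff_lt.1 hlt') (hrun m' hst) hm

theorem BucketRun.degree_le (R : BucketRun ρ ζ y t₀ p) (hS : Setup ρ ζ y)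
    (hP : Precondition ρ ζ y t₀ I p) {k : ℕ} {t : ℝ} (htc : R.cur k < t ∨ (k = 0 ∧ t₀ ≤ t))
    (htk : t ≤ R.time k) : degree ρ ζ (R.scheme I) t ≤ y := by
  classical
  have hct : R.cur k ≤ t := by
    rcases htc with h | ⟨rfl, h⟩
    · exact h.le
    · exact h
  refine Finset.sup_le fun i _ => ?_
  rw [Set.ncard_eq_toFinset_card']
  have hr : ∀ j, ∀ z ∈ region ρ ζ (R.scheme I) t j,
      dist z (ζ j ((R.state k).last j)) ≤ ρ + (t - (R.state k).last j) :=
    fun j z hz => hz _ (R.isLastQuery hP htc htk j)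
  have hmem : i ∈ {j : Fin n |
      (region ρ ζ (R.scheme I) t i ∩ region ρ ζ (R.scheme I) t j).Nonempty}.toFinset := by
    simp only [Set.mem_toFinset, Set.mem_ofPred_eq, Set.inter_self]
    refine ⟨ζ i ((R.state k).last i), fun p' hp' => ?_⟩
    rw [hp'.unique (R.isLastQuery hP htc htk i), dist_self]
    linarith [R.last_le_cur hP k i, hS.rho_pos]
  refine R.card_le_of_meet hS hP hct htk hmem fun j hj => ?_
  simp only [Set.mem_toFinset, Set.mem_ofPred_eq] at hj
  obtain ⟨z, hzi, hzj⟩ := hj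
  have h1 := hr i z hzi
  have h2 := hr j z hzj
  have h3 := dist_triangle_left (ζ i ((R.state k).last i)) (ζ j ((R.state k).last j)) z
  linarith

lemma ncard_region_le_degree (ρ : ℝ) (ζ : Fin n → ℝ → Space d) (Q : Scheme n) (t : ℝ)
    (z : Space d) : {i : Fin n | z ∈ region ρ ζ Q t i}.ncard ≤ degree ρ ζ Q t := by
  rcases Set.eq_empty_or_nonempty {i : Fin n | z ∈ region ρ ζ Q t i} with h | ⟨i, hi⟩
  · rw [h, Set.ncard_empty]; exact Nat.zero_le _
  · refine le_trans ?_ (Finset.le_sup (f := fun i : Fin n =>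
      {j : Fin n | (region ρ ζ Q t i ∩ region ρ ζ Q t j).Nonempty}.ncard) (Finset.mem_univ i))
    exact Set.ncard_le_ncard (fun j hj => ⟨z, hi, hj⟩) (Set.toFinite _)

lemma ply_le_degree (ρ : ℝ) (ζ : Fin n → ℝ → Space d) (Q : Scheme n) (t : ℝ) :
    ply ρ ζ Q t ≤ degree ρ ζ Q t :=
  ciSup_le fun z => ncard_region_le_degree ρ ζ Q t z

lemma ncard_region_le_ply (ρ : ℝ) (ζ : Fin n → ℝ → Space d) (Q : Scheme n) (t : ℝ)
    (z : Space d) : {i : Fin n | z ∈ region ρ ζ Q t i}.ncard ≤ ply ρ ζ Q t :=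
  le_ciSup (f := fun z : Space d => {i : Fin n | z ∈ region ρ ζ Q t i}.ncard)
    ⟨degree ρ ζ Q t, by rintro _ ⟨z, rfl⟩; exact ncard_region_le_degree ρ ζ Q t z⟩ z

end Perception

/-! ### Gaps between successive queries. -/

section Granularity

variable {d n : ℕ} {ρ : ℝ} {ζ : Fin n → ℝ → Space d} {y : ℕ} {t₀ : ℝ} {p : Fin n → ℝ}
  {I : Scheme n}

/-- The bucket in which an entity was scheduled is comparable in length with its separation at
that time, and not far in the future. -/
lemma BucketRun.exists_arrival (R : BucketRun ρ ζ y t₀ p) (hS : Setup ρ ζ y)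
    (hP : Precondition ρ ζ y t₀ I p) (m : ℕ) (l : Fin n) :
    ∃ τ, t₀ ≤ τ ∧ τ ≤ R.cur m ∧ (R.nom m l).finish ≤ τ + 3 * (R.nom m l).len ∧
      lam d y * xSep ρ (config ζ τ) y l ≤ 96 * (R.nom m l).len := by
  rcases R.unqueried_or_queriedAt m l with h | ⟨k, h⟩
  · refine ⟨t₀, le_rfl, R.le_cur m, ?_, ?_⟩
    · rw [h.nom, Bucket.finish_eq, firstBucketAfter_len]
      have := (firstBucketAfter_start (bucketExp d y (R.per 0 l)) t₀).2
      have : (0 : ℝ) < 2 ^ bucketExp d y (R.per 0 l) := zpow_pos two_pos _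
      linarith
    · rw [h.nom, firstBucketAfter_len]
      have h1 := (hP.two_zpow_exp hS R l).2
      have h2 := hP.lower l
      rw [← R.per_zero] at h2
      have := hS.lam_pos
      nlinarith
  · have hm := R.recent hS hP k
    refine ⟨R.time k, (R.lt_time k).le, R.cur_strictMono.monotone (show k + 1 ≤ m from h.lt), ?_, ?_⟩
    · rw [h.nom, Bucket.finish_eq, firstBucketAfter_len]
      have := (firstBucketAfter_start (R.exp k) (R.time k + (2 : ℝ) ^ R.exp k)).2
      linarith
    · rw [h.nom, firstBucketAfter_len]
      have h1 := (hm.two_zpow_exp hS hP).2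
      have h2 := hm.le_per_succ hS hP
      rw [h.who] at h1 h2
      have := hS.lam_pos
      nlinarith

/-- The entities that `Loaded.exists_heavy` finds behind `X` still have separations O(|Y| + g)/λ at
time t, since |Y| and g also bound the time elapsed since their scheduling. -/
lemma BucketRun.le_demand_of_occupied (R : BucketRun ρ ζ y t₀ p) (hS : Setup ρ ζ y)
    (hP : Precondition ρ ζ y t₀ I p) {k : ℕ} {i : Fin n} {X : Bucket}
    (hX : (R.state k).bucket i = some X) {t g : ℝ} (hkt : R.cur k ≤ t) (ht : t ≤ X.mid + g)
    (hg : X.len / 2 ≤ g) : lam d y / 416 / g ≤ demand ρ ζ y t := by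
  obtain ⟨L, Y, hY, hsum⟩ := (R.inv k).loaded.exists_heavy hX
  have hl0 := hS.lam_pos
  have hX0 := X.len_pos
  have hg0 : 0 < g := by linarith
  have ht0 : 0 ≤ t := (hP.pos hS).le.trans ((R.le_cur k).trans hkt)
  have hσ : ∀ l ∈ L, lam d y * xSep ρ (config ζ t) y l ≤ 102 * (Y l).len + 2 * g := by
    intro l hl
    obtain ⟨⟨m, hm, hmY⟩, hw⟩ := hY l hl
    obtain ⟨τ, h1, h2, h3, h4⟩ := R.exists_arrival hS hP m l
    rw [hmY] at h3 h4
    have h5 : τ ≤ t := h2.trans ((R.cur_strictMono.monotone hm).trans hkt)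
    have h6 := hS.xSep_lipschitz ((hP.pos hS).le.trans h1) ht0 l
    rw [abs_sub_comm, abs_of_nonneg (by linarith)] at h6
    have h7 := hw.mid_mem.2
    have h8 : t - τ ≤ 3 * (Y l).len + g := by linarith
    have h9 := hS.lam_lt
    have h10 : lam d y * (t - τ) ≤ t - τ := by nlinarith
    nlinarith
  have hpos : ∀ l, 0 < xSep ρ (config ζ t) y l := fun l => hS.xSep_pos ht0 l
  have hdem : ∑ l ∈ L, 1 / xSep ρ (config ζ t) y l ≤ demand ρ ζ y t :=
    Finset.sum_le_sum_of_subset_of_nonneg (Finset.subset_univ L)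
      fun l _ _ => (one_div_pos.2 (hpos l)).le
  refine le_trans ?_ hdem
  -- A single entity with a bucket of length at most g suffices. Otherwise all separations are
  -- O(|Y|)/λ, and the weighted sum of `exists_heavy` applies.
  by_cases hex : ∃ l ∈ L, (Y l).len ≤ g
  · obtain ⟨l, hl, hlg⟩ := hex
    refine le_trans ?_ (Finset.single_le_sum
      (f := fun l => 1 / xSep ρ (config ζ t) y l) (fun l _ => (one_div_pos.2 (hpos l)).le) hl)
    have := hσ l hl
    rw [div_div, div_le_div_iff₀ (by positivity) (hpos l)]
    linarith
  · push Not at hex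
    have h1 : ∀ l ∈ L, lam d y / (104 * X.len) * (X.len / (Y l).len) ≤
        1 / xSep ρ (config ζ t) y l := by
      intro l hl
      have h2 := hσ l hl
      have h3 := hex l hl
      have h4 := (Y l).len_pos
      have h5 : lam d y / (104 * X.len) * (X.len / (Y l).len) = lam d y / (104 * (Y l).len) := by
        field_simp
      rw [h5, div_le_div_iff₀ (by positivity) (hpos l)]
      linarith
    refine le_trans ?_ (Finset.sum_le_sum h1)
    rw [← Finset.mul_sum]
    calc lam d y / 416 / g ≤ lam d y / (104 * X.len) * (1 / 2) := by
          rw [div_div, div_mul_eq_mul_div, div_le_div_iff₀ (by positivity) (by positivity)]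
          nlinarith
      _ ≤ _ := by gcongr

lemma Setup.demand_pos (hS : Setup ρ ζ y) {t : ℝ} (ht : 0 ≤ t) : 0 < demand ρ ζ y t := by
  have : Nonempty (Fin n) := ⟨⟨0, (Nat.zero_le y).trans_lt hS.lt⟩⟩
  exact Finset.sum_pos (fun i _ => one_div_pos.2 (hS.xSep_pos ht i)) Finset.univ_nonempty

/-- Both query times are midpoints of buckets occupied just before the respective queries. The
shorter bucket has at most twice the length of the gap, and its being occupied forces a large
demand. -/
theorem BucketRun.granularity (R : BucketRun ρ ζ y t₀ p) (hS : Setup ρ ζ y)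
    (hP : Precondition ρ ζ y t₀ I p) (k : ℕ) {t : ℝ}
    (ht : t ∈ Set.Icc (R.time k) (R.time (k + 1))) :
    lam d y / 416 / demand ρ ζ y t ≤ R.time (k + 1) - R.time k := by
  have hlt := R.cur_lt_time (k + 1)
  have ht0 : 0 ≤ t := (R.time_nonneg hS hP k).trans ht.1
  have hg : 0 < R.time (k + 1) - R.time k := sub_pos.2 hlt
  have hdem : lam d y / 416 / (R.time (k + 1) - R.time k) ≤ demand ρ ζ y t := by
    obtain ⟨X, hX, hXt⟩ := (R.step k).1
    obtain ⟨X', hX', hXt'⟩ := (R.step (k + 1)).1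
    have h1 : X.mid < X'.mid := by rw [← hXt, ← hXt']; exact hlt
    have h2 := ht.1
    have h3 := ht.2
    rcases exists_len_le_of_mid_lt h1 with h | h <;> rw [← hXt, ← hXt'] at h
    · exact R.le_demand_of_occupied hS hP hX ((R.cur_lt_time k).le.trans h2) (by linarith) h
    · exact R.le_demand_of_occupied hS hP hX' h2 (by linarith) h
  have hd := hS.demand_pos ht0
  rw [div_le_iff₀ hg] at hdem
  rw [div_le_iff₀ hd]
  linarith

/-- The query times of a run are unbounded. -/
lemma BucketRun.exists_le_time (R : BucketRun ρ ζ y t₀ p) (hS : Setup ρ ζ y)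
    (hP : Precondition ρ ζ y t₀ I p) (t : ℝ) : ∃ k, t ≤ R.time k := by
  have hl0 := hS.lam_pos
  have hρ := hS.rho_pos
  have hn : (0 : ℝ) < n := by exact_mod_cast (Nat.zero_le y).trans_lt hS.lt
  set δ : ℝ := lam d y / 416 / (n * (1 / (lam d y * ρ))) with hδ
  -- Separations are at least λρ, so the demand is bounded and the gaps are uniformly positive.
  have hδ0 : 0 < δ := by positivity
  have hgap : ∀ k, R.time k + δ ≤ R.time (k + 1) := by
    intro k
    have h0 := R.time_nonneg hS hP k
    have h1 := R.granularity hS hP k (t := R.time k) ⟨le_rfl, (R.cur_lt_time (k + 1)).le⟩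
    have h2 : demand ρ ζ y (R.time k) ≤ n * (1 / (lam d y * ρ)) := by
      have : ∑ i : Fin n, 1 / xSep ρ (config ζ (R.time k)) y i ≤
          ∑ _i : Fin n, 1 / (lam d y * ρ) :=
        Finset.sum_le_sum fun i _ =>
          one_div_le_one_div_of_le (by positivity) (hS.xSep_lower h0 i)
      simpa [demand] using this
    have h3 : δ ≤ lam d y / 416 / demand ρ ζ y (R.time k) :=
      div_le_div_of_nonneg_left (by positivity) (hS.demand_pos h0) h2
    linarith
  have hlin : ∀ k : ℕ, R.time 0 + k * δ ≤ R.time k := by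
    intro k
    induction k with
    | zero => simp
    | succ k ih => push_cast; linarith [hgap k]
  obtain ⟨k, hk⟩ := exists_nat_ge ((t - R.time 0) / δ)
  rw [div_le_iff₀ hδ0] at hk
  exact ⟨k, by linarith [hlin k]⟩

lemma BucketRun.exists_state (R : BucketRun ρ ζ y t₀ p) (hS : Setup ρ ζ y)
    (hP : Precondition ρ ζ y t₀ I p) {t : ℝ} (ht : t₀ ≤ t) :
    ∃ k, (R.cur k < t ∨ (k = 0 ∧ t₀ ≤ t)) ∧ t ≤ R.time k := by
  classical
  have hex := R.exists_le_time hS hP t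
  refine ⟨Nat.find hex, ?_, Nat.find_spec hex⟩
  rcases Nat.eq_zero_or_pos (Nat.find hex) with h | h
  · exact Or.inr ⟨h, ht⟩
  · left
    obtain ⟨m, hm⟩ := Nat.exists_eq_succ_of_ne_zero h.ne'
    have := Nat.find_min hex (m := m) (by omega)
    rw [hm]
    exact not_le.1 this

end Granularity

/-! ### The number of queries of a run against the integrated demand. -/

section Count

variable {d n : ℕ} {ρ : ℝ} {ζ : Fin n → ℝ → Space d} {y : ℕ} {t₀ : ℝ} {p : Fin n → ℝ}
  {I : Scheme n}

lemma Setup.continuousOn_xSep (hS : Setup ρ ζ y) (i : Fin n) :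
    ContinuousOn (fun t => xSep ρ (config ζ t) y i) (Set.Ici 0) := by
  have : LipschitzOnWith 2 (fun t => xSep ρ (config ζ t) y i) (Set.Ici 0) := by
    refine LipschitzOnWith.of_dist_le_mul fun s hs t ht => ?_
    rw [Real.dist_eq, Real.dist_eq, abs_sub_le_iff]
    have h1 := hS.xSep_lipschitz hs ht i
    have h2 := hS.xSep_lipschitz ht hs i
    rw [abs_sub_comm] at h2
    push_cast
    constructor <;> linarith
  exact this.continuousOn

lemma Setup.intervalIntegrable (hS : Setup ρ ζ y) (i : Fin n) {a b : ℝ} (ha : 0 ≤ a) (hb : 0 ≤ b) :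
    IntervalIntegrable (fun t => 1 / xSep ρ (config ζ t) y i) volume a b := by
  refine ContinuousOn.intervalIntegrable ?_
  have hsub : Set.uIcc a b ⊆ Set.Ici 0 := fun u hu => (le_min ha hb).trans hu.1
  refine continuousOn_const.div ((hS.continuousOn_xSep i).mono hsub) fun u hu => ?_
  exact (hS.xSep_pos (hsub hu) i).ne'

lemma Setup.integral_le (hS : Setup ρ ζ y) (i : Fin n) {a b m : ℝ} (ha : 0 ≤ a) (hab : a ≤ b)
    (hm : 0 < m) (h : ∀ u ∈ Set.Icc a b, m ≤ xSep ρ (config ζ u) y i) :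
    ∫ t in a..b, 1 / xSep ρ (config ζ t) y i ≤ (b - a) / m := by
  have := intervalIntegral.integral_mono_on hab (hS.intervalIntegrable i ha (ha.trans hab))
    (intervalIntegrable_const (c := 1 / m)) fun _ hu => one_div_le_one_div_of_le hm (h _ hu)
  rwa [intervalIntegral.integral_const, smul_eq_mul, mul_one_div] at this

lemma Setup.le_integral (hS : Setup ρ ζ y) (i : Fin n) {a b m : ℝ} (ha : 0 ≤ a) (hab : a ≤ b)
    (h : ∀ u ∈ Set.Icc a b, xSep ρ (config ζ u) y i ≤ m) :
    (b - a) / m ≤ ∫ t in a..b, 1 / xSep ρ (config ζ t) y i := by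
  have := intervalIntegral.integral_mono_on hab (intervalIntegrable_const (c := 1 / m))
    (hS.intervalIntegrable i ha (ha.trans hab))
    fun _ hu => one_div_le_one_div_of_le (hS.xSep_pos (ha.trans hu.1) i) (h _ hu)
  rwa [intervalIntegral.integral_const, smul_eq_mul, mul_one_div] at this

lemma Setup.integral_nonneg (hS : Setup ρ ζ y) (i : Fin n) {a b : ℝ} (ha : 0 ≤ a) (hab : a ≤ b) :
    0 ≤ ∫ t in a..b, 1 / xSep ρ (config ζ t) y i :=
  intervalIntegral.integral_nonneg hab fun _u hu =>
    (one_div_pos.2 (hS.xSep_pos (ha.trans hu.1) i)).le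

lemma Setup.integral_add (hS : Setup ρ ζ y) (i : Fin n) {a b c : ℝ} (ha : 0 ≤ a) (hb : 0 ≤ b)
    (hc : 0 ≤ c) :
    (∫ t in a..b, 1 / xSep ρ (config ζ t) y i) + ∫ t in b..c, 1 / xSep ρ (config ζ t) y i =
      ∫ t in a..c, 1 / xSep ρ (config ζ t) y i :=
  intervalIntegral.integral_add_adjacent_intervals (hS.intervalIntegrable i ha hb)
    (hS.intervalIntegrable i hb hc)

/-- The wait is at most 3 · (λ/24) · (3/2)σ. During it σ changes by at most 3/8 of its initial
value, so it stays between 5/8 and 11/8 of that value. -/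
lemma BucketRun.time_sub_le (R : BucketRun ρ ζ y t₀ p) (hS : Setup ρ ζ y)
    (hP : Precondition ρ ζ y t₀ I p) (k : ℕ) (i : Fin n) :
    R.time k - max t₀ ((R.state k).last i) ≤
      3 / 16 * xSep ρ (config ζ (max t₀ ((R.state k).last i))) y i := by
  have hl0 := hS.lam_pos
  have hl1 := hS.lam_lt
  rcases R.unqueried_or_queriedAt k i with h | ⟨m, h⟩
  · rw [h.last, max_eq_left (hP.last_lt i).le]
    have h1 := h.time_le
    have h2 := (hP.two_zpow_exp hS R i).1
    have h3 := hP.upper i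
    rw [← R.per_zero] at h3
    have h4 := hP.per_pos hS R i
    have h5 := hS.xSep_pos (hP.pos hS).le i
    nlinarith
  · rw [h.last, max_eq_right (R.lt_time m).le]
    have hm := R.recent hS hP m
    have h1 := h.time_le
    have h2 := (hm.two_zpow_exp hS hP).1
    have h3 := hm.per_succ_le' hS hP
    have h4 := hm.le_per_succ hS hP
    rw [h.who] at h2 h3 h4
    have h5 := hS.xSep_pos (R.time_nonneg hS hP m) i
    nlinarith

lemma BucketRun.integral_le_one (R : BucketRun ρ ζ y t₀ p) (hS : Setup ρ ζ y)
    (hP : Precondition ρ ζ y t₀ I p) (k : ℕ) (i : Fin n) {a b : ℝ}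
    (ha : max t₀ ((R.state k).last i) ≤ a) (hab : a ≤ b) (hb : b ≤ R.time k) :
    ∫ t in a..b, 1 / xSep ρ (config ζ t) y i ≤ 1 := by
  have h1 := R.time_sub_le hS hP k i
  set τ := max t₀ ((R.state k).last i)
  have hτ0 : 0 ≤ τ := (hP.pos hS).le.trans (le_max_left _ _)
  have hσ := hS.xSep_pos hτ0 i
  refine (hS.integral_le i (hτ0.trans ha) hab
    (m := 5 / 8 * xSep ρ (config ζ τ) y i) (by positivity) fun u hu => ?_).trans ?_
  · have h2 := hS.xSep_lipschitz (hτ0.trans (ha.trans hu.1)) hτ0 i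
    rw [abs_of_nonneg (by linarith [hu.1])] at h2
    linarith [hu.2]
  · rw [div_le_one (by positivity)]
    linarith

/-- The wait exceeds one bucket length, hence λσ/96, while the separation stays below 11σ/8; the
quotient is λ/132. -/
lemma BucketRun.QueriedAt.le_integral {R : BucketRun ρ ζ y t₀ p} {k m : ℕ}
    (h : R.QueriedAt k (R.who k) m) (hS : Setup ρ ζ y) (hP : Precondition ρ ζ y t₀ I p) :
    lam d y / 132 ≤ ∫ t in R.time m..R.time k, 1 / xSep ρ (config ζ t) y (R.who k) := by
  have hm := R.recent hS hP m
  have ht := R.time_nonneg hS hP m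
  have h1 := R.time_sub_le hS hP k (R.who k)
  rw [h.last, max_eq_right (R.lt_time m).le] at h1
  have h2 := h.lt_time
  have h3 := (hm.two_zpow_exp hS hP).2
  have h4 := hm.le_per_succ hS hP
  rw [h.who] at h3 h4
  have hσ := hS.xSep_pos ht (R.who k)
  have hle := (R.time_strictMono h.lt).le
  have hl0 := hS.lam_pos
  refine le_trans ?_ (hS.le_integral (R.who k) ht hle
    (m := 11 / 8 * xSep ρ (config ζ (R.time m)) y (R.who k)) fun u hu => ?_)
  · rw [div_le_div_iff₀ (by norm_num) (by positivity)]
    nlinarith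
  · have h5 := hS.xSep_lipschitz ht (ht.trans hu.1) (R.who k)
    rw [abs_sub_comm, abs_of_nonneg (by linarith [hu.1])] at h5
    linarith [hu.2]

/-- The indices before `k` of the queries to entity `i` that are not made before time `s`. -/
noncomputable def BucketRun.queries (R : BucketRun ρ ζ y t₀ p) (s : ℝ) (i : Fin n) (k : ℕ) :
    Finset ℕ :=
  open Classical in (Finset.range k).filter fun m => R.who m = i ∧ s ≤ R.time m

lemma BucketRun.queries_succ_of_not (R : BucketRun ρ ζ y t₀ p) {s : ℝ} {i : Fin n} {k : ℕ}
    (h : ¬ (R.who k = i ∧ s ≤ R.time k)) : R.queries s i (k + 1) = R.queries s i k := by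
  rw [queries, Finset.range_add_one, Finset.filter_insert, if_neg h, queries]

lemma BucketRun.card_queries_succ (R : BucketRun ρ ζ y t₀ p) {s : ℝ} {i : Fin n} {k : ℕ}
    (h : R.who k = i ∧ s ≤ R.time k) :
    (R.queries s i (k + 1)).card = (R.queries s i k).card + 1 := by
  rw [queries, Finset.range_add_one, Finset.filter_insert, if_pos h,
    Finset.card_insert_of_notMem (by simp), queries]

lemma BucketRun.integral_queries (R : BucketRun ρ ζ y t₀ p) (hS : Setup ρ ζ y)
    (hP : Precondition ρ ζ y t₀ I p) {s : ℝ} (hs : t₀ ≤ s) (i : Fin n) (k : ℕ) :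
    ∫ t in s..max s ((R.state k).last i), 1 / xSep ρ (config ζ t) y i ≤ (R.queries s i k).card ∧
    lam d y / 132 * ((R.queries s i k).card - 1) ≤
      ∫ t in s..max s ((R.state k).last i), 1 / xSep ρ (config ζ t) y i := by
  have hs0 : 0 ≤ s := (hP.pos hS).le.trans hs
  have hl0 := hS.lam_pos
  induction k with
  | zero =>
    rw [R.init_last, max_eq_left ((hP.last_lt i).le.trans hs), intervalIntegral.integral_same]
    simp [queries]
    positivity
  | succ k ih =>
    by_cases hi : R.who k = i
    · have hlast : (R.state (k + 1)).last i = R.time k := by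
        rw [R.last_succ, hi, Function.update_self]
      rw [hlast]
      by_cases hst : s ≤ R.time k
      · rw [R.card_queries_succ ⟨hi, hst⟩, max_eq_right hst]
        push_cast
        have hle : max s ((R.state k).last i) ≤ R.time k :=
          max_le hst ((R.last_le_cur hP k i).trans (R.cur_lt_time k).le)
        have hm0 : 0 ≤ max s ((R.state k).last i) := hs0.trans (le_max_left _ _)
        rw [← hS.integral_add i hs0 hm0 (hs0.trans hst)]
        have h1 := R.integral_le_one hS hP k i (max_le_max_right _ hs) hle le_rfl
        have h2 := hS.integral_nonneg i hm0 hle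
        have h3 := hS.integral_nonneg i hs0 (le_max_left s ((R.state k).last i))
        refine ⟨by linarith [ih.1], ?_⟩
        rcases Finset.eq_empty_or_nonempty (R.queries s i k) with hq | ⟨m', hm'⟩
        · rw [hq, Finset.card_empty, Nat.cast_zero]; linarith
        · simp only [queries, Finset.mem_filter, Finset.mem_range] at hm'
          rcases R.unqueried_or_queriedAt k i with h | ⟨m, h⟩
          · exact absurd hm'.2.1 (h.who_ne m' hm'.1)
          · have hmm : m' ≤ m := by
              by_contra hlt
              exact h.who_ne m' (not_le.1 hlt) hm'.1 hm'.2.1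
            have hsm : s ≤ R.time m := hm'.2.2.trans (R.time_strictMono.monotone hmm)
            have h4 := ih.2
            rw [h.last, max_eq_right hsm] at h4 ⊢
            subst hi
            have h5 := h.le_integral hS hP
            linarith
      · rw [R.queries_succ_of_not fun h => hst h.2, max_eq_left (not_le.1 hst).le,
          intervalIntegral.integral_same]
        have hq : R.queries s i k = ∅ := by
          refine Finset.filter_eq_empty_iff.2 fun m hm h => hst ?_
          exact h.2.trans (R.time_strictMono.monotone (Finset.mem_range.1 hm).le)
        rw [hq]
        simp
        positivity
    · have hlast : (R.state (k + 1)).last i = (R.state k).last i := by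
        rw [R.last_succ, Function.update_of_ne fun h => hi h.symm]
      rw [hlast, R.queries_succ_of_not fun h => hi h.1]
      exact ih

lemma BucketRun.ncard_inter_Icc (R : BucketRun ρ ζ y t₀ p) (hP : Precondition ρ ζ y t₀ I p)
    {s e : ℝ} (hs : t₀ ≤ s) {k : ℕ} (hk : R.cur k ≤ e) (hk' : e < R.time k) (i : Fin n) :
    (R.scheme I i ∩ Set.Icc s e).ncard = (R.queries s i k).card := by
  classical
  have : R.scheme I i ∩ Set.Icc s e = ((R.queries s i k).image R.time : Finset ℝ) := by
    ext t
    simp only [scheme, queries, Set.mem_inter_iff, Set.mem_union, Set.mem_ofPred_eq, Set.mem_Icc,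
      Finset.coe_image, Set.mem_image, Finset.mem_coe, Finset.mem_filter, Finset.mem_range]
    constructor
    · rintro ⟨h | ⟨m, hm, rfl⟩, hst, hte⟩
      · exact absurd (hP.before i h) (not_lt.2 (hs.trans hst))
      · exact ⟨m, ⟨R.time_strictMono.lt_iff_lt.1 (hte.trans_lt hk'), hm, hst⟩, rfl⟩
    · rintro ⟨m, ⟨hmk, hm, hst⟩, rfl⟩
      exact ⟨Or.inr ⟨m, hm, rfl⟩, hst, (R.cur_strictMono.monotone (show m + 1 ≤ k from hmk)).trans hk⟩
  rw [this, Set.ncard_coe_finset, Finset.card_image_of_injective _ R.time_strictMono.injective]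

/-- The number of queries of a run over an interval is comparable with the intrinsic demand. -/
theorem BucketRun.queryCount_bounds (R : BucketRun ρ ζ y t₀ p) (hS : Setup ρ ζ y)
    (hP : Precondition ρ ζ y t₀ I p) {s e : ℝ} (hs : t₀ ≤ s) (hse : s ≤ e) :
    intervalDemand ρ ζ y s e ≤ queryCount (R.scheme I) (Set.Icc s e) + n ∧
    lam d y / 132 * (queryCount (R.scheme I) (Set.Icc s e) - n) ≤ intervalDemand ρ ζ y s e := by
  classical
  have hs0 : 0 ≤ s := (hP.pos hS).le.trans hs
  have hex : ∃ k, e < R.time k := by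
    obtain ⟨k, hk⟩ := R.exists_le_time hS hP (e + 1)
    exact ⟨k, by linarith⟩
  obtain ⟨k, hk, hk'⟩ : ∃ k, R.cur k ≤ e ∧ e < R.time k := by
    refine ⟨Nat.find hex, ?_, Nat.find_spec hex⟩
    rcases Nat.eq_zero_or_pos (Nat.find hex) with h | h
    · rw [h]; exact hs.trans hse
    · obtain ⟨m, hm⟩ := Nat.exists_eq_succ_of_ne_zero h.ne'
      have := Nat.find_min hex (m := m) (by omega)
      rw [hm]
      exact not_lt.1 this
  have key : ∀ i, ∫ t in s..e, 1 / xSep ρ (config ζ t) y i ≤ (R.queries s i k).card + 1 ∧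
      lam d y / 132 * ((R.queries s i k).card - 1) ≤
        ∫ t in s..e, 1 / xSep ρ (config ζ t) y i := by
    intro i
    have h1 := R.integral_queries hS hP hs i k
    have hm0 : 0 ≤ max s ((R.state k).last i) := hs0.trans (le_max_left _ _)
    have hme : max s ((R.state k).last i) ≤ e := max_le hse ((R.last_le_cur hP k i).trans hk)
    rw [← hS.integral_add i hs0 hm0 (hs0.trans hse)]
    have h2 := R.integral_le_one hS hP k i (max_le_max_right _ hs) hme hk'.le
    have h3 := hS.integral_nonneg i hm0 hme
    constructor <;> linarith [h1.1, h1.2]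
  have hcount : (queryCount (R.scheme I) (Set.Icc s e) : ℝ) =
      ∑ i, ((R.queries s i k).card : ℝ) := by
    simp only [queryCount, R.ncard_inter_Icc hP hs hk hk']
    push_cast
    rfl
  have h1 := Finset.sum_le_sum fun i (_ : i ∈ Finset.univ) => (key i).1
  have h2 := Finset.sum_le_sum fun i (_ : i ∈ Finset.univ) => (key i).2
  rw [Finset.sum_add_distrib] at h1
  rw [← Finset.mul_sum, Finset.sum_sub_distrib] at h2
  simp only [Finset.sum_const, Finset.card_univ, Fintype.card_fin, nsmul_eq_mul, mul_one] at h1 h2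
  rw [hcount]
  exact ⟨h1, h2⟩

end Count

/-! ### Queries and small clusters -/

/-- Moving points `z i` with scales `σ i`, such that each point belongs to a cluster of more than
`y` points at the same scale. -/
structure ClusteredMotion {E : Type*} [PseudoMetricSpace E] {n : ℕ} (y : ℕ) (κ : ℝ)
    (σ : Fin n → ℝ → ℝ) (z : Fin n → ℝ → E) : Prop where
  one_le : 1 ≤ κ
  pos : ∀ i t, 0 < σ i t
  lip : ∀ i s t, |σ i s - σ i t| ≤ 2 * |s - t|
  speed : ∀ i s t, dist (z i s) (z i t) ≤ |s - t|
  cluster : ∀ i t, ∃ A : Finset (Fin n), y + 1 ≤ A.card ∧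
    ∀ j ∈ A, dist (z j t) (z i t) ≤ 2 * κ * σ i t ∧ σ j t ≤ 2 * κ * σ i t

/-- In a cluster around any point at a time in `[s, e]`, more than `y - x` points are queried
within the time scale of the cluster. -/
def QueriesClusters {E : Type*} [PseudoMetricSpace E] {n : ℕ} (x y : ℕ) (κ : ℝ)
    (σ : Fin n → ℝ → ℝ) (z : Fin n → ℝ → E) (Q : Fin n → Set ℝ) (s e : ℝ) : Prop :=
  ∀ i t, s ≤ t → t + κ * σ i t ≤ e → ∃ F : Finset (Fin n), y + 1 ≤ x + F.card ∧
    ∀ j ∈ F, dist (z j t) (z i t) ≤ 2 * κ * σ i t ∧ σ j t ≤ 2 * κ * σ i t ∧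
      ∃ q ∈ Q j, t ≤ q ∧ q ≤ t + κ * σ i t

section Dichotomy

variable {E : Type*} [PseudoMetricSpace E] {n x y : ℕ} {κ : ℝ} {σ : Fin n → ℝ → ℝ}
  {z : Fin n → ℝ → E}

lemma ClusteredMotion.continuous_scale (h : ClusteredMotion y κ σ z) (i : Fin n) :
    Continuous (σ i) := by
  have : LipschitzWith 2 (σ i) := LipschitzWith.of_dist_le_mul fun s t => by
    rw [Real.dist_eq, Real.dist_eq]; exact h.lip i s t
  exact this.continuous

lemma ClusteredMotion.continuous_pos (h : ClusteredMotion y κ σ z) (i : Fin n) :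
    Continuous (z i) := by
  have : LipschitzWith 1 (z i) := LipschitzWith.of_dist_le_mul fun s t => by
    rw [Real.dist_eq, NNReal.coe_one, one_mul]; exact h.speed i s t
  exact this.continuous

lemma ClusteredMotion.scale_le (h : ClusteredMotion y κ σ z) (i : Fin n) {s t : ℝ} (hst : s ≤ t) :
    σ i t ≤ σ i s + 2 * (t - s) := by
  have h1 := h.lip i t s
  rw [abs_of_nonneg (sub_nonneg.2 hst)] at h1
  linarith [le_abs_self (σ i t - σ i s)]

lemma ClusteredMotion.dist_le (h : ClusteredMotion y κ σ z) (i : Fin n) {s t : ℝ} (hst : s ≤ t) :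
    dist (z i t) (z i s) ≤ t - s := by
  have h1 := h.speed i t s
  rwa [abs_of_nonneg (sub_nonneg.2 hst)] at h1

/-- Some entity of scale at most `a` is, at time `u`, in the ball about `c` that grows linearly
from radius `b` at time `t`, at speed `v`. -/
def SmallNear (σ : Fin n → ℝ → ℝ) (z : Fin n → ℝ → E) (a b v t : ℝ) (c : E) (u : ℝ) : Prop :=
  ∃ k, σ k u ≤ a ∧ dist (z k u) c ≤ b + v * (u - t)

lemma ClusteredMotion.isClosed_smallNear (h : ClusteredMotion y κ σ z) (a b v t : ℝ) (c : E) :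
    IsClosed {u | SmallNear σ z a b v t c u} := by
  simp only [SmallNear, Set.ofPred_exists]
  refine isClosed_iUnion_of_finite fun k => ?_
  exact (isClosed_le (h.continuous_scale k) continuous_const).inter
    (isClosed_le ((h.continuous_pos k).dist continuous_const) (by fun_prop))

/-- Either there are many queries to entities of comparable scale near `(i, t)`, or there are
clusters of much smaller scale near `(i, t)` for a long time. -/
theorem ClusteredMotion.dichotomy (h : ClusteredMotion y κ σ z) {Q : Fin n → Set ℝ} {s e ε : ℝ}
    (hQ : QueriesClusters x y κ σ z Q s e) (hε : 0 < ε) (hε1 : ε ≤ 1) (i : Fin n) {t : ℝ}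
    (hs : s ≤ t) (he : t + 2 * κ * σ i t ≤ e) :
    (∃ F : Finset (Fin n), y + 1 ≤ x + F.card ∧ ∀ j ∈ F, ∃ q ∈ Q j, t ≤ q ∧
      q ≤ t + 2 * κ * σ i t ∧ dist (z j q) (z i t) ≤ 40 * κ ^ 2 * σ i t ∧ ε * σ i t ≤ σ j q ∧
      σ j q ≤ 40 * κ ^ 2 * σ i t) ∨
    ∃ w₀, t ≤ w₀ ∧ w₀ + σ i t ≤ t + 2 * κ * σ i t ∧ ∀ w ∈ Set.Icc w₀ (w₀ + σ i t),
      ∃ A : Finset (Fin n), y + 1 ≤ A.card ∧ ∀ j ∈ A,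
        dist (z j w) (z i t) ≤ 40 * κ ^ 2 * σ i t ∧
        σ j w ≤ 4 * κ * (1 + 2 * κ) * ε * σ i t := by
  have hκ := h.one_le
  have hr := h.pos i t
  set r := σ i t with hrdef
  have hκr : r ≤ κ * r := by nlinarith
  have hκκ : κ * r ≤ κ ^ 2 * r := by nlinarith
  have hεr : ε * r ≤ r := by nlinarith
  have hεr0 : 0 < ε * r := by positivity
  have hκεr : κ * (ε * r) ≤ κ * r := by nlinarith
  have hκκεr : κ ^ 2 * (ε * r) ≤ κ ^ 2 * r := by nlinarith [sq_nonneg κ]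
  -- The speed 1 + 8κ is chosen so that members of the cluster of a point in the ball, examined εr/2
  -- later, are in the enlarged ball: 8κ · εr/2 is the radius of that cluster.
  set S : ℝ → Prop := SmallNear σ z (ε * r) (2 * κ * r) (1 + 8 * κ) t (z i t) with hSdef
  -- A delay εr/2, and then the time κ · 2εr within which a cluster of scale 2εr is queried.
  set g := (1 / 2 + 2 * κ) * (ε * r) with hg
  have hg0 : 0 < g := by positivity
  by_cases h0 : ∃ w₀ ∈ Set.Icc t (t + κ * r), S w₀
  swap
  · -- no small scale nearby: the cluster of `i` itself is queried
    left
    push Not at h0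
    obtain ⟨F, hF, hFq⟩ := hQ i t hs (by linarith)
    refine ⟨F, hF, fun j hj => ?_⟩
    obtain ⟨h1, h2, q, hq, hq1, hq2⟩ := hFq j hj
    have h3 := h.dist_le j hq1
    have h4 := dist_triangle (z j q) (z j t) (z i t)
    have h5 := h.scale_le j hq1
    refine ⟨q, hq, hq1, by linarith, by linarith, ?_, by linarith⟩
    by_contra hlt
    refine h0 q ⟨hq1, hq2⟩ ⟨j, (not_le.1 hlt).le, ?_⟩
    nlinarith
  obtain ⟨w₀, ⟨hw₀, hw₀'⟩, hSw₀⟩ := h0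
  by_cases hpers : ∀ w ∈ Set.Icc w₀ (w₀ + r), ∃ w' ∈ Set.Icc (w - g) w, w₀ ≤ w' ∧ S w'
  · -- the small scale persists
    right
    refine ⟨w₀, hw₀, by linarith, fun w hw => ?_⟩
    obtain ⟨w', ⟨hw1, hw2⟩, hw3, k, hk1, hk2⟩ := hpers w hw
    obtain ⟨A, hA, hAs⟩ := h.cluster k w
    have h1 := h.scale_le k hw2
    -- A time g after a small cluster was seen, its scale is at most εr + 2g.
    have h2 : σ k w ≤ (2 + 4 * κ) * (ε * r) := by rw [hg] at hw1; nlinarith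
    have h3 := h.dist_le k hw2
    have h4 : (1 + 8 * κ) * (w' - t) ≤ (1 + 8 * κ) * ((κ + 1) * r) := by
      refine mul_le_mul_of_nonneg_left ?_ (by linarith)
      linarith [hw.2]
    have h5 : κ * σ k w ≤ κ * ((2 + 4 * κ) * (ε * r)) := by gcongr
    refine ⟨A, hA, fun j hj => ?_⟩
    obtain ⟨hj1, hj2⟩ := hAs j hj
    have h6 := dist_triangle4 (z j w) (z k w) (z k w') (z i t)
    constructor
    · nlinarith
    · nlinarith
  · -- after a last small cluster there is a gap, in which it must be queried
    left
    push Not at hpers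
    obtain ⟨w₁, ⟨hw₁, hw₁'⟩, hgap⟩ := hpers
    have hclosed := h.isClosed_smallNear (ε * r) (2 * κ * r) (1 + 8 * κ) t (z i t)
    -- The last time before `w₁` at which a small point is nearby; it exists because the condition
    -- is closed.
    obtain ⟨u, ⟨⟨hu1, hu2⟩, hSu⟩, hmax⟩ := ((isCompact_Icc (a := w₀) (b := w₁)).inter_right
      hclosed).exists_isGreatest ⟨w₀, ⟨le_rfl, hw₁⟩, hSw₀⟩
    have hug : u < w₁ - g := by
      by_contra hlt
      exact hgap u ⟨not_lt.1 hlt, hu2⟩ hu1 hSu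
    have hnot : ∀ w, u < w → w ≤ w₁ → ¬ S w := fun w hw hw' hSw =>
      absurd (hmax ⟨⟨hu1.trans hw.le, hw'⟩, hSw⟩) (not_le.2 hw)
    obtain ⟨k, hk1, hk2⟩ := hSu
    -- The cluster is examined after `u`, so its queries fall into the gap. The queried points are
    -- near at that moment, and so cannot be of scale εr or less.
    set w := u + ε * r / 2 with hw
    have huw : u ≤ w := by linarith
    have hkw : σ k w ≤ 2 * (ε * r) := by linarith [h.scale_le k huw]
    have hkw' : κ * σ k w ≤ κ * (2 * (ε * r)) := by gcongr
    have hend : w + κ * σ k w ≤ w₁ := by rw [hg] at hug; linarith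
    obtain ⟨F, hF, hFq⟩ := hQ k w (by linarith) (by linarith)
    refine ⟨F, hF, fun j hj => ?_⟩
    obtain ⟨h1, h2, q, hq, hq1, hq2⟩ := hFq j hj
    have h3 := h.dist_le j hq1
    have h4 := h.dist_le k huw
    have h5 := h.scale_le j hq1
    have h6 := dist_triangle4 (z j q) (z j w) (z k w) (z i t)
    have h7 := dist_triangle (z k w) (z k u) (z i t)
    have h8 : dist (z j q) (z i t) ≤ 2 * κ * r + (1 + 8 * κ) * (q - t) := by nlinarith
    have h9 : (1 + 8 * κ) * (q - t) ≤ (1 + 8 * κ) * ((κ + 1) * r) := by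
      refine mul_le_mul_of_nonneg_left ?_ (by linarith)
      linarith
    refine ⟨q, hq, by linarith, by linarith, by linarith, ?_, by linarith⟩
    by_contra hlt
    exact hnot q (by linarith) (by linarith) ⟨j, (not_le.1 hlt).le, h8⟩

end Dichotomy

/-- At all times, at most `N * y` points of scale at least `r` are in a ball of radius `C * r`. -/
def Uncrowded {E : Type*} [PseudoMetricSpace E] {n : ℕ} (y : ℕ) (σ : Fin n → ℝ → ℝ)
    (z : Fin n → ℝ → E) (N : ℕ) (C : ℝ) : Prop :=
  ∀ (t : ℝ) (c : E) (r : ℝ), 0 < r → ∀ F : Finset (Fin n),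
    (∀ i ∈ F, r ≤ σ i t ∧ dist (z i t) c ≤ C * r) → F.card ≤ N * y

/-! ### Charging the demand to queries and to smaller points. -/

section Integral

variable {E : Type*} [PseudoMetricSpace E] {n x y : ℕ} {κ : ℝ} {σ : Fin n → ℝ → ℝ}
  {z : Fin n → ℝ → E}

/-- The times `t` at which point `i` sees, on its scale `κ * σ i t`, only times in `[s, e]`. -/
def innerTimes (κ : ℝ) (σ : Fin n → ℝ → ℝ) (s e : ℝ) (i : Fin n) : Set ℝ :=
  {t | s ≤ t ∧ t + 4 * κ * σ i t ≤ e}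

lemma ClusteredMotion.isClosed_innerTimes (h : ClusteredMotion y κ σ z) (s e : ℝ) (i : Fin n) :
    IsClosed (innerTimes κ σ s e i) := by
  have := h.continuous_scale i
  simp only [innerTimes, Set.ofPred_and]
  exact IsClosed.inter (isClosed_le (by fun_prop) (by fun_prop))
    (isClosed_le (by fun_prop) (by fun_prop))

/-- The demand of point `i` at time `t`, restricted to `innerTimes`. -/
noncomputable def innerDemand (κ : ℝ) (σ : Fin n → ℝ → ℝ) (s e : ℝ) (i : Fin n) : ℝ → ℝ≥0∞ :=
  (innerTimes κ σ s e i).indicator fun t => ENNReal.ofReal (1 / σ i t)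

/-- The pairs `(t, w)` such that `k` at time `w` is a small point near `i` at time `t`. -/
def smallPairs (κ D δ : ℝ) (σ : Fin n → ℝ → ℝ) (z : Fin n → ℝ → E) (i k : Fin n) :
    Set (ℝ × ℝ) :=
  {u | u.1 ≤ u.2 ∧ u.2 ≤ u.1 + 2 * κ * σ i u.1 ∧ dist (z k u.2) (z i u.1) ≤ D * σ i u.1 ∧
    σ k u.2 ≤ δ * σ i u.1}

lemma ClusteredMotion.isClosed_smallPairs (h : ClusteredMotion y κ σ z) (D δ : ℝ) (i k : Fin n) :
    IsClosed (smallPairs κ D δ σ z i k) := by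
  have h1 := h.continuous_scale i
  have h2 := h.continuous_scale k
  have h3 := h.continuous_pos i
  have h4 := h.continuous_pos k
  simp only [smallPairs, Set.ofPred_and]
  repeat' apply IsClosed.inter
  all_goals exact isClosed_le (by fun_prop) (by fun_prop)

/-- The times `t` at which point `i` is near `c`, and has a scale comparable with `r`, at most
`2 * κ` times its scale before `q`. -/
def chargedTimes (κ D ε : ℝ) (σ : Fin n → ℝ → ℝ) (z : Fin n → ℝ → E) (i : Fin n) (c : E)
    (q r : ℝ) : Set ℝ :=
  {t | t ≤ q ∧ q ≤ t + 2 * κ * σ i t ∧ dist c (z i t) ≤ D * σ i t ∧ ε * σ i t ≤ r ∧ r ≤ D * σ i t}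

lemma ClusteredMotion.isClosed_chargedTimes (h : ClusteredMotion y κ σ z) (D ε : ℝ) (i : Fin n)
    (c : E) (q r : ℝ) : IsClosed (chargedTimes κ D ε σ z i c q r) := by
  have h1 := h.continuous_scale i
  have h3 := h.continuous_pos i
  simp only [chargedTimes, Set.ofPred_and]
  repeat' apply IsClosed.inter
  all_goals exact isClosed_le (by fun_prop) (by fun_prop)

lemma ClusteredMotion.measurable_inv (h : ClusteredMotion y κ σ z) (i : Fin n) (a : ℕ) :
    Measurable fun t => ENNReal.ofReal (1 / σ i t ^ a) :=
  (measurable_const.div ((h.continuous_scale i).measurable.pow_const a)).ennreal_ofReal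

lemma ClusteredMotion.measurable_inv_one (h : ClusteredMotion y κ σ z) (i : Fin n) :
    Measurable fun t => ENNReal.ofReal (1 / σ i t) := by
  simpa using h.measurable_inv i 1

/-- A single query receives O(y): at each time at most M y points charge it, M being the crowding
constant written `N` here, each with density at most D/r, within a window of length 2κr/ε. -/
lemma ClusteredMotion.lintegral_chargedTimes_le (h : ClusteredMotion y κ σ z) {D ε : ℝ} {N : ℕ}
    (hD : 0 < D) (hε : 0 < ε) (hN : Uncrowded y σ z N (D ^ 2 / ε)) (c : E) (q : ℝ) {r : ℝ}
    (hr : 0 < r) :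
    ∑ i, ∫⁻ t, (chargedTimes κ D ε σ z i c q r).indicator (fun t => ENNReal.ofReal (1 / σ i t)) t ≤
      ENNReal.ofReal (2 * κ * D * N * y / ε) := by
  classical
  have hκ := h.one_le
  have hmeas : ∀ i : Fin n, Measurable ((chargedTimes κ D ε σ z i c q r).indicator
      fun t => ENNReal.ofReal (1 / σ i t)) := fun i =>
    (h.measurable_inv_one i).indicator (h.isClosed_chargedTimes D ε i c q r).measurableSet
  rw [← lintegral_finsetSum _ fun i _ => hmeas i]
  have hpt : ∀ t, ∑ i, (chargedTimes κ D ε σ z i c q r).indicator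
      (fun t => ENNReal.ofReal (1 / σ i t)) t ≤ (Set.Icc (q - 2 * κ * (r / ε)) q).indicator
        (fun _ => ENNReal.ofReal (N * y * (D / r))) t := by
    intro t
    set F := Finset.univ.filter fun i : Fin n => t ∈ chargedTimes κ D ε σ z i c q r with hF
    have hsum : ∑ i, (chargedTimes κ D ε σ z i c q r).indicator
        (fun t => ENNReal.ofReal (1 / σ i t)) t = ∑ i ∈ F, ENNReal.ofReal (1 / σ i t) := by
      rw [hF, Finset.sum_filter]
      exact Finset.sum_congr rfl fun i _ => Set.indicator_apply _ _ _
    rw [hsum]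
    rcases F.eq_empty_or_nonempty with hFe | ⟨i₀, hi₀⟩
    · rw [hFe, Finset.sum_empty]; exact zero_le
    · have hmem : t ∈ Set.Icc (q - 2 * κ * (r / ε)) q := by
        obtain ⟨h1, h2, -, h4, -⟩ := (Finset.mem_filter.1 hi₀).2
        refine ⟨?_, h1⟩
        have h5 : σ i₀ t ≤ r / ε := by rw [le_div_iff₀ hε]; linarith
        have h6 : 2 * κ * σ i₀ t ≤ 2 * κ * (r / ε) := by gcongr
        linarith
      rw [Set.indicator_of_mem hmem]
      have hcard : F.card ≤ N * y := by
        -- The chargers have scale at least r/D and lie within D · r/ε = (D²/ε) · (r/D).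
        refine hN t c (r / D) (by positivity) F fun i hi => ?_
        obtain ⟨-, -, h3, h4, h5⟩ := (Finset.mem_filter.1 hi).2
        refine ⟨by rw [div_le_iff₀ hD]; linarith, ?_⟩
        have h6 : σ i t ≤ r / ε := by rw [le_div_iff₀ hε]; linarith
        have h7 : D ^ 2 / ε * (r / D) = D * (r / ε) := by field_simp
        rw [h7, dist_comm]
        exact h3.trans (by gcongr)
      calc ∑ i ∈ F, ENNReal.ofReal (1 / σ i t) ≤ ∑ _i ∈ F, ENNReal.ofReal (D / r) := by
            refine Finset.sum_le_sum fun i hi => ENNReal.ofReal_le_ofReal ?_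
            obtain ⟨-, -, -, -, h5⟩ := (Finset.mem_filter.1 hi).2
            rw [div_le_div_iff₀ (h.pos i t) hr]
            linarith
        _ = (F.card : ℝ≥0∞) * ENNReal.ofReal (D / r) := by rw [Finset.sum_const, nsmul_eq_mul]
        _ ≤ ((N * y : ℕ) : ℝ≥0∞) * ENNReal.ofReal (D / r) := by gcongr
        _ = ENNReal.ofReal (N * y * (D / r)) := by
            rw [ENNReal.ofReal_mul (by positivity), ← ENNReal.ofReal_natCast]
            push_cast
            rfl
  refine (lintegral_mono hpt).trans ?_
  rw [lintegral_indicator_const measurableSet_Icc, Real.volume_Icc,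
    ← ENNReal.ofReal_mul (by positivity)]
  refine ENNReal.ofReal_le_ofReal (le_of_eq ?_)
  field_simp
  ring

/-- Dyadic decomposition by scale: at scale 2^l r there are at most N y points, with density (2^l
r)⁻² over a window of length 4κ 2^l r. The contributions decay geometrically. -/
lemma ClusteredMotion.lintegral_large_le (h : ClusteredMotion y κ σ z) {D : ℝ} {N : ℕ}
    (hD : 0 < D) (hN : Uncrowded y σ z N (2 * D)) (c : E) (w : ℝ) {r : ℝ} (hr : 0 < r) 
    (T : Fin n → Set ℝ) (hT : ∀ i, MeasurableSet (T i))
    (hTs : ∀ i, ∀ t ∈ T i, t ≤ w ∧ w ≤ t + 2 * κ * σ i t ∧ dist c (z i t) ≤ D * σ i t ∧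
      r ≤ σ i t) :
    ∑ i, ∫⁻ t, (T i).indicator (fun t => ENNReal.ofReal (1 / σ i t ^ 2)) t ≤
      ENNReal.ofReal (8 * κ * N * y / r) := by
  classical
  have hκ := h.one_le
  have hmeas : ∀ i : Fin n, Measurable ((T i).indicator
      fun t => ENNReal.ofReal (1 / σ i t ^ 2)) := fun i =>
    (h.measurable_inv i 2).indicator (hT i)
  rw [← lintegral_finsetSum _ fun i _ => hmeas i]
  have hpt : ∀ t, ∑ i, (T i).indicator (fun t => ENNReal.ofReal (1 / σ i t ^ 2)) t ≤
      ∑' l : ℕ, (Set.Icc (w - 4 * κ * (2 ^ l * r)) w).indicator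
        (fun _ => ENNReal.ofReal (N * y * (1 / (2 ^ l * r) ^ 2))) t := by
    intro t
    set P : Fin n → ℕ → Prop := fun i l => t ∈ T i ∧ 2 ^ l * r ≤ σ i t ∧ σ i t < 2 ^ (l + 1) * r
    have h1 : ∀ i, (T i).indicator (fun t => ENNReal.ofReal (1 / σ i t ^ 2)) t ≤
        ∑' l : ℕ, if P i l then ENNReal.ofReal (1 / (2 ^ l * r) ^ 2) else 0 := by
      intro i
      by_cases hi : t ∈ T i
      · rw [Set.indicator_of_mem hi]
        have h2 : 1 ≤ σ i t / r := by rw [one_le_div hr]; exact (hTs i t hi).2.2.2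
        obtain ⟨l, hl, hl'⟩ := exists_nat_pow_near h2 one_lt_two
        rw [le_div_iff₀ hr] at hl
        rw [div_lt_iff₀ hr] at hl'
        refine le_trans ?_ (ENNReal.le_tsum l)
        rw [if_pos ⟨hi, hl, hl'⟩]
        refine ENNReal.ofReal_le_ofReal (one_div_le_one_div_of_le (by positivity) ?_)
        gcongr
      · rw [Set.indicator_of_notMem hi]; exact zero_le
    refine (Finset.sum_le_sum fun i _ => h1 i).trans ?_
    rw [← Summable.tsum_finsetSum fun i _ => ENNReal.summable]
    refine ENNReal.tsum_le_tsum fun l => ?_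
    rw [← Finset.sum_filter]
    set F := Finset.univ.filter fun i : Fin n => P i l with hF
    rcases F.eq_empty_or_nonempty with hFe | ⟨i₀, hi₀⟩
    · rw [hFe, Finset.sum_empty]; exact zero_le
    · have hmem : t ∈ Set.Icc (w - 4 * κ * (2 ^ l * r)) w := by
        obtain ⟨h1, -, h3⟩ := (Finset.mem_filter.1 hi₀).2
        obtain ⟨h4, h5, -, -⟩ := hTs i₀ t h1
        refine ⟨?_, h4⟩
        have h6 : 2 * κ * σ i₀ t ≤ 2 * κ * (2 ^ (l + 1) * r) := by gcongr
        rw [pow_succ] at h6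
        linarith
      rw [Set.indicator_of_mem hmem]
      have hcard : F.card ≤ N * y := by
        refine hN t c (2 ^ l * r) (by positivity) F fun i hi => ?_
        obtain ⟨h1, h2, h3⟩ := (Finset.mem_filter.1 hi).2
        obtain ⟨-, -, h6, -⟩ := hTs i t h1
        refine ⟨h2, ?_⟩
        rw [dist_comm]
        refine h6.trans ?_
        rw [pow_succ] at h3
        nlinarith
      calc ∑ i ∈ F, ENNReal.ofReal (1 / (2 ^ l * r) ^ 2)
          = (F.card : ℝ≥0∞) * ENNReal.ofReal (1 / (2 ^ l * r) ^ 2) := by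
            rw [Finset.sum_const, nsmul_eq_mul]
        _ ≤ ((N * y : ℕ) : ℝ≥0∞) * ENNReal.ofReal (1 / (2 ^ l * r) ^ 2) := by gcongr
        _ = ENNReal.ofReal (N * y * (1 / (2 ^ l * r) ^ 2)) := by
            rw [ENNReal.ofReal_mul (by positivity), ← ENNReal.ofReal_natCast]
            push_cast
            rfl
  refine (lintegral_mono hpt).trans ?_
  rw [lintegral_tsum fun l => (measurable_const.indicator measurableSet_Icc).aemeasurable]
  have hterm : ∀ l : ℕ, ∫⁻ t, (Set.Icc (w - 4 * κ * (2 ^ l * r)) w).indicator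
      (fun _ => ENNReal.ofReal (N * y * (1 / (2 ^ l * r) ^ 2))) t =
      ENNReal.ofReal (4 * κ * N * y / r * (1 / 2) ^ l) := by
    intro l
    rw [lintegral_indicator_const measurableSet_Icc, Real.volume_Icc,
      ← ENNReal.ofReal_mul (by positivity)]
    congr 1
    rw [one_div_pow]
    field_simp
    ring
  simp only [hterm]
  rw [← ENNReal.ofReal_tsum_of_nonneg (fun l => by positivity)
    (summable_geometric_two.mul_left _), tsum_mul_left, tsum_geometric_two]
  refine ENNReal.ofReal_le_ofReal (le_of_eq ?_)
  ring

/-- The integrand that expresses the demand of `i` through the small points near it. -/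
noncomputable def smallDemand (κ D δ : ℝ) (σ : Fin n → ℝ → ℝ) (z : Fin n → ℝ → E) (s e : ℝ)
    (i k : Fin n) : ℝ × ℝ → ℝ≥0∞ :=
  (smallPairs κ D δ σ z i k ∩ Prod.snd ⁻¹' innerTimes κ σ s e k).indicator
    fun u => ENNReal.ofReal (1 / σ i u.1 ^ 2)

lemma ClusteredMotion.measurable_smallDemand (h : ClusteredMotion y κ σ z) (D δ s e : ℝ)
    (i k : Fin n) : Measurable (smallDemand κ D δ σ z s e i k) :=
  ((h.measurable_inv i 2).comp measurable_fst).indicator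
    ((h.isClosed_smallPairs D δ i k).measurableSet.inter
      (measurable_snd (h.isClosed_innerTimes s e k).measurableSet))

/-- After exchanging the integrals, the small point `k` at time `w` is fixed. It is seen only by
points of scale at least σ_k/δ, and these contribute O(yδ)/σ_k, a small multiple of y times its own
demand. -/
lemma ClusteredMotion.sum_lintegral_smallDemand_le (h : ClusteredMotion y κ σ z) {D δ : ℝ} {N : ℕ}
    (hD : 0 < D) (hδ : 0 < δ) (hN : Uncrowded y σ z N (2 * D)) (s e : ℝ) :
    ∑ i, ∑ k, ∫⁻ t, ∫⁻ w, smallDemand κ D δ σ z s e i k (t, w) ≤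
      ENNReal.ofReal (8 * κ * N * y * δ) * ∑ k, ∫⁻ w, innerDemand κ σ s e k w := by
  have hκ := h.one_le
  have hm := h.measurable_smallDemand D δ s e
  have hswap : ∀ i k, ∫⁻ t, ∫⁻ w, smallDemand κ D δ σ z s e i k (t, w) =
      ∫⁻ w, ∫⁻ t, smallDemand κ D δ σ z s e i k (t, w) := fun i k =>
    lintegral_lintegral_swap (hm i k).aemeasurable
  simp only [hswap]
  rw [Finset.sum_comm, Finset.mul_sum]
  refine Finset.sum_le_sum fun k _ => ?_
  rw [← lintegral_finsetSum _ fun i _ => (hm i k).lintegral_prod_left',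
    ← lintegral_const_mul' _ _ ENNReal.ofReal_ne_top]
  refine lintegral_mono fun w => ?_
  by_cases hw : w ∈ innerTimes κ σ s e k
  · rw [innerDemand, Set.indicator_of_mem hw, ← ENNReal.ofReal_mul (by positivity)]
    have hσ := h.pos k w
    have h1 := h.lintegral_large_le hD hN (z k w) w (r := σ k w / δ) (by positivity)
      (fun i => {t | (t, w) ∈ smallPairs κ D δ σ z i k})
      (fun i => measurable_prodMk_right (h.isClosed_smallPairs D δ i k).measurableSet)
      (fun i t ht => ⟨ht.1, ht.2.1, ht.2.2.1, by
        rw [div_le_iff₀ hδ, mul_comm]; exact ht.2.2.2⟩)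
    refine le_trans (le_of_eq ?_) (h1.trans (ENNReal.ofReal_le_ofReal (le_of_eq ?_)))
    · refine Finset.sum_congr rfl fun i _ => lintegral_congr fun t => ?_
      by_cases hu : (t, w) ∈ smallPairs κ D δ σ z i k
      · rw [smallDemand, Set.indicator_of_mem (show (t, w) ∈ smallPairs κ D δ σ z i k ∩
          Prod.snd ⁻¹' innerTimes κ σ s e k from ⟨hu, hw⟩), Set.indicator_of_mem
          (show t ∈ {t | (t, w) ∈ smallPairs κ D δ σ z i k} from hu)]
      · rw [smallDemand, Set.indicator_of_notMem fun h => hu h.1, Set.indicator_of_notMem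
          (show t ∉ {t | (t, w) ∈ smallPairs κ D δ σ z i k} from hu)]
    · field_simp
  · refine le_trans (le_of_eq (Finset.sum_eq_zero fun i _ => ?_)) zero_le
    rw [← lintegral_zero (μ := volume) (α := ℝ)]
    refine lintegral_congr fun t => ?_
    rw [smallDemand, Set.indicator_of_notMem]
    exact fun h => hw h.2

/-- The demand of each point is covered by queries to points of comparable scale nearby and by
the demand of much smaller points nearby. -/
lemma ClusteredMotion.innerDemand_le (h : ClusteredMotion y κ σ z) {Q : Fin n → Set ℝ}
    {s e ε : ℝ} (hQ : QueriesClusters x y κ σ z Q s e) (hε : 0 < ε) (hε1 : ε ≤ 1)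
    (hδ : 4 * κ * (1 + 2 * κ) * ε ≤ 1 / 2) (hxy : x ≤ y)
    (Qf : Fin n → Finset ℝ) (hQf : ∀ j, ∀ q ∈ Q j, s ≤ q → q ≤ e → q ∈ Qf j) (i : Fin n) (t : ℝ) :
    innerDemand κ σ s e i t ≤
      ((y + 1 - x : ℕ) : ℝ≥0∞)⁻¹ * ∑ j, ∑ q ∈ Qf j,
        (chargedTimes κ (40 * κ ^ 2) ε σ z i (z j q) q (σ j q)).indicator
          (fun t => ENNReal.ofReal (1 / σ i t)) t +
      ((y + 1 : ℕ) : ℝ≥0∞)⁻¹ * ∑ k, ∫⁻ w,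
        smallDemand κ (40 * κ ^ 2) (4 * κ * (1 + 2 * κ) * ε) σ z s e i k (t, w) := by
  classical
  by_cases ht : t ∈ innerTimes κ σ s e i
  swap
  · rw [innerDemand, Set.indicator_of_notMem ht]; exact zero_le
  have hκ := h.one_le
  have hr := h.pos i t
  have hκr : 0 < κ * σ i t := by positivity
  rw [innerDemand, Set.indicator_of_mem ht]
  rcases h.dichotomy hQ hε hε1 i ht.1 (by linarith [ht.2]) with ⟨F, hF, hFq⟩ | ⟨w₀, hw₀, hw₁, hA⟩
  · refine le_trans ?_ le_self_add
    have hm : y + 1 - x ≤ F.card := by omega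
    have hm0 : ((y + 1 - x : ℕ) : ℝ≥0∞) ≠ 0 := by
      rw [Nat.cast_ne_zero]; omega
    calc ENNReal.ofReal (1 / σ i t) = ((y + 1 - x : ℕ) : ℝ≥0∞)⁻¹ *
          (((y + 1 - x : ℕ) : ℝ≥0∞) * ENNReal.ofReal (1 / σ i t)) := by
            rw [← mul_assoc, ENNReal.inv_mul_cancel hm0 (ENNReal.natCast_ne_top _), one_mul]
      _ ≤ ((y + 1 - x : ℕ) : ℝ≥0∞)⁻¹ * (∑ _j ∈ F, ENNReal.ofReal (1 / σ i t)) := by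
            rw [Finset.sum_const, nsmul_eq_mul]
            gcongr
      _ ≤ _ := by
            gcongr
            refine le_trans (Finset.sum_le_sum fun j hj => ?_)
              (Finset.sum_le_sum_of_subset (Finset.subset_univ F))
            obtain ⟨q, hq, h1, h2, h3, h4, h5⟩ := hFq j hj
            have hmem : t ∈ chargedTimes κ (40 * κ ^ 2) ε σ z i (z j q) q (σ j q) :=
              ⟨h1, h2, h3, h4, h5⟩
            rw [← Set.indicator_of_mem hmem fun t => ENNReal.ofReal (1 / σ i t)]
            have hqe : q ≤ e := by linarith [ht.2]
            exact Finset.single_le_sum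
              (f := fun q => (chargedTimes κ (40 * κ ^ 2) ε σ z i (z j q) q (σ j q)).indicator
                (fun t => ENNReal.ofReal (1 / σ i t)) t) (fun _ _ => zero_le)
                (hQf j q hq (ht.1.trans h1) hqe)
  · refine le_trans ?_ le_add_self
    set δ := 4 * κ * (1 + 2 * κ) * ε with hδdef
    have hm0 : ((y + 1 : ℕ) : ℝ≥0∞) ≠ 0 := by
      rw [Nat.cast_ne_zero]; omega
    have hms : ∀ k, Measurable fun w => smallDemand κ (40 * κ ^ 2) δ σ z s e i k (t, w) :=
      fun k => (h.measurable_smallDemand (40 * κ ^ 2) δ s e i k).comp measurable_prodMk_left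
    rw [← lintegral_finsetSum _ fun k _ => hms k]
    calc ENNReal.ofReal (1 / σ i t) = ((y + 1 : ℕ) : ℝ≥0∞)⁻¹ *
          (((y + 1 : ℕ) : ℝ≥0∞) * ENNReal.ofReal (1 / σ i t)) := by
            rw [← mul_assoc, ENNReal.inv_mul_cancel hm0 (ENNReal.natCast_ne_top _), one_mul]
      -- The demand 1/σ is the integral of 1/σ² over a window of length σ.
      _ = ((y + 1 : ℕ) : ℝ≥0∞)⁻¹ * ∫⁻ w, (Set.Icc w₀ (w₀ + σ i t)).indicator
            (fun _ => ((y + 1 : ℕ) : ℝ≥0∞) * ENNReal.ofReal (1 / σ i t ^ 2)) w := by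
            rw [lintegral_indicator_const measurableSet_Icc, Real.volume_Icc, mul_assoc,
              ← ENNReal.ofReal_mul (by positivity)]
            congr 3
            field_simp
            ring
      _ ≤ _ := by
            refine mul_le_mul_right (lintegral_mono fun w => ?_) _
            by_cases hw : w ∈ Set.Icc w₀ (w₀ + σ i t)
            swap
            · rw [Set.indicator_of_notMem hw]; exact zero_le
            rw [Set.indicator_of_mem hw]
            obtain ⟨A, hAc, hAs⟩ := hA w hw
            refine le_trans ?_ (Finset.sum_le_sum_of_subset (Finset.subset_univ A))
            calc ((y + 1 : ℕ) : ℝ≥0∞) * ENNReal.ofReal (1 / σ i t ^ 2)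
                ≤ ∑ _k ∈ A, ENNReal.ofReal (1 / σ i t ^ 2) := by
                  rw [Finset.sum_const, nsmul_eq_mul]
                  gcongr
              _ ≤ _ := Finset.sum_le_sum fun k hk => ?_
            obtain ⟨h1, h2⟩ := hAs k hk
            have h3 : δ * σ i t ≤ 1 / 2 * σ i t := by gcongr
            -- This keeps `w` an inner time of `k`: w ≤ t + 2κσ_i and 4κσ_k ≤ 2κσ_i add up to the
            -- margin 4κσ_i of `i`.
            have h4 : κ * σ k w ≤ κ * (1 / 2 * σ i t) := by gcongr; linarith
            have hmem : (t, w) ∈ smallPairs κ (40 * κ ^ 2) δ σ z i k ∩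
                Prod.snd ⁻¹' innerTimes κ σ s e k :=
              ⟨⟨hw₀.trans hw.1, hw.2.trans hw₁, h1, h2⟩,
                ht.1.trans (hw₀.trans hw.1), by
                  have := hw.2
                  have := ht.2
                  simp only at *
                  linarith⟩
            rw [smallDemand, Set.indicator_of_mem hmem]

/-- By `hNε` the charges to smaller points are at most half the total, which yields X ≤ B + X/2. -/
theorem ClusteredMotion.sum_innerDemand_le (h : ClusteredMotion y κ σ z) {Q : Fin n → Set ℝ}
    {s e ε : ℝ} (hQ : QueriesClusters x y κ σ z Q s e) (hε : 0 < ε) (hε1 : ε ≤ 1)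
    (hδ : 4 * κ * (1 + 2 * κ) * ε ≤ 1 / 2) (hxy : x ≤ y) {N M : ℕ}
    (hN : Uncrowded y σ z N (2 * (40 * κ ^ 2)))
    (hNε : 16 * κ * N * (4 * κ * (1 + 2 * κ) * ε) ≤ 1)
    (hM : Uncrowded y σ z M ((40 * κ ^ 2) ^ 2 / ε))
    (Qf : Fin n → Finset ℝ) (hQf : ∀ j, ∀ q ∈ Q j, s ≤ q → q ≤ e → q ∈ Qf j)
    {m : ℝ} (hm : 0 < m) (hmσ : ∀ i t, m ≤ σ i t) :
    ∑ i, ∫⁻ t, innerDemand κ σ s e i t ≤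
      2 * (((y + 1 - x : ℕ) : ℝ≥0∞)⁻¹ * (((∑ j, (Qf j).card : ℕ) : ℝ≥0∞) *
        ENNReal.ofReal (2 * κ * (40 * κ ^ 2) * M * y / ε))) := by
  have hκ := h.one_le
  set D := 40 * κ ^ 2 with hDdef
  have hD : 0 < D := by positivity
  set δ := 4 * κ * (1 + 2 * κ) * ε with hδdef
  have hδ0 : 0 < δ := by positivity
  set X := ∑ i, ∫⁻ t, innerDemand κ σ s e i t with hX
  set B := ((y + 1 - x : ℕ) : ℝ≥0∞)⁻¹ * (((∑ j, (Qf j).card : ℕ) : ℝ≥0∞) *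
        ENNReal.ofReal (2 * κ * D * M * y / ε)) with hB
  -- Cancelling X/2 requires X to be finite; the lower bound `m` on the scales serves only this
  -- purpose.
  have hfin : X ≠ ∞ := by
    refine (ENNReal.sum_lt_top.2 fun i _ => ?_).ne
    have : ∀ t, innerDemand κ σ s e i t ≤
        (Set.Icc s e).indicator (fun _ => ENNReal.ofReal (1 / m)) t := by
      intro t
      refine Set.indicator_le_indicator_of_subset ?_ (fun _ => zero_le) t |>.trans
        (Set.indicator_le_indicator
          (ENNReal.ofReal_le_ofReal (one_div_le_one_div_of_le hm (hmσ i t))))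
      intro u hu
      have := h.pos i u
      have h2 := hu.2
      exact ⟨hu.1, by nlinarith⟩
    refine (lintegral_mono this).trans_lt ?_
    rw [lintegral_indicator_const measurableSet_Icc, Real.volume_Icc]
    exact ENNReal.mul_lt_top ENNReal.ofReal_lt_top ENNReal.ofReal_lt_top
  have hmeas1 : ∀ (i j : Fin n) (q : ℝ), Measurable
      ((chargedTimes κ D ε σ z i (z j q) q (σ j q)).indicator
        fun t => ENNReal.ofReal (1 / σ i t)) := fun i j q =>
    (h.measurable_inv_one i).indicator (h.isClosed_chargedTimes D ε i _ q _).measurableSet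
  have hmeas2 : ∀ i k : Fin n, Measurable fun t => ∫⁻ w, smallDemand κ D δ σ z s e i k (t, w) :=
    fun i k => (h.measurable_smallDemand D δ s e i k).lintegral_prod_right'
  have hi : ∀ i, ∫⁻ t, innerDemand κ σ s e i t ≤
      ((y + 1 - x : ℕ) : ℝ≥0∞)⁻¹ * (∑ j, ∑ q ∈ Qf j, ∫⁻ t,
        (chargedTimes κ D ε σ z i (z j q) q (σ j q)).indicator
          (fun t => ENNReal.ofReal (1 / σ i t)) t) +
      ((y + 1 : ℕ) : ℝ≥0∞)⁻¹ * ∑ k, ∫⁻ t, ∫⁻ w, smallDemand κ D δ σ z s e i k (t, w) := by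
    intro i
    refine (lintegral_mono (h.innerDemand_le hQ hε hε1 hδ hxy Qf hQf i)).trans (le_of_eq ?_)
    have hsm : Measurable fun t => ∑ j, ∑ q ∈ Qf j,
        (chargedTimes κ D ε σ z i (z j q) q (σ j q)).indicator
          (fun t => ENNReal.ofReal (1 / σ i t)) t :=
      Finset.measurable_fun_sum _ fun j _ => Finset.measurable_fun_sum _ fun q _ => hmeas1 i j q
    rw [lintegral_add_left (hsm.const_mul _), lintegral_const_mul _ hsm,
      lintegral_const_mul _ (Finset.measurable_fun_sum _ fun k _ => hmeas2 i k),
      lintegral_finsetSum _ fun k _ => hmeas2 i k,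
      lintegral_finsetSum _ fun j _ => Finset.measurable_fun_sum _ fun q _ => hmeas1 i j q]
    congr 2
    exact Finset.sum_congr rfl fun j _ => lintegral_finsetSum _ fun q _ => hmeas1 i j q
  have hsum : X ≤ B + 2⁻¹ * X := by
    refine (Finset.sum_le_sum fun i _ => hi i).trans ?_
    rw [Finset.sum_add_distrib, ← Finset.mul_sum, ← Finset.mul_sum]
    refine add_le_add ?_ ?_
    · rw [hB]
      gcongr
      rw [Finset.sum_comm]
      push_cast
      rw [Finset.sum_mul]
      refine Finset.sum_le_sum fun j _ => ?_
      rw [Finset.sum_comm, ← nsmul_eq_mul]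
      refine Finset.sum_le_card_nsmul _ _ _ fun q _ => ?_
      exact h.lintegral_chargedTimes_le hD hε hM (z j q) q (h.pos j q)
    · calc ((y + 1 : ℕ) : ℝ≥0∞)⁻¹ * ∑ i, ∑ k, ∫⁻ t, ∫⁻ w, smallDemand κ D δ σ z s e i k (t, w)
          ≤ ((y + 1 : ℕ) : ℝ≥0∞)⁻¹ * (ENNReal.ofReal (8 * κ * N * y * δ) * X) := by
            gcongr
            exact h.sum_lintegral_smallDemand_le hD hδ0 hN s e
        _ ≤ 2⁻¹ * X := by
            rw [← mul_assoc]
            gcongr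
            rw [← ENNReal.ofReal_natCast, ← ENNReal.ofReal_inv_of_pos (by positivity),
              ← ENNReal.ofReal_mul (by positivity), ← ENNReal.ofReal_ofNat,
              ← ENNReal.ofReal_inv_of_pos (by positivity)]
            refine ENNReal.ofReal_le_ofReal ?_
            push_cast
            rw [inv_mul_le_iff₀ (by positivity)]
            nlinarith [(Nat.cast_nonneg y : (0 : ℝ) ≤ y)]
  have h3 : X = 2⁻¹ * X + 2⁻¹ * X := by
    rw [← two_mul, ← mul_assoc, ENNReal.mul_inv_cancel two_ne_zero ENNReal.ofNat_ne_top, one_mul]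
  have h4 : 2⁻¹ * X ≠ ∞ := ENNReal.mul_ne_top (by simp) hfin
  have h5 : 2⁻¹ * X ≤ B := by
    refine (ENNReal.add_le_add_iff_right h4).1 ?_
    rwa [← h3]
  calc X = 2 * (2⁻¹ * X) := by
        rw [← mul_assoc, ENNReal.mul_inv_cancel two_ne_zero ENNReal.ofNat_ne_top, one_mul]
    _ ≤ 2 * B := by gcongr

end Integral

/-! ### The demand of moving entities against clairvoyant query schemes -/

section Clairvoyant

variable {d n : ℕ} {ρ : ℝ} {ζ : Fin n → ℝ → Space d} {x y : ℕ} {κ : ℝ}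

lemma Setup.one_le_of_mul_lam (hS : Setup ρ ζ y) (hκ : 1 ≤ κ * lam d y) : 1 ≤ κ := by
  have h0 := hS.lam_pos
  have h1 := hS.lam_lt
  by_contra! h
  nlinarith

lemma Setup.rho_add_le (hS : Setup ρ ζ y) (hκ : 1 ≤ κ * lam d y) {t : ℝ} (ht : 0 ≤ t) (i : Fin n) :
    ρ + xSep ρ (config ζ t) y i ≤ κ * xSep ρ (config ζ t) y i := by
  have h1 := hS.key t ht i
  have h2 := hS.xSep_pos ht i
  have h3 := hS.rho_pos
  have h4 := hS.one_le_of_mul_lam hκ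
  nlinarith [mul_le_mul_of_nonneg_left h1 (zero_le_one.trans h4),
    mul_le_mul_of_nonneg_right hκ (add_pos h3 h2).le]

/-- Every entity belongs to a cluster of `y + 1` entities of comparable separation. -/
lemma Setup.exists_cluster (hS : Setup ρ ζ y) (hκ : 1 ≤ κ * lam d y) {t : ℝ} (ht : 0 ≤ t)
    (i : Fin n) :
    ∃ A : Finset (Fin n), A.card = y + 1 ∧ ∀ j ∈ A,
      dist (ζ j t) (ζ i t) ≤ ρ + κ * xSep ρ (config ζ t) y i ∧
      xSep ρ (config ζ t) y j ≤ 2 * κ * xSep ρ (config ζ t) y i := by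
  obtain ⟨A, hA, hiA, hAs⟩ := BucketModel.exists_cluster ρ (config ζ t) hS.one_le hS.lt i
  have h1 := hS.rho_add_le hκ ht i
  have h2 := hS.xSep_pos ht i
  have h3 := hS.rho_pos
  have hstar : ∀ a ∈ A, a ≠ i → dist (ζ i t) (ζ a t) ≤ 2 * ρ + xSep ρ (config ζ t) y i := by
    intro a ha hai
    have := hAs a ha hai
    simp only [sep, config] at this ⊢
    linarith
  refine ⟨A, hA, fun j hj => ⟨?_, ?_⟩⟩
  · by_cases hji : j = i
    · rw [hji, dist_self]; linarith
    · rw [dist_comm]; linarith [hstar j hj hji]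
  · have := hS.xSep_neighbour hA.ge (DiamLE.of_star hS.rho_pos.le h2.le hstar) hj
    linarith

/-- The motion is extended to negative times by standing still. -/
lemma Setup.clusteredMotion (hS : Setup ρ ζ y) (hκ : 1 ≤ κ * lam d y) :
    ClusteredMotion y κ (fun i t => xSep ρ (config ζ (max t 0)) y i)
      (fun i t => ζ i (max t 0)) where
  one_le := hS.one_le_of_mul_lam hκ
  pos i t := hS.xSep_pos (le_max_right _ _) i
  lip i s t := by
    have h0 := abs_max_sub_max_le_abs s t 0
    have h1 := hS.xSep_lipschitz (le_max_right s 0) (le_max_right t 0) i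
    have h2 := hS.xSep_lipschitz (le_max_right t 0) (le_max_right s 0) i
    rw [abs_sub_comm (max t 0)] at h2
    rw [abs_sub_le_iff]
    constructor <;> linarith
  speed i s t := (hS.motion.speed i _ (le_max_right s 0) _ (le_max_right t 0)).trans
    (abs_max_sub_max_le_abs s t 0)
  cluster i t := by
    obtain ⟨A, hA, hAs⟩ := hS.exists_cluster hκ (le_max_right t 0) i
    refine ⟨A, hA.ge, fun j hj => ⟨(hAs j hj).1.trans ?_, (hAs j hj).2⟩⟩
    have h1 := hS.rho_add_le hκ (le_max_right t 0) i
    have h2 := hS.xSep_pos (le_max_right t 0) i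
    linarith

/-- A scheme of low ply queries, in each cluster, all but few of the entities. -/
lemma Setup.queriesClusters (hS : Setup ρ ζ y) (hκ : 1 ≤ κ * lam d y) {Q : Scheme n}
    (hQ : IsScheme Q) {s e : ℝ} (hs : 0 ≤ s) (hply : ∀ t ∈ Set.Icc s e, ply ρ ζ Q t ≤ x) :
    QueriesClusters x y κ (fun i t => xSep ρ (config ζ (max t 0)) y i)
      (fun i t => ζ i (max t 0)) Q s e := by
  classical
  intro i t hst hte
  have ht : 0 ≤ t := hs.trans hst
  simp only [max_eq_left ht] at hte ⊢
  obtain ⟨A, hA, hAs⟩ := hS.exists_cluster hκ ht i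
  have h1 := hS.rho_add_le hκ ht i
  have h2 := hS.xSep_pos ht i
  have h3 := hS.rho_pos
  set R := κ * xSep ρ (config ζ t) y i with hR
  let F := A.filter fun j => ∃ q ∈ Q j, t ≤ q ∧ q ≤ t + R
  refine ⟨F, ?_, fun j hj => ?_⟩
  · have hcard := Finset.card_filter_add_card_filter_not (s := A)
      fun j => ∃ q ∈ Q j, t ≤ q ∧ q ≤ t + R
    -- A member last queried at q < t has, at time t + R, a region of radius ρ + (t - q) + R, while
    -- its centre is within (t - q) + ρ + R of `ζ i t`. The region of a member never queried is the
    -- whole space.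
    have hle : (A.filter fun j => ¬ ∃ q ∈ Q j, t ≤ q ∧ q ≤ t + R).card ≤ x := by
      refine le_trans (le_ncard_of_finset le_rfl fun j hj => ?_)
        ((ncard_region_le_ply ρ ζ Q (t + R) (ζ i t)).trans (hply _ ⟨by linarith, hte⟩))
      obtain ⟨hjA, hjq⟩ := Finset.mem_filter.1 hj
      intro q hq
      have hqt : q < t := by
        by_contra! h
        exact hjq ⟨q, hq.1.1, h, hq.1.2.le⟩
      have h4 := hS.motion.speed j t ht q ((hQ j).1 hq.1.1)
      rw [abs_of_nonneg (by linarith)] at h4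
      have h5 := (hAs j hjA).1
      rw [dist_comm] at h5
      linarith [dist_triangle (ζ i t) (ζ j t) (ζ j q)]
    change y + 1 ≤ x + (A.filter _).card
    omega
  · obtain ⟨hjA, hjq⟩ := Finset.mem_filter.1 hj
    exact ⟨(hAs j hjA).1.trans (by linarith), (hAs j hjA).2, hjq⟩

/-- The ball is covered by N balls of radius r/4. More than `y` entities in one of these would be
within r/2 of each other, and so have separation less than r. -/
lemma exists_uncrowded (d : ℕ) (C : ℝ) :
    ∃ N : ℕ, ∀ {n : ℕ} {ρ : ℝ} {ζ : Fin n → ℝ → Space d} {y : ℕ}, Setup ρ ζ y →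
      Uncrowded y (fun i t => xSep ρ (config ζ (max t 0)) y i) (fun i t => ζ i (max t 0)) N C := by
  classical
  obtain ⟨N, hN⟩ := exists_cover d (4 * C)
  refine ⟨N, fun {n ρ ζ y} hS t c r hr F hF => ?_⟩
  obtain ⟨G, hG, hcov⟩ := hN c (r / 4) (by positivity)
  have hu : ∀ i ∈ F, ∃ u ∈ G, dist (ζ i (max t 0)) u < r / 4 := fun i hi =>
    hcov _ ((hF i hi).2.trans (by linarith))
  choose! f hfG hf using hu
  have hcard := Finset.card_le_mul_card_image_of_maps_to (s := F) (t := G) (f := f) hfG y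
    fun u _ => by
      by_contra! hlt
      obtain ⟨i, hi⟩ := Finset.card_pos.1 ((Nat.zero_le y).trans_lt hlt)
      have h1 := hS.xSep_neighbour (t := max t 0) (D := r / 2 - 2 * ρ) hlt (fun k hk l hl => by
        obtain ⟨hk1, hk2⟩ := Finset.mem_filter.1 hk
        obtain ⟨hl1, hl2⟩ := Finset.mem_filter.1 hl
        have h2 := hf k hk1
        have h3 := hf l hl1
        rw [hk2] at h2
        rw [hl2] at h3
        linarith [dist_triangle_right (ζ k (max t 0)) (ζ l (max t 0)) u]) hi
      have h4 := (hF i (Finset.mem_filter.1 hi).1).1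
      have := hS.rho_pos
      simp only at h4
      linarith
  calc F.card ≤ y * G.card := hcard
    _ ≤ N * y := by rw [mul_comm]; gcongr

/-- Up to a boundary term, the demand over an interval is concentrated on the inner times of a
longer interval. -/
lemma Setup.ofReal_integral_le (hS : Setup ρ ζ y) (hκ : 0 ≤ κ) (i : Fin n) {s L w : ℝ}
    (hs : 0 ≤ s) (hL : 0 ≤ L) (hw : 0 < w) :
    ENNReal.ofReal (∫ t in s..s + L, 1 / xSep ρ (config ζ t) y i) ≤
      (∫⁻ t, innerDemand κ (fun i t => xSep ρ (config ζ (max t 0)) y i) s (s + L + w) i t) +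
        ENNReal.ofReal (4 * κ * (L / w)) := by
  have hint := hS.intervalIntegrable i hs (b := s + L) (by linarith)
  rw [intervalIntegrable_iff_integrableOn_Ioc_of_le (by linarith)] at hint
  rw [intervalIntegral.integral_of_le (by linarith),
    ofReal_integral_eq_lintegral_ofReal hint]
  swap
  · refine (ae_restrict_mem measurableSet_Ioc).mono fun t ht => ?_
    exact (one_div_pos.2 (hS.xSep_pos (hs.trans ht.1.le) i)).le
  have hpt : ∀ t ∈ Set.Ioc s (s + L), ENNReal.ofReal (1 / xSep ρ (config ζ t) y i) ≤
      innerDemand κ (fun i t => xSep ρ (config ζ (max t 0)) y i) s (s + L + w) i t +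
        ENNReal.ofReal (4 * κ / w) := by
    intro t ht
    have ht0 : 0 ≤ t := hs.trans ht.1.le
    have hσ := hS.xSep_pos ht0 i
    by_cases hmem : t ∈ innerTimes κ (fun i t => xSep ρ (config ζ (max t 0)) y i) s (s + L + w) i
    · rw [innerDemand, Set.indicator_of_mem hmem, max_eq_left ht0]
      exact le_self_add
    · refine le_trans (ENNReal.ofReal_le_ofReal ?_) le_add_self
      have h1 : s + L + w < t + 4 * κ * xSep ρ (config ζ t) y i := by
        by_contra! h
        exact hmem ⟨ht.1.le, by simpa only [max_eq_left ht0] using h⟩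
      rw [div_le_div_iff₀ hσ hw]
      linarith [ht.2]
  calc ∫⁻ t in Set.Ioc s (s + L), ENNReal.ofReal (1 / xSep ρ (config ζ t) y i)
      ≤ ∫⁻ t in Set.Ioc s (s + L),
          (innerDemand κ (fun i t => xSep ρ (config ζ (max t 0)) y i) s (s + L + w) i t +
            ENNReal.ofReal (4 * κ / w)) := setLIntegral_mono' measurableSet_Ioc hpt
    _ = (∫⁻ t in Set.Ioc s (s + L),
          innerDemand κ (fun i t => xSep ρ (config ζ (max t 0)) y i) s (s + L + w) i t) +
            ENNReal.ofReal (4 * κ * (L / w)) := by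
        rw [lintegral_add_right _ measurable_const, setLIntegral_const, Real.volume_Ioc,
          ← ENNReal.ofReal_mul (by positivity)]
        congr 2
        ring
    _ ≤ _ := add_le_add (setLIntegral_le_lintegral _ _) le_rfl

lemma queryCount_eq_sum_card {Q : Scheme n} (hQ : IsScheme Q) (s e : ℝ) :
    ∃ Qf : Fin n → Finset ℝ, (∀ j, ∀ q ∈ Q j, s ≤ q → q ≤ e → q ∈ Qf j) ∧
      ∑ j, (Qf j).card = queryCount Q (Set.Icc s e) := by
  have hfin : ∀ j, (Q j ∩ Set.Icc s e).Finite := fun j =>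
    ((hQ j).2 e).subset fun q hq => ⟨hq.1, hq.2.2⟩
  refine ⟨fun j => (hfin j).toFinset, fun j q hq h1 h2 => ?_, ?_⟩
  · rw [Set.Finite.mem_toFinset]
    exact ⟨hq, h1, h2⟩
  · exact Finset.sum_congr rfl fun j _ => (Set.ncard_eq_toFinset_card _ (hfin j)).symm

lemma queryCount_union_le (Q : Scheme n) (S T : Set ℝ) :
    queryCount Q (S ∪ T) ≤ queryCount Q S + queryCount Q T := by
  rw [queryCount, queryCount, queryCount, ← Finset.sum_add_distrib]
  refine Finset.sum_le_sum fun i _ => ?_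
  rw [Set.inter_union_distrib_left]
  exact Set.ncard_union_le _ _

/-- The number of queries of a scheme of ply at most `x` is bounded below in terms of the
demand. -/
theorem exists_intervalDemand_le (d : ℕ) {κ : ℝ} (hκ : 1 ≤ κ) :
    ∃ A : ℝ, 0 < A ∧ ∀ {n : ℕ} {ρ : ℝ} {ζ : Fin n → ℝ → Space d} {x y : ℕ}, Setup ρ ζ y →
      1 ≤ κ * lam d y → x ≤ y → ∀ {Q : Scheme n}, IsScheme Q → ∀ {s L w : ℝ}, 0 ≤ s → 0 ≤ L →
      0 < w → (∀ t ∈ Set.Icc s (s + L + w), ply ρ ζ Q t ≤ x) →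
      intervalDemand ρ ζ y s (s + L) ≤
        A * (y / (y + 1 - x)) * queryCount Q (Set.Icc s (s + L + w)) + n * (4 * κ * (L / w)) := by
  obtain ⟨N, hN⟩ := exists_uncrowded d (2 * (40 * κ ^ 2))
  -- Chosen so that δ = 4κ(1 + 2κ)ε equals 1 / (2(1 + 8κN)), whence δ ≤ 1/2 and 16κNδ ≤ 1. The
  -- constant M may then depend on ε, whereas N does not.
  set ε : ℝ := 1 / (8 * κ * (1 + 2 * κ) * (1 + 8 * κ * N)) with hε
  have hP : 1 ≤ 8 * κ * (1 + 2 * κ) := by nlinarith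
  have hNκ : 0 ≤ 8 * κ * N := by positivity
  have hε0 : 0 < ε := by positivity
  have hε1 : ε ≤ 1 := by
    rw [hε, div_le_one (by positivity)]
    nlinarith
  have hδ : 4 * κ * (1 + 2 * κ) * ε = 1 / 2 / (1 + 8 * κ * N) := by
    rw [hε]
    field_simp
    norm_num
  have hδ2 : 4 * κ * (1 + 2 * κ) * ε ≤ 1 / 2 := by
    rw [hδ]
    exact div_le_self (by norm_num) (by linarith)
  have hδN : 16 * κ * N * (4 * κ * (1 + 2 * κ) * ε) ≤ 1 := by
    rw [hδ, mul_div_assoc', div_le_one (by positivity)]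
    linarith
  obtain ⟨M, hM⟩ := exists_uncrowded d ((40 * κ ^ 2) ^ 2 / ε)
  refine ⟨4 * κ * (40 * κ ^ 2) * (M + 1) / ε, by positivity, ?_⟩
  intro n ρ ζ x y hS hκl hxy Q hQ s L w hs hL hw hply
  obtain ⟨Qf, hQf, hcard⟩ := queryCount_eq_sum_card hQ s (s + L + w)
  have hmain := (hS.clusteredMotion hκl).sum_innerDemand_le (hS.queriesClusters hκl hQ hs hply)
    hε0 hε1 hδ2 hxy (hN hS) hδN (hM hS) Qf hQf (mul_pos hS.lam_pos hS.rho_pos)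
    fun i t => hS.xSep_lower (le_max_right t 0) i
  rw [hcard] at hmain
  set q := queryCount Q (Set.Icc s (s + L + w))
  have hm : (0 : ℝ) < y + 1 - x := by
    have : (x : ℝ) ≤ y := by exact_mod_cast hxy
    linarith
  have hmc : ((y + 1 - x : ℕ) : ℝ) = y + 1 - x := by
    rw [Nat.cast_sub (by omega)]
    push_cast
    ring
  have hB : 2 * (((y + 1 - x : ℕ) : ℝ≥0∞)⁻¹ * ((q : ℝ≥0∞) *
      ENNReal.ofReal (2 * κ * (40 * κ ^ 2) * M * y / ε))) =
      ENNReal.ofReal (2 * ((y + 1 - x : ℝ)⁻¹ * (q * (2 * κ * (40 * κ ^ 2) * M * y / ε)))) := by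
    rw [ENNReal.ofReal_mul (by norm_num), ENNReal.ofReal_mul (by positivity),
      ENNReal.ofReal_mul (by positivity), ENNReal.ofReal_inv_of_pos hm, ← hmc,
      ENNReal.ofReal_natCast, ENNReal.ofReal_natCast, ENNReal.ofReal_ofNat]
  rw [hB] at hmain
  have hsum : ENNReal.ofReal (intervalDemand ρ ζ y s (s + L)) ≤ ENNReal.ofReal
      (2 * ((y + 1 - x : ℝ)⁻¹ * (q * (2 * κ * (40 * κ ^ 2) * M * y / ε))) +
        n * (4 * κ * (L / w))) := by
    rw [intervalDemand, ENNReal.ofReal_sum_of_nonneg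
      fun i _ => hS.integral_nonneg i hs (by linarith), ENNReal.ofReal_add (by positivity)
      (by positivity)]
    refine (Finset.sum_le_sum fun i _ => hS.ofReal_integral_le (zero_le_one.trans hκ) i hs hL
      hw).trans ?_
    rw [Finset.sum_add_distrib]
    refine add_le_add hmain (le_of_eq ?_)
    rw [Finset.sum_const, Finset.card_univ, Fintype.card_fin, nsmul_eq_mul,
      ENNReal.ofReal_mul (p := (n : ℝ)) (by positivity), ENNReal.ofReal_natCast]
  refine ((ENNReal.ofReal_le_ofReal_iff (by positivity)).1 hsum).trans ?_
  refine add_le_add ?_ le_rfl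
  calc 2 * ((y + 1 - x : ℝ)⁻¹ * (q * (2 * κ * (40 * κ ^ 2) * M * y / ε)))
      = 4 * κ * (40 * κ ^ 2) * M / ε * (y / (y + 1 - x)) * q := by ring
    _ ≤ _ := by gcongr; linarith

end Clairvoyant

end BucketModel

/-! ### Assembly of the theorem. -/

open BucketModel in
theorem mainTheorem1 (d : ℕ) (hd : 1 ≤ d) :
    ∃ K C c : ℝ, 0 < K ∧ 0 < C ∧ 0 < c ∧
      ∀ (ρ : ℝ), 0 < ρ → ∀ (x : ℕ), xHat d < x → ∀ (β : ℝ), 0 ≤ β →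
      ∀ (y : ℕ), y = ⌊(1 + β) * (x : ℝ)⌋₊ →
      ∀ (n : ℕ), y < n → ∀ (ζ : Fin n → ℝ → Space d), IsMotion ρ ζ →
      ∀ (t₀ : ℝ) (I : Scheme n) (p : Fin n → ℝ), Precondition ρ ζ y t₀ I p →
        Nonempty (BucketRun ρ ζ y t₀ p) ∧
        ∀ R : BucketRun ρ ζ y t₀ p,
          (∀ t, t₀ ≤ t →
            (degree ρ ζ (R.scheme I) t : ℝ) ≤ (1 + β) * x ∧
            (ply ρ ζ (R.scheme I) t : ℝ) ≤ (1 + β) * x) ∧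
          (∀ s L : ℝ, t₀ ≤ s → 0 < L → K * n ≤ intervalDemand ρ ζ y s (s + L) →
            (∀ Q : Scheme n, IsScheme Q →
              (∀ t ∈ Set.Icc s (s + L) ∪ Set.Icc (s + L / 2 ^ 55) (s + L + L / 2 ^ 55),
                ply ρ ζ Q t ≤ x) →
              (β = 0 → (queryCount (R.scheme I) (Set.Icc s (s + L)) : ℝ) ≤
                C * x * max (queryCount Q (Set.Icc s (s + L)) : ℝ)
                  (queryCount Q (Set.Icc (s + L / 2 ^ 55) (s + L + L / 2 ^ 55)) : ℝ)) ∧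
              (0 < β → (queryCount (R.scheme I) (Set.Icc s (s + L)) : ℝ) ≤
                C * ((1 + β) / β) * max (queryCount Q (Set.Icc s (s + L)) : ℝ)
                  (queryCount Q (Set.Icc (s + L / 2 ^ 55) (s + L + L / 2 ^ 55)) : ℝ))) ∧
            c * intervalDemand ρ ζ y s (s + L) ≤
              (queryCount (R.scheme I) (Set.Icc s (s + L)) : ℝ) ∧
            (queryCount (R.scheme I) (Set.Icc s (s + L)) : ℝ) ≤
              C * intervalDemand ρ ζ y s (s + L)) ∧
          (∀ k : ℕ, ∀ t ∈ Set.Icc (R.time k) (R.time (k + 1)),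
            c / demand ρ ζ y t ≤ R.time (k + 1) - R.time k) := by
  obtain ⟨l, hl0, hl⟩ := exists_lam_bound hd
  have hl1 : l < 1 := (hl _ (Nat.lt_succ_self (xHat d))).1.trans_lt (hl _ (Nat.lt_succ_self _)).2
  have hκ : 1 ≤ 1 / l := by rw [le_div_iff₀ hl0]; linarith
  have hκ0 : 0 < 1 / l := by positivity
  obtain ⟨A, hA0, hA⟩ := exists_intervalDemand_le d hκ
  set κ := 1 / l with hκdef
  -- The first summand of K makes the boundary term 4κ 2^55 n at most half the demand; the second
  -- gives demand at least 2n, which absorbs the error n in the count of queries.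
  refine ⟨8 * κ * 2 ^ 55 + 2, (132 * κ + 1) * (4 * A + 1), l / 416, by positivity, by positivity,
    by positivity, ?_⟩
  intro ρ hρ x hx β hβ y hy n hn ζ hζ t₀ I p hP
  have hx0 : (1 : ℝ) ≤ x := by exact_mod_cast (Nat.zero_le (xHat d)).trans_lt hx
  have hprod : (0 : ℝ) ≤ (1 + β) * x := by positivity
  have hyle : (y : ℝ) ≤ (1 + β) * x := by rw [hy]; exact Nat.floor_le hprod
  have hylt : (1 + β) * x < y + 1 := by rw [hy]; exact Nat.lt_floor_add_one _
  have hxy : x ≤ y := by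
    rw [hy]
    exact Nat.le_floor (by nlinarith)
  have hS : Setup ρ ζ y := Setup.of_xHat_lt hd hρ (hx.trans_le hxy) hn hζ
  have hlam := (hl y (hx.trans_le hxy)).1
  have hκl : 1 ≤ κ * lam d y := by
    rw [hκdef, one_div, ← div_eq_inv_mul, le_div_iff₀ hl0]
    linarith
  refine ⟨nonempty_bucketRun ρ ζ y (by omega) t₀ p, fun R => ⟨fun t ht => ?_, ?_, ?_⟩⟩
  · obtain ⟨k, hk, hkt⟩ := R.exists_state hS hP ht
    have h1 := R.degree_le hS hP hk hkt
    have h2 := (ply_le_degree ρ ζ (R.scheme I) t).trans h1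
    exact ⟨(Nat.cast_le.2 h1).trans hyle, (Nat.cast_le.2 h2).trans hyle⟩
  · intro s L hs hL hΦ
    have hs0 : 0 ≤ s := (hP.pos hS).le.trans hs
    obtain ⟨hN1, hN2⟩ := R.queryCount_bounds hS hP hs (show s ≤ s + L by linarith)
    set Φ := intervalDemand ρ ζ y s (s + L)
    set q := queryCount (R.scheme I) (Set.Icc s (s + L))
    have hn0 : (0 : ℝ) ≤ n := Nat.cast_nonneg n
    have hnκ : 0 ≤ 8 * κ * 2 ^ 55 * n := by positivity
    have hΦn : 2 * n ≤ Φ := by linarith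
    have hqΦ : (q : ℝ) ≤ (132 * κ + 1) * Φ := by
      have h1 : l / 132 * (q - n) ≤ Φ := by
        rcases le_total (q : ℝ) n with h | h
        · exact (mul_nonpos_of_nonneg_of_nonpos (by positivity) (by linarith)).trans
            (by linarith)
        · refine le_trans ?_ hN2
          gcongr
      have h2 : (q : ℝ) - n = 132 * κ * (l / 132 * (q - n)) := by
        rw [hκdef]
        field_simp
      have h3 : 132 * κ * (l / 132 * (q - n)) ≤ 132 * κ * Φ := by gcongr
      linarith
    have hclair : ∀ Q : Scheme n, IsScheme Q →
        (∀ t ∈ Set.Icc s (s + L) ∪ Set.Icc (s + L / 2 ^ 55) (s + L + L / 2 ^ 55),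
          ply ρ ζ Q t ≤ x) → (q : ℝ) ≤ (132 * κ + 1) * (4 * A + 1) * (y / (y + 1 - x)) *
            max (queryCount Q (Set.Icc s (s + L)) : ℝ)
              (queryCount Q (Set.Icc (s + L / 2 ^ 55) (s + L + L / 2 ^ 55)) : ℝ) := by
      intro Q hQ hply
      have hw : 0 < L / 2 ^ 55 := by positivity
      have hwL : L / 2 ^ 55 ≤ L := div_le_self hL.le (by norm_num)
      -- The two intervals overlap, so the ply is controlled on the whole of the extended interval.
      have hsub : Set.Icc s (s + L + L / 2 ^ 55) =
          Set.Icc s (s + L) ∪ Set.Icc (s + L / 2 ^ 55) (s + L + L / 2 ^ 55) := by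
        rw [Set.Icc_union_Icc' (by linarith) (by linarith), min_eq_left (by linarith),
          max_eq_right (by linarith)]
      have h1 := hA hS hκl hxy hQ hs0 hL.le hw (by rwa [hsub])
      have h2 : L / (L / 2 ^ 55) = 2 ^ 55 := by field_simp
      rw [hsub, h2] at h1
      have h3 := queryCount_union_le Q (Set.Icc s (s + L))
        (Set.Icc (s + L / 2 ^ 55) (s + L + L / 2 ^ 55))
      set q₁ := queryCount Q (Set.Icc s (s + L))
      set q₂ := queryCount Q (Set.Icc (s + L / 2 ^ 55) (s + L + L / 2 ^ 55))
      have hm0 : (0 : ℝ) < y + 1 - x := by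
        have : (x : ℝ) ≤ y := by exact_mod_cast hxy
        linarith
      set m : ℝ := max q₁ q₂
      have hm : (0 : ℝ) ≤ m := (Nat.cast_nonneg q₁).trans (le_max_left _ _)
      have h4 : (queryCount Q (Set.Icc s (s + L) ∪
          Set.Icc (s + L / 2 ^ 55) (s + L + L / 2 ^ 55)) : ℝ) ≤ 2 * m := by
        have h5 : (q₁ : ℝ) ≤ m := le_max_left _ _
        have h6 : (q₂ : ℝ) ≤ m := le_max_right _ _
        have h7 := (Nat.cast_le (α := ℝ)).2 h3
        push_cast at h7
        linarith
      have h5 : A * (y / (y + 1 - x)) * (queryCount Q (Set.Icc s (s + L) ∪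
          Set.Icc (s + L / 2 ^ 55) (s + L + L / 2 ^ 55)) : ℝ) ≤
          A * (y / (y + 1 - x)) * (2 * m) := by gcongr
      have h6 : Φ ≤ (4 * A) * (y / (y + 1 - x)) * m := by linarith
      calc (q : ℝ) ≤ (132 * κ + 1) * Φ := hqΦ
        _ ≤ (132 * κ + 1) * ((4 * A) * (y / (y + 1 - x)) * m) := by gcongr
        _ ≤ (132 * κ + 1) * ((4 * A + 1) * (y / (y + 1 - x)) * m) := by gcongr; linarith
        _ = _ := by ring
    refine ⟨fun Q hQ hply => ⟨fun hβ0 => ?_, fun hβ0 => ?_⟩, ?_, ?_⟩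
    · refine (hclair Q hQ hply).trans (le_of_eq ?_)
      have hyx : (y : ℝ) = x := by
        rw [hβ0, add_zero, one_mul] at hyle
        exact le_antisymm hyle (by exact_mod_cast hxy)
      rw [hyx, add_sub_cancel_left, div_one]
    · refine (hclair Q hQ hply).trans ?_
      -- Since y ≤ (1 + β)x < y + 1, the denominator exceeds βx.
      have h1 : (y : ℝ) / (y + 1 - x) ≤ (1 + β) / β := by
        calc (y : ℝ) / (y + 1 - x) ≤ (1 + β) * x / (β * x) := by
              gcongr
              linarith
          _ = _ := by field_simp
      gcongr
    · have : l / 416 * Φ ≤ 1 / 2 * Φ := by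
        gcongr
        · linarith
        · linarith
      linarith
    · refine hqΦ.trans ?_
      have hΦ0 : 0 ≤ Φ := by linarith
      rw [mul_right_comm]
      exact le_mul_of_one_le_right (by positivity) (by linarith)
  · intro k t ht
    refine le_trans ?_ (R.granularity hS hP k ht)
    have ht0 : 0 ≤ t := (R.time_nonneg hS hP k).trans ht.1
    have := hS.demand_pos ht0
    gcongr
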